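/- **Setting.** An ordered Bratteli diagram $x=(B,\le_r)$ consists of finite non-empty vertex sets $V_k$ ($k\ge 0$), finite edge sets $E_k$ ($k\ge 1$) with surjective source and range maps $s:E_k\to V_{k-1}$, $r:E_k\to V_k$, and a linear order on $r^{-1}(v)$ for every $v\in V_k$, $k\geq 1$. The orders induce the lexicographic order on the finite paths from a given level to a given vertex (the highest edge at which two paths differ decides). Let $X_B$ be the space of infinite paths $p=(p_1,p_2,\dots)$, $p_k\in E_k$, $r(p_k)=s(p_{k+1})$, and, for $\lambda>1$, let $d_\lambda(p,q)=\lambda^{-k+1}$ with $k$ the smallest index such that $p_k\ne q_k$ (and $d_\lambda(p,p)=0$). Write $s(p)=s(p_1)\in V_0$. The diagram is *strongly minimal* if for every $k$ there is an $\ell$ such that any $v\in V_k$, $w\in V_{k+\ell}$ are joined by at least two paths, and *properly ordered* if it has exactly one path $x^-$ with all edges minimal and exactly one path $x^+$ with all edges maximal. In that case the adic map $\phi:X_B\to X_B$ sends $p\neq x^+$ to its successor and $x^+$ to $x^-$. Let $A_k$ be the $V_k\times V_{k-1}$ matrix whose $(v,u)$ entry is the number of edges from $u$ to $v$, and $\mathcal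 A_{(k)}=A_k\cdots A_1$. Let $\mathcal O_\beth$ be the space of ordered Bratteli diagrams with the Borel $\sigma$-algebra of the cylinder topology, and let $\sigma$ be the shift on it, which removes the first level. A diagram is *Kesten–Furstenberg regular* with growth rate $\lambda>0$ if $\frac1n\log\|\mathcal A_{(n)}w\|\to\log\lambda$ for every $w\in\mathbb R^{V_0}$ with positive entries. **Solenoid.** Let $x$ be properly ordered, $\lambda>1$, and $l\in\mathbb R^{V_0}$ with positive entries. The metric graph $\Gamma^k_x$ has one oriented edge $e_v$ of length $\lambda^{-k}(\mathcal A_{(k)}l)_v$ for each $v\in V_k$; the end of $e_{v_1}$ is glued to the beginning of $e_{v_2}$ if there are a vertex $w$ of a higher level and paths from $v_1$ and from $v_2$ to $w$ such that the second is the successor of the first among all paths from $V_k$ to $w$, or if $v_1=s(x^+_{k+1})$ and $v_2=s(x^-_{k+1})$. Let $d_k$ be the path metric of $\Gamma_x^k$. The map $\gamma_k:\Gamma^k_x\to\Gamma^{k-1}_x$ stretches $e_v$ by $\lambda$ and wraps it along $e_{s(f_1)}e_{s(f_2)}\cdots e_{s(f_j)}$, where $r^{-1}(v)=\{f_1<\dots<f_j\}$.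 Let $\Omega_x=\varprojlim(\Gamma^k_x,\gamma_k)$, with $\bar d_\lambda(y,z)=\sum_{k\ge0}\lambda^{-k}d_k(y_k,z_k)/\mathrm{diam}(\Gamma^k_x)$, and let $\mho_x$ be the set of $z\in\Omega_x$ such that $z_0$ is a vertex of $\Gamma_x^0$. The natural $\mathbb R$-action $\varphi$ on $\Omega_x$ is the flow such that $\varphi_t(z)_k=z_k+\lambda^{-k}t$ as long as $z_k$ and $z_k+\lambda^{-k}t$ lie in the interior of the same edge, and which, at a point all of whose coordinates are vertices, moves for small $t>0$ forward from the beginnings of the edges $e_{s(x^-_{k+1})}$ and for small $t<0$ backward from the ends of the edges $e_{s(x^+_{k+1})}$, at speed $\lambda^{-k}$ in $\Gamma^k_x$. Let $\hat X_B$ be the suspension of $\phi$ with roof function $p\mapsto l_{s(p)}$, that is, $X_B\times\mathbb R$ modulo $(p,t+l_{s(p)})\sim(\phi(p),t)$, with the special flow $(p,s)\mapsto(p,s+t)$; $X_B$ is identified with the set of the classes of $(p,0)$. **Proposition.** Let $\mu$ be a $\sigma$-invariant ergodic probability measure on $\mathcal O_\beth$ such that $\mu$-almost every diagram is strongly minimal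 and properly ordered and satisfies: for all $\varepsilon>0$ there is a $K_\varepsilon$ with $|V_k|\le K_\varepsilon e^{\varepsilon k}$ for all $k\geq 0$. Let $\lambda_\mu$ be the exponential of the Lyapunov exponent of $\mu$. Then for $\mu$-almost every diagram $x=(B,\le_r)$ that is Kesten–Furstenberg regular with growth rate $\lambda_\mu$ the following holds: $\lambda_\mu>1$, and for every $l\in\mathbb R^{V_0}$ with positive entries, with $\lambda=\lambda_\mu$ above, the natural $\mathbb R$-action on $\Omega_x$ exists, is unique and continuous, and is conjugate to the special flow over $\phi$ with roof function $l$, by a homeomorphism $\varpi:\hat X_B\to\Omega_x$ with $\varpi(X_B)=\mho_x$ and such that $$\forall\varepsilon\in(0,1)\ \exists K>0\ \forall p,q\in X_B:\quad K\,d_{\lambda_\mu}(p,q)^{1+\varepsilon}\le\bar d_{\lambda_\mu}(\varpi(p),\varpi(q)),$$ $$\bar d_{\lambda_\mu}(\varpi(p),\varpi(q))\le\frac{d_{\lambda_\mu}(p,q)}{\lambda_\mu-1}\quad\text{for all } p,q\in X_B\text{ with } s(p)=s(q),$$ $$\bar d_{\lambda_\mu}(\varpi(p),\varpi(q))\le\frac{\lambda_\mu\,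 d_{\lambda_\mu}(p,q)}{\lambda_\mu-1}\quad\text{for all } p,q\in X_B.$$ -/

import Mathlib

open MeasureTheory Filter Topology

/-- An ordered Bratteli diagram. The vertices of level `k` are `Fin (nV k)`. For a vertex `v` of
level `k + 1`, `into k v` lists the sources (vertices of level `k`) of the edges with range `v`, in
the order that is prescribed on `r⁻¹(v)`; so it encodes the edges, with multiplicity, together with
their order. The source and range maps are onto. -/
structure OrderedBratteli where
  nV : ℕ → ℕ
  nV_pos : ∀ k, 0 < nV k
  into : ∀ k, Fin (nV (k + 1)) → List (Fin (nV k))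
  into_ne_nil : ∀ k v, into k v ≠ []
  source_surj : ∀ k u, ∃ v, u ∈ into k v

namespace OrderedBratteli

/-- The vertices of level `k`. -/
abbrev V (x : OrderedBratteli) (k : ℕ) : Type := Fin (x.nV k)

/-- The data of a diagram at one site: two consecutive vertex sets and the ordered edges between
them. -/
abbrev Site : Type := Σ m n : ℕ, (Fin n → List (Fin m))

/-- The data of `x` between the levels `k` and `k + 1`. -/
def site (x : OrderedBratteli) (k : ℕ) : Site := ⟨x.nV k, x.nV (k + 1), x.into k⟩

/-- The σ-algebra generated by the cylinder sets `{x | x.site k = a}`. As there are countably many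
possible sites, it is the Borel σ-algebra of the cylinder topology. -/
instance : MeasurableSpace OrderedBratteli :=
  ⨆ k : ℕ, MeasurableSpace.comap (fun x : OrderedBratteli => x.site k) ⊤

/-- The shift, which removes the first level. -/
def shift (x : OrderedBratteli) : OrderedBratteli where
  nV k := x.nV (k + 1)
  nV_pos k := x.nV_pos (k + 1)
  into k := x.into (k + 1)
  into_ne_nil k := x.into_ne_nil (k + 1)
  source_surj k := x.source_surj (k + 1)

/-! ### Edges and paths -/

/-- The edges between the levels `k` and `k + 1`: a range together with a position in `r⁻¹(v)`. -/
abbrev Edge (x : OrderedBratteli) (k : ℕ) : Type :=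
  Σ v : x.V (k + 1), Fin (x.into k v).length

variable {x : OrderedBratteli}

/-- The range of an edge. -/
def ran {k : ℕ} (e : x.Edge k) : x.V (k + 1) := e.1

/-- The source of an edge. -/
def src {k : ℕ} (e : x.Edge k) : x.V k := (x.into k e.1).get e.2

/-- `e < f`, for two edges with the same range. -/
def EdgeLt {k : ℕ} (e f : x.Edge k) : Prop := e.1 = f.1 ∧ (e.2 : ℕ) < (f.2 : ℕ)

/-- `e` is the first edge of `r⁻¹(r(e))`. -/
def IsMinEdge {k : ℕ} (e : x.Edge k) : Prop := ∀ f : x.Edge k, ¬ EdgeLt f e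

/-- `e` is the last edge of `r⁻¹(r(e))`. -/
def IsMaxEdge {k : ℕ} (e : x.Edge k) : Prop := ∀ f : x.Edge k, ¬ EdgeLt e f

/-- The finite paths from level `m` to level `n`. -/
def FinPath (x : OrderedBratteli) (m n : ℕ) : Type :=
  {e : ∀ i, m ≤ i → i < n → x.Edge i //
    ∀ i (h₁ : m ≤ i) (h₂ : i + 1 < n),
      ran (e i h₁ (Nat.lt_of_succ_lt h₂)) = src (e (i + 1) (Nat.le_succ_of_le h₁) h₂)}

/-- The lexicographic order on the finite paths with a given range; the edge of the highest level
at which the two paths differ decides. Two comparable paths have the same range. -/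
def FinPath.Lt {m n : ℕ} (e f : FinPath x m n) : Prop :=
  ∃ j, ∃ (h₁ : m ≤ j) (h₂ : j < n), EdgeLt (e.1 j h₁ h₂) (f.1 j h₁ h₂) ∧
    ∀ i (h₃ : m ≤ i) (h₄ : i < n), j < i → e.1 i h₃ h₄ = f.1 i h₃ h₄

/-- `f` is the successor of `e` among the paths from level `m` with the same range. -/
def FinPath.IsSucc {m n : ℕ} (e f : FinPath x m n) : Prop :=
  e.Lt f ∧ ∀ g : FinPath x m n, ¬ (e.Lt g ∧ g.Lt f)

/-- The space `X_B` of infinite paths, with the topology induced by the product of the finite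
discrete edge sets. The edge between the levels `k` and `k + 1` has index `k`. -/
abbrev PathSpace (x : OrderedBratteli) : Type :=
  {p : ∀ k, x.Edge k // ∀ k, ran (p k) = src (p (k + 1))}

/-- The initial segment of an infinite path up to level `n`. -/
def PathSpace.take (p : x.PathSpace) (n : ℕ) : FinPath x 0 n :=
  ⟨fun i _ _ => p.1 i, fun i _ _ => p.2 i⟩

/-- A path all of whose edges are minimal. -/
def IsMinPath (p : x.PathSpace) : Prop := ∀ k, IsMinEdge (p.1 k)

/-- A path all of whose edges are maximal. -/
def IsMaxPath (p : x.PathSpace) : Prop := ∀ k, IsMaxEdge (p.1 k)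

/-- Strong minimality: for every level there is a later one such that any vertex of the first and
any vertex of the second are joined by at least two paths. -/
def StronglyMinimal (x : OrderedBratteli) : Prop :=
  ∀ k, ∃ j, ∀ (v : x.V k) (w : x.V (k + j + 1)), ∃ p q : FinPath x k (k + j + 1), p ≠ q ∧
    src (p.1 k le_rfl (by omega)) = v ∧ ran (p.1 (k + j) (by omega) (by omega)) = w ∧
    src (q.1 k le_rfl (by omega)) = v ∧ ran (q.1 (k + j) (by omega) (by omega)) = w

/-- There are exactly one minimal and exactly one maximal infinite path. -/
def ProperlyOrdered (x : OrderedBratteli) : Prop :=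
  (∃! p : x.PathSpace, IsMinPath p) ∧ (∃! p : x.PathSpace, IsMaxPath p)

/-- The number of vertices grows subexponentially. -/
def SubexponentialVertices (x : OrderedBratteli) : Prop :=
  ∀ ε : ℝ, 0 < ε → ∃ K : ℝ, ∀ k : ℕ, (x.nV k : ℝ) ≤ K * Real.exp (ε * k)

/-- `q` is the successor of `p`: with `n` the first index at which `p` is not maximal, the initial
segment of `q` up to the edge `n` follows that of `p`, and the later edges agree. -/
def IsSuccessor (p q : x.PathSpace) : Prop :=
  ∃ n, (∀ i < n, IsMaxEdge (p.1 i)) ∧ ¬ IsMaxEdge (p.1 n) ∧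
    (PathSpace.take p (n + 1)).IsSucc (PathSpace.take q (n + 1)) ∧ ∀ i, n < i → q.1 i = p.1 i

/-- The graph of the adic map: successor, and the maximal path goes to the minimal one. -/
def AdicStep (p q : x.PathSpace) : Prop := IsSuccessor p q ∨ (IsMaxPath p ∧ IsMinPath q)

open Classical in
/-- The adic (Vershik) transformation of `X_B`; on a properly ordered diagram every path has
exactly one image under `AdicStep`, so the default value is not used. -/
noncomputable def adic (p : x.PathSpace) : x.PathSpace :=
  if h : ∃ q, AdicStep p q then h.choose else p

/-- The metric `d_λ` on `X_B`: `λ^{-i}` if the first `i` edges agree and the next ones do not. -/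
noncomputable def pathDist (lam : ℝ) (p q : x.PathSpace) : ℝ :=
  open Classical in if p = q then 0 else (lam⁻¹) ^ sInf {i : ℕ | p.1 i ≠ q.1 i}

/-! ### The renormalization cocycle -/

/-- The incidence matrix between the levels `k` and `k + 1`: the entry at `(v, u)` is the number
of edges from `u` to `v`. -/
def incidence (x : OrderedBratteli) (k : ℕ) : Matrix (x.V (k + 1)) (x.V k) ℝ :=
  fun v u => ((x.into k v).count u : ℝ)

/-- The product of the first `k` incidence matrices. -/
noncomputable def cocycle (x : OrderedBratteli) : ∀ k, Matrix (x.V k) (x.V 0) ℝ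
  | 0 => 1
  | k + 1 => x.incidence k * cocycle x k

/-- `x` is Kesten–Furstenberg regular with growth rate `lam`: every positive vector grows under the
cocycle at the exponential rate `log lam` (in the sup norm). -/
def IsKFRegular (x : OrderedBratteli) (lam : ℝ) : Prop :=
  0 < lam ∧ ∀ w : x.V 0 → ℝ, (∀ v, 0 < w v) →
    Tendsto (fun n : ℕ => Real.log ‖(x.cocycle n).mulVec w‖ / n) atTop (𝓝 (Real.log lam))

/-! ### The metric graphs and the solenoid -/

/-- The length `λ^{-k} (A_k ⋯ A_1 l)_v` of the edge `e_v` of the `k`-th graph. -/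
noncomputable def len (x : OrderedBratteli) (lam : ℝ) (l : x.V 0 → ℝ) (k : ℕ) (v : x.V k) : ℝ :=
  (lam⁻¹) ^ k * (x.cocycle k).mulVec l v

/-- The end of `e_{v₁}` is glued to the beginning of `e_{v₂}`. -/
def Adjacent (x : OrderedBratteli) (k : ℕ) (v₁ v₂ : x.V k) : Prop :=
  (∃ n, ∃ h : k < n, ∃ e f : FinPath x k n,
    src (e.1 k le_rfl h) = v₁ ∧ src (f.1 k le_rfl h) = v₂ ∧ e.IsSucc f) ∨
  (∃ pmax pmin : x.PathSpace, IsMaxPath pmax ∧ IsMinPath pmin ∧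
    src (pmax.1 k) = v₁ ∧ src (pmin.1 k) = v₂)

/-- The disjoint union of the edges `e_v = [0, |e_v|]`. -/
abbrev PreGraph (x : OrderedBratteli) (lam : ℝ) (l : x.V 0 → ℝ) (k : ℕ) : Type :=
  Σ v : x.V k, Set.Icc (0 : ℝ) (x.len lam l k v)

/-- The graph `Γ^k`, with the quotient topology. `Quot` divides by the equivalence relation that
the gluing generates. -/
abbrev Graph (x : OrderedBratteli) (lam : ℝ) (l : x.V 0 → ℝ) (k : ℕ) : Type :=
  Quot (fun a b : x.PreGraph lam l k =>
    x.Adjacent k a.1 b.1 ∧ (a.2 : ℝ) = x.len lam l k a.1 ∧ (b.2 : ℝ) = 0)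

variable {lam : ℝ} {l : x.V 0 → ℝ}

/-- The point of `Γ^k` at position `s` on the edge `e_v`. -/
def pt {k : ℕ} (v : x.V k) (s : Set.Icc (0 : ℝ) (x.len lam l k v)) : x.Graph lam l k :=
  Quot.mk _ ⟨v, s⟩

/-- The vertices of the graph `Γ^k`. -/
def IsVertex {k : ℕ} (y : x.Graph lam l k) : Prop :=
  ∃ v, ∃ s : Set.Icc (0 : ℝ) (x.len lam l k v),
    y = pt v s ∧ ((s : ℝ) = 0 ∨ (s : ℝ) = x.len lam l k v)

/-- `Joined a b L`: there is a path of length `L` from `a` to `b` that consists of finitely many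
segments of edges. -/
inductive Joined {k : ℕ} (a : x.Graph lam l k) : x.Graph lam l k → ℝ → Prop
  | refl : Joined a a 0
  | step (v : x.V k) (s t : Set.Icc (0 : ℝ) (x.len lam l k v)) (L : ℝ) :
      Joined a (pt v s) L → Joined a (pt v t) (L + |(s : ℝ) - t|)

/-- The path metric `d_k` of the graph `Γ^k`. -/
noncomputable def graphDist {k : ℕ} (a b : x.Graph lam l k) : ℝ := sInf {L | Joined a b L}

/-- The diameter of `Γ^k`. -/
noncomputable def graphDiam (x : OrderedBratteli) (lam : ℝ) (l : x.V 0 → ℝ) (k : ℕ) : ℝ :=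
  sSup {r | ∃ a b : x.Graph lam l k, r = graphDist a b}

/-- The graph of the map `γ : Γ^{k+1} → Γ^k`, which stretches `e_v` by `λ` and wraps it along the
concatenation of the edges `e_{s(e)}`, `e ∈ r⁻¹(v)`, in their order: the point `s` of `e_{r(e)}`
goes to the point `t` of `e_{s(e)}` if `λ s` is `t` plus the lengths of the preceding edges. -/
def Wraps {k : ℕ} (z : x.Graph lam l (k + 1)) (y : x.Graph lam l k) : Prop :=
  ∃ (e : x.Edge k) (s : Set.Icc (0 : ℝ) (x.len lam l (k + 1) (ran e)))
    (t : Set.Icc (0 : ℝ) (x.len lam l k (src e))),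
    z = pt (ran e) s ∧ y = pt (src e) t ∧
    lam * (s : ℝ) =
      (∑ j ∈ Finset.univ.filter (fun j : Fin (x.into k e.1).length => j < e.2),
        x.len lam l k ((x.into k e.1).get j)) + t

/-- The solenoid: the inverse limit of the graphs `Γ^k` along the maps `γ`, with the topology
induced by the product. -/
abbrev Solenoid (x : OrderedBratteli) (lam : ℝ) (l : x.V 0 → ℝ) : Type :=
  {z : ∀ k, x.Graph lam l k // ∀ k, Wraps (z (k + 1)) (z k)}

/-- The metric `∑ λ^{-k} d_k(y_k, z_k) / diam Γ^k` on the solenoid. -/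
noncomputable def solenoidDist (y z : x.Solenoid lam l) : ℝ :=
  ∑' k : ℕ, (lam⁻¹) ^ k * (graphDist (y.1 k) (z.1 k) / x.graphDiam lam l k)

/-- The set `℧` of the points of the solenoid over the vertices of `Γ^0`. -/
def mho (x : OrderedBratteli) (lam : ℝ) (l : x.V 0 → ℝ) : Set (x.Solenoid lam l) :=
  {z | IsVertex (z.1 0)}

/-- The natural `ℝ`-action on the solenoid. If `z_k` is an interior point of an edge of `Γ^k`, then
for small `t` the `k`-th coordinate of `φ_t(z)` is `z_k + λ^{-k} t`, as long as this stays inside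
that edge. If every `z_k` is a vertex, then for small `t > 0` the point `φ_t(z)` moves along the
edges that the minimal path visits, starting at their beginnings, and `φ_{-t}(z)` moves backwards
along the edges that the maximal path visits, starting at their ends. -/
structure IsNaturalFlow (Φ : Flow ℝ (x.Solenoid lam l)) : Prop where
  translate : ∀ (z : x.Solenoid lam l) (k : ℕ) (v : x.V k)
    (s s' : Set.Icc (0 : ℝ) (x.len lam l k v)) (t : ℝ),
    z.1 k = pt v s → 0 < (s : ℝ) → (s : ℝ) < x.len lam l k v →
    0 < (s' : ℝ) → (s' : ℝ) < x.len lam l k v → (s' : ℝ) = s + (lam⁻¹) ^ k * t →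
    (Φ t z).1 k = pt v s'
  forward : ∀ z : x.Solenoid lam l, (∀ k, IsVertex (z.1 k)) →
    ∀ p : x.PathSpace, IsMinPath p → ∀ t : ℝ, 0 < t → t < l (src (p.1 0)) →
    ∀ k, ∃ s : Set.Icc (0 : ℝ) (x.len lam l k (src (p.1 k))),
      (s : ℝ) = (lam⁻¹) ^ k * t ∧ (Φ t z).1 k = pt (src (p.1 k)) s
  backward : ∀ z : x.Solenoid lam l, (∀ k, IsVertex (z.1 k)) →
    ∀ p : x.PathSpace, IsMaxPath p → ∀ t : ℝ, 0 < t → t < l (src (p.1 0)) →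
    ∀ k, ∃ s : Set.Icc (0 : ℝ) (x.len lam l k (src (p.1 k))),
      (s : ℝ) = x.len lam l k (src (p.1 k)) - (lam⁻¹) ^ k * t ∧
      (Φ (-t) z).1 k = pt (src (p.1 k)) s

/-! ### The special flow -/

/-- The suspension of the adic map with roof function `p ↦ l (s(p))`: the quotient of
`X_B × ℝ` by `(p, t + l(s(p))) ∼ (adic p, t)`, with the quotient topology. -/
abbrev Suspension (x : OrderedBratteli) (l : x.V 0 → ℝ) : Type :=
  Quot (fun a b : x.PathSpace × ℝ => b.1 = adic a.1 ∧ a.2 = b.2 + l (src (a.1.1 0)))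

/-- The special flow: translation of the second coordinate. -/
def specialFlow (t : ℝ) : x.Suspension l → x.Suspension l :=
  Quot.map (fun a => (a.1, a.2 + t)) fun a b h => ⟨h.1, by
    change a.2 + t = b.2 + t + l (src (a.1.1 0))
    rw [h.2]; ring⟩

/-- The inclusion of `X_B` into the suspension, at height `0`. -/
def base (l : x.V 0 → ℝ) (p : x.PathSpace) : x.Suspension l := Quot.mk _ (p, 0)

end OrderedBratteli

/-! Over every vertex `v` of level `k` stands a tower of height `ht l k v`, the length of the edge
`e_v` before the rescaling by `λ^{-k}`. A path `p` singles out one floor of the tower over its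
vertex at level `k`; that floor starts at `hgt l p k`, the total weight of the initial segments
preceding that of `p`, and `rest l p k` is what lies above its start. The adic map is an odometer
that climbs one floor at a time, and from the top floor of a tower it goes to the bottom of an
adjacent one; this is how the ends of the edges are glued. So `(p, t)` ↦ (the points at heights `hgt
l p k + t`)`_k` respects the suspension relation (`baseParam_glue`) and extends to `X_B × ℝ`
(`param`). It is onto by compactness. It is injective on the suspension because interior points of
edges remember edge and height, and the only point without interior coordinates is the minimal path
at height 0. A continuous bijection from a compact to a Hausdorff space is a homeomorphism, and the
transported special flow is the natural flow. For uniqueness (`IsNaturalFlow.eq_naturalFlow`), a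
given motion takes place inside one edge at all high levels, except on the orbit of the vertex
point, where the clauses at vertices decide.

The upper bounds hold since paths that agree for a while give points with the same first
coordinates, and the remaining terms of the metric are at most `λ^{-k}`.

For the lower bound, let `p` and `q` separate at `n`. Suppose that a block of `N` levels which
doubles all heights ends before `n`, and that a block through which all minimal paths, and all
maximal paths, have a common source begins after `n`. Then at the level `M` where the second block
ends, the two points are at distance at least `λ^{-M} m`, with `m` the largest height at the start
of the first block (`le_solenoidDist_of_isBlock`). Regularity and the subexponential number of
vertices turn this into `λ^{-n(1+ε)}`, provided that both blocks lie within `o(n)` of `n`.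

Ergodicity supplies such blocks. Strong minimality and proper ordering make some fixed `N` good on a
set of positive measure; an inequality of Kac type with the Borel–Cantelli lemma makes the gaps
between visits sublinear (`Ergodic.ae_exists_visit_le`). The same visits double the smallest height
with non-vanishing frequency, which forces `λ > 1` (`one_lt_of_isKFRegular`). -/

namespace OrderedBratteli

variable {x : OrderedBratteli}

/-! ### Minimal and maximal edges -/

theorem Edge.ext_val {k : ℕ} {e f : x.Edge k} (h₁ : e.1 = f.1) (h₂ : (e.2 : ℕ) = f.2) : e = f := by
  obtain ⟨v, i⟩ := e
  obtain ⟨w, j⟩ := f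
  obtain rfl : v = w := h₁
  obtain rfl : i = j := Fin.ext h₂
  rfl

/-- The first edge with range `v`. -/
def minEdge {k : ℕ} (v : x.V (k + 1)) : x.Edge k :=
  ⟨v, ⟨0, List.length_pos_of_ne_nil (x.into_ne_nil k v)⟩⟩

/-- The last edge with range `v`. -/
def maxEdge {k : ℕ} (v : x.V (k + 1)) : x.Edge k :=
  ⟨v, ⟨(x.into k v).length - 1,
    Nat.sub_lt (List.length_pos_of_ne_nil (x.into_ne_nil k v)) one_pos⟩⟩

@[simp] theorem ran_minEdge {k : ℕ} (v : x.V (k + 1)) : ran (minEdge v) = v := rfl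

@[simp] theorem ran_maxEdge {k : ℕ} (v : x.V (k + 1)) : ran (maxEdge v) = v := rfl

theorem isMinEdge_iff {k : ℕ} (e : x.Edge k) : IsMinEdge e ↔ (e.2 : ℕ) = 0 := by
  constructor
  · intro h
    by_contra h0
    exact h (minEdge e.1) ⟨rfl, Nat.pos_of_ne_zero h0⟩
  · rintro h f ⟨-, hf⟩
    omega

theorem isMaxEdge_iff {k : ℕ} (e : x.Edge k) :
    IsMaxEdge e ↔ (e.2 : ℕ) + 1 = (x.into k e.1).length := by
  have he := e.2.2
  constructor
  · intro h
    by_contra h0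
    exact h ⟨e.1, ⟨e.2 + 1, by omega⟩⟩ ⟨rfl, Nat.lt_succ_self _⟩
  · rintro h ⟨w, j⟩ ⟨hf1, hf⟩
    obtain rfl : e.1 = w := hf1
    have := j.2
    simp only at hf
    omega

theorem isMinEdge_minEdge {k : ℕ} (v : x.V (k + 1)) : IsMinEdge (minEdge v) :=
  (isMinEdge_iff _).2 rfl

theorem isMaxEdge_maxEdge {k : ℕ} (v : x.V (k + 1)) : IsMaxEdge (maxEdge v) := by
  rw [isMaxEdge_iff]
  have := List.length_pos_of_ne_nil (x.into_ne_nil k v)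
  simp only [maxEdge]
  omega

theorem IsMinEdge.eq_minEdge {k : ℕ} {e : x.Edge k} (h : IsMinEdge e) : e = minEdge (ran e) :=
  Edge.ext_val rfl ((isMinEdge_iff e).1 h)

theorem IsMaxEdge.eq_maxEdge {k : ℕ} {e : x.Edge k} (h : IsMaxEdge e) : e = maxEdge (ran e) := by
  refine Edge.ext_val rfl ?_
  have := (isMaxEdge_iff e).1 h
  simp only [maxEdge, ran]
  omega

theorem IsMinEdge.eq_of_ran_eq {k : ℕ} {e f : x.Edge k} (he : IsMinEdge e) (hf : IsMinEdge f)
    (h : ran e = ran f) : e = f := by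
  rw [he.eq_minEdge, hf.eq_minEdge, h]

theorem IsMaxEdge.eq_of_ran_eq {k : ℕ} {e f : x.Edge k} (he : IsMaxEdge e) (hf : IsMaxEdge f)
    (h : ran e = ran f) : e = f := by
  rw [he.eq_maxEdge, hf.eq_maxEdge, h]

theorem edgeLt_or_edgeLt {k : ℕ} {e f : x.Edge k} (h : ran e = ran f) (hne : e ≠ f) :
    EdgeLt e f ∨ EdgeLt f e := by
  rcases lt_trichotomy (e.2 : ℕ) f.2 with h' | h' | h'
  · exact Or.inl ⟨h, h'⟩
  · exact absurd (Edge.ext_val h h') hne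
  · exact Or.inr ⟨h.symm, h'⟩

theorem EdgeLt.trans {k : ℕ} {e f g : x.Edge k} (h : EdgeLt e f) (h' : EdgeLt f g) :
    EdgeLt e g := ⟨h.1.trans h'.1, h.2.trans h'.2⟩

theorem not_edgeLt_self {k : ℕ} (e : x.Edge k) : ¬ EdgeLt e e := fun h => lt_irrefl _ h.2

theorem exists_next {k : ℕ} {e : x.Edge k} (h : ¬ IsMaxEdge e) :
    ∃ f : x.Edge k, f.1 = e.1 ∧ (f.2 : ℕ) = e.2 + 1 := by
  rw [isMaxEdge_iff] at h
  have := e.2.2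
  exact ⟨⟨e.1, ⟨e.2 + 1, by omega⟩⟩, rfl, rfl⟩

theorem exists_prev {k : ℕ} {e : x.Edge k} (h : ¬ IsMinEdge e) :
    ∃ f : x.Edge k, f.1 = e.1 ∧ (e.2 : ℕ) = f.2 + 1 := by
  rw [isMinEdge_iff] at h
  have := e.2.2
  exact ⟨⟨e.1, ⟨e.2 - 1, by omega⟩⟩, rfl, by simp only; omega⟩

/-! ### Heights of vertices -/

/-- The total weight of the paths from level `0` to the vertex `v` of level `k`, where a path
that starts at `u` has weight `l u`. -/
noncomputable def ht (l : x.V 0 → ℝ) (k : ℕ) (v : x.V k) : ℝ := (x.cocycle k).mulVec l v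

theorem len_eq (lam : ℝ) (l : x.V 0 → ℝ) (k : ℕ) (v : x.V k) :
    x.len lam l k v = (lam⁻¹) ^ k * ht l k v := rfl

@[simp] theorem ht_zero (l : x.V 0 → ℝ) (v : x.V 0) : ht l 0 v = l v := by
  simp [ht, cocycle]

/-- The matrix forgets the order of the edges. Counting the sources with multiplicity recovers a sum
over the ordered list, whose partial sums are the offsets of the subtowers. -/
theorem ht_succ (l : x.V 0 → ℝ) (k : ℕ) (v : x.V (k + 1)) :
    ht l (k + 1) v = ∑ j : Fin (x.into k v).length, ht l k ((x.into k v).get j) := by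
  have h1 : ∑ j : Fin (x.into k v).length, ht l k ((x.into k v).get j)
      = ((x.into k v).map (ht l k)).sum := by
    rw [← List.sum_ofFn]
    congr 1
    apply List.ext_get
    · simp
    · intro n h1 h2
      simp
  rw [h1, Finset.sum_list_map_count,
    Finset.sum_subset (Finset.subset_univ _) (fun u _ hu => by
      rw [List.count_eq_zero_of_not_mem (by simpa using hu), zero_smul])]
  simp only [ht, cocycle, ← Matrix.mulVec_mulVec]
  simp only [Matrix.mulVec, dotProduct, incidence, nsmul_eq_mul]

/-- The sum of the heights of the first `i` sources of edges with range `v`. -/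
noncomputable def partialHt (l : x.V 0 → ℝ) (k : ℕ) (v : x.V (k + 1)) (i : ℕ) : ℝ :=
  ∑ j ∈ Finset.univ.filter (fun j : Fin (x.into k v).length => (j : ℕ) < i),
    ht l k ((x.into k v).get j)

theorem partialHt_zero (l : x.V 0 → ℝ) (k : ℕ) (v : x.V (k + 1)) : partialHt l k v 0 = 0 := by
  simp [partialHt]

theorem partialHt_succ (l : x.V 0 → ℝ) (e : x.Edge k) :
    partialHt l k e.1 (e.2 + 1) = partialHt l k e.1 e.2 + ht l k (src e) := by
  rw [partialHt, partialHt]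
  have : Finset.univ.filter (fun j : Fin (x.into k e.1).length => (j : ℕ) < e.2 + 1)
      = insert e.2 (Finset.univ.filter (fun j : Fin (x.into k e.1).length => (j : ℕ) < e.2)) := by
    ext j
    simp only [Finset.mem_filter, Finset.mem_univ, true_and, Finset.mem_insert, Fin.ext_iff]
    omega
  rw [this, Finset.sum_insert (by simp), add_comm]
  rfl

theorem partialHt_length (l : x.V 0 → ℝ) (k : ℕ) (v : x.V (k + 1)) :
    partialHt l k v (x.into k v).length = ht l (k + 1) v := by
  rw [partialHt, ht_succ]
  congr 1
  ext j
  simp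

/-- The sum of the heights of the sources of the edges that precede `e`. -/
noncomputable def off (l : x.V 0 → ℝ) {k : ℕ} (e : x.Edge k) : ℝ := partialHt l k e.1 e.2

theorem off_of_isMinEdge (l : x.V 0 → ℝ) {k : ℕ} {e : x.Edge k} (h : IsMinEdge e) :
    off l e = 0 := by
  rw [off, (isMinEdge_iff e).1 h, partialHt_zero]

theorem off_add_of_isMaxEdge (l : x.V 0 → ℝ) {k : ℕ} {e : x.Edge k} (h : IsMaxEdge e) :
    off l e + ht l k (src e) = ht l (k + 1) (ran e) := by
  rw [off, ← partialHt_succ, (isMaxEdge_iff e).1 h, partialHt_length]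
  rfl

theorem off_next (l : x.V 0 → ℝ) {k : ℕ} {e f : x.Edge k} (h₁ : f.1 = e.1)
    (h₂ : (f.2 : ℕ) = e.2 + 1) : off l f = off l e + ht l k (src e) := by
  rw [off, off, ← partialHt_succ, h₂, h₁]

theorem ht_nonneg {l : x.V 0 → ℝ} (hl : ∀ v, 0 ≤ l v) (k : ℕ) (v : x.V k) : 0 ≤ ht l k v := by
  induction k with
  | zero => simpa using hl v
  | succ k ih =>
    rw [ht_succ]
    exact Finset.sum_nonneg fun j _ => ih _

theorem partialHt_mono {l : x.V 0 → ℝ} (hl : ∀ v, 0 ≤ l v) (k : ℕ) (v : x.V (k + 1)) :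
    Monotone (partialHt l k v) := by
  intro i j hij
  apply Finset.sum_le_sum_of_subset_of_nonneg
  · intro a
    simp only [Finset.mem_filter, Finset.mem_univ, true_and]
    omega
  · intro a _ _
    exact ht_nonneg hl _ _

section nonneg

variable {l : x.V 0 → ℝ} {k : ℕ}

theorem off_nonneg (hl : ∀ v, 0 ≤ l v) (e : x.Edge k) : 0 ≤ off l e := by
  rw [← partialHt_zero l k e.1]
  exact partialHt_mono hl _ _ (Nat.zero_le _)

theorem off_add_le_of_edgeLt (hl : ∀ v, 0 ≤ l v) {e f : x.Edge k} (h : EdgeLt e f) :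
    off l e + ht l k (src e) ≤ off l f := by
  have := partialHt_mono hl k f.1 (Nat.succ_le_of_lt h.2)
  rw [off, ← partialHt_succ, off]
  exact (congrArg (partialHt l k · ((e.2 : ℕ) + 1)) h.1).le.trans this

theorem off_add_le (hl : ∀ v, 0 ≤ l v) (e : x.Edge k) :
    off l e + ht l k (src e) ≤ ht l (k + 1) (ran e) := by
  rw [off, ← partialHt_succ, ← partialHt_length]
  exact partialHt_mono hl _ _ e.2.2

theorem ht_src_le (hl : ∀ v, 0 ≤ l v) (e : x.Edge k) : ht l k (src e) ≤ ht l (k + 1) (ran e) :=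
  (le_add_of_nonneg_left (off_nonneg hl e)).trans (off_add_le hl e)

/-- Every vertex has an incoming edge, and its tower contains the tower over the source of that
edge. -/
theorem le_ht_of_le (hl : ∀ v, 0 ≤ l v) {m : ℝ} (hm : ∀ v : x.V k, m ≤ ht l k v) {i : ℕ}
    (hi : k ≤ i) (v : x.V i) : m ≤ ht l i v := by
  induction i, hi using Nat.le_induction with
  | base => exact hm v
  | succ i _ ih => exact (ih (src (minEdge v))).trans (ht_src_le hl (minEdge v))

end nonneg

theorem ht_pos {l : x.V 0 → ℝ} (hl : ∀ v, 0 < l v) (k : ℕ) (v : x.V k) : 0 < ht l k v := by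
  induction k with
  | zero => simpa using hl v
  | succ k ih =>
    exact (ih (src (minEdge v))).trans_le (ht_src_le (fun v => (hl v).le) (minEdge v))

theorem exists_edge_of_lt {l : x.V 0 → ℝ} {k : ℕ} {v : x.V (k + 1)} {τ : ℝ} (h₀ : 0 ≤ τ)
    (h₁ : τ < ht l (k + 1) v) :
    ∃ e : x.Edge k, ran e = v ∧ off l e ≤ τ ∧ τ < off l e + ht l k (src e) := by
  classical
  -- The first partial sum above `τ` has a positive index, at most the length of the list; the edge
  -- wanted is the one just before that index.
  have hex : ∃ i, τ < partialHt l k v i := ⟨_, by rwa [partialHt_length]⟩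
  have hpos : Nat.find hex ≠ 0 := by
    intro h
    have := Nat.find_spec hex
    rw [h, partialHt_zero] at this
    linarith
  obtain ⟨i, hi⟩ := Nat.exists_eq_succ_of_ne_zero hpos
  have hle : Nat.find hex ≤ (x.into k v).length := Nat.find_min' hex (by rwa [partialHt_length])
  refine ⟨⟨v, ⟨i, by omega⟩⟩, rfl, ?_, ?_⟩
  · exact not_lt.1 (Nat.find_min hex (m := i) (by omega))
  · have := Nat.find_spec hex
    rw [hi] at this
    rw [off, ← partialHt_succ]
    exact this

/-! ### Heights along paths -/

/-- The total weight of the initial segments to level `k` that precede the one of `p`. -/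
noncomputable def hgt (l : x.V 0 → ℝ) (p : x.PathSpace) : ℕ → ℝ
  | 0 => 0
  | k + 1 => off l (p.1 k) + hgt l p k

/-- The total weight of the initial segments to level `k` from the one of `p` onwards. -/
noncomputable def rest (l : x.V 0 → ℝ) (p : x.PathSpace) (k : ℕ) : ℝ :=
  ht l k (src (p.1 k)) - hgt l p k

@[simp] theorem hgt_zero (l : x.V 0 → ℝ) (p : x.PathSpace) : hgt l p 0 = 0 := rfl

theorem hgt_succ (l : x.V 0 → ℝ) (p : x.PathSpace) (k : ℕ) :
    hgt l p (k + 1) = off l (p.1 k) + hgt l p k := rfl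

@[simp] theorem rest_zero (l : x.V 0 → ℝ) (p : x.PathSpace) :
    rest l p 0 = l (src (p.1 0)) := by simp [rest]

theorem rest_succ (l : x.V 0 → ℝ) (p : x.PathSpace) (k : ℕ) :
    rest l p (k + 1) = ht l (k + 1) (ran (p.1 k)) - off l (p.1 k) - hgt l p k := by
  rw [rest, hgt_succ, ← p.2 k]
  ring

theorem hgt_add_rest (l : x.V 0 → ℝ) (p : x.PathSpace) (k : ℕ) :
    hgt l p k + rest l p k = ht l k (src (p.1 k)) := by rw [rest]; ring

theorem hgt_congr (l : x.V 0 → ℝ) {p q : x.PathSpace} {k : ℕ} (h : ∀ i < k, p.1 i = q.1 i) :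
    hgt l p k = hgt l q k := by
  induction k with
  | zero => rfl
  | succ k ih => rw [hgt_succ, hgt_succ, h k (Nat.lt_succ_self k), ih fun i hi => h i (by omega)]

theorem hgt_eq_of_min (l : x.V 0 → ℝ) {p : x.PathSpace} {k M : ℕ} (hkM : k ≤ M)
    (h : ∀ i, k ≤ i → i < M → IsMinEdge (p.1 i)) : hgt l p M = hgt l p k := by
  induction M, hkM using Nat.le_induction with
  | base => rfl
  | succ M hM ih =>
    rw [hgt_succ, off_of_isMinEdge l (h M hM (Nat.lt_succ_self M)), zero_add,
      ih fun i hi hi' => h i hi (by omega)]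

theorem rest_eq_of_max (l : x.V 0 → ℝ) {p : x.PathSpace} {k M : ℕ} (hkM : k ≤ M)
    (h : ∀ i, k ≤ i → i < M → IsMaxEdge (p.1 i)) : rest l p M = rest l p k := by
  induction M, hkM using Nat.le_induction with
  | base => rfl
  | succ M hM ih =>
    rw [rest_succ, ← off_add_of_isMaxEdge l (h M hM (Nat.lt_succ_self M)),
      ← ih fun i hi hi' => h i hi (by omega), rest]
    ring

section nonneg

variable {l : x.V 0 → ℝ}

theorem hgt_mono (hl : ∀ v, 0 ≤ l v) (p : x.PathSpace) : Monotone (hgt l p) :=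
  monotone_nat_of_le_succ fun k => by
    rw [hgt_succ]
    exact le_add_of_nonneg_left (off_nonneg hl _)

theorem hgt_nonneg (hl : ∀ v, 0 ≤ l v) (p : x.PathSpace) (k : ℕ) : 0 ≤ hgt l p k :=
  hgt_mono hl p (Nat.zero_le k)

theorem rest_mono (hl : ∀ v, 0 ≤ l v) (p : x.PathSpace) : Monotone (rest l p) :=
  monotone_nat_of_le_succ fun k => by
    rw [rest_succ, rest]
    linarith [off_add_le hl (p.1 k)]

theorem le_rest (hl : ∀ v, 0 ≤ l v) (p : x.PathSpace) (k : ℕ) : l (src (p.1 0)) ≤ rest l p k := by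
  simpa using rest_mono hl p (Nat.zero_le k)

theorem ht_src_le_hgt (hl : ∀ v, 0 ≤ l v) (p : x.PathSpace) {k M : ℕ} (hkM : k < M)
    {f : x.Edge k} (h : EdgeLt f (p.1 k)) :
    ht l k (src f) ≤ hgt l p M := by
  have h1 := off_add_le_of_edgeLt hl h
  have h2 := off_nonneg hl f
  have h3 := hgt_nonneg hl p k
  have h4 : hgt l p (k + 1) ≤ hgt l p M := hgt_mono hl p hkM
  rw [hgt_succ] at h4
  linarith

theorem rest_add_ht_src_le (hl : ∀ v, 0 ≤ l v) (p : x.PathSpace) {k M : ℕ} (hkM : k < M)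
    {f : x.Edge k} (h : EdgeLt (p.1 k) f) :
    rest l p k + ht l k (src f) ≤ rest l p M := by
  have h1 := off_add_le_of_edgeLt hl h
  have h2 := off_add_le hl f
  have h4 : rest l p (k + 1) ≤ rest l p M := rest_mono hl p hkM
  have h5 : ran f = ran (p.1 k) := h.1.symm
  rw [rest_succ, ← h5] at h4
  rw [rest]
  linarith

/-- The basic separation estimate. At level `j`, the remainder of the subtower of `p` and the part
of the subtower of `q` below its floor both lie between the two floors; common edges above `j` shift
both floors equally. -/
theorem hgt_add_rest_le_of_edgeLt (hl : ∀ v, 0 ≤ l v) (p q : x.PathSpace) {j M : ℕ} (hjM : j < M)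
    (hj : EdgeLt (p.1 j) (q.1 j)) (hM : ∀ i, j < i → i < M → p.1 i = q.1 i) :
    hgt l p M + (rest l p j + hgt l q j) ≤ hgt l q M := by
  induction M, Nat.succ_le_of_lt hjM using Nat.le_induction with
  | base =>
    have := off_add_le_of_edgeLt hl hj
    rw [Nat.succ_eq_add_one, hgt_succ, hgt_succ, rest]
    linarith
  | succ M hM' ih =>
    rw [hgt_succ, hgt_succ, hM M (by omega) (by omega)]
    linarith [ih (by omega) fun i hi hi' => hM i hi (by omega)]

end nonneg

/-- At the last level below `M` where the paths differ, their edges have the same range and are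
therefore comparable. -/
theorem exists_edgeLt_of_ne (p q : x.PathSpace) {M n : ℕ} (hn : n < M) (hne : p.1 n ≠ q.1 n)
    (hM : src (p.1 M) = src (q.1 M)) :
    ∃ j, n ≤ j ∧ j < M ∧ (EdgeLt (p.1 j) (q.1 j) ∨ EdgeLt (q.1 j) (p.1 j)) ∧
      ∀ i, j < i → i < M → p.1 i = q.1 i := by
  induction M, Nat.succ_le_of_lt hn using Nat.le_induction with
  | base =>
    refine ⟨n, le_rfl, Nat.lt_succ_self n, edgeLt_or_edgeLt ?_ hne, fun i h1 h2 => by omega⟩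
    rw [p.2, q.2]
    exact hM
  | succ M hM' ih =>
    by_cases h : p.1 M = q.1 M
    · obtain ⟨j, h1, h2, h3, h4⟩ := ih (by omega) (by rw [h])
      refine ⟨j, h1, by omega, h3, fun i hi hi' => ?_⟩
      rcases Nat.lt_succ_iff_lt_or_eq.1 hi' with h5 | rfl
      · exact h4 i hi h5
      · exact h
    · refine ⟨M, by omega, by omega, edgeLt_or_edgeLt ?_ h, fun i h1 h2 => by omega⟩
      rw [p.2, q.2]
      exact hM

/-! ### Existence of paths -/

/-- Only the tail has to be specified: every vertex has an incoming edge, so the path can be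
completed downwards. -/
theorem exists_path_of_tail (k : ℕ) (g : ∀ i, x.Edge i)
    (hg : ∀ i, k ≤ i → ran (g i) = src (g (i + 1))) :
    ∃ p : x.PathSpace, ∀ i, k ≤ i → p.1 i = g i := by
  induction k generalizing g with
  | zero => exact ⟨⟨g, fun i => hg i (Nat.zero_le i)⟩, fun _ _ => rfl⟩
  | succ k ih =>
    obtain ⟨p, hp⟩ := ih (Function.update g k (minEdge (src (g (k + 1))))) (by
      intro i hi
      rcases eq_or_lt_of_le hi with rfl | hi
      · rw [Function.update_self, Function.update_of_ne (by omega)]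
        rfl
      · rw [Function.update_of_ne (by omega), Function.update_of_ne (by omega)]
        exact hg i hi)
    exact ⟨p, fun i hi => by rw [hp i (by omega), Function.update_of_ne (by omega)]⟩

theorem exists_edge_src {k : ℕ} (u : x.V k) : ∃ e : x.Edge k, src e = u := by
  obtain ⟨v, hv⟩ := x.source_surj k u
  obtain ⟨i, hi⟩ := List.get_of_mem hv
  exact ⟨⟨v, i⟩, hi⟩

theorem exists_path_through (k : ℕ) (v : x.V k) : ∃ p : x.PathSpace, src (p.1 k) = v := by
  classical
  choose up hup using fun (k : ℕ) (u : x.V k) => exists_edge_src u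
  -- The vertex at level `k` is forced to be `v`, and from there on outgoing edges are followed; the
  -- values below `k` play no role.
  let w : ∀ i, x.V i := fun i => Nat.rec (motive := fun i => x.V i)
    (if h : k = 0 then cast (congrArg x.V h) v else ⟨0, x.nV_pos 0⟩)
    (fun i u => if h : k = i + 1 then cast (congrArg x.V h) v else ran (up i u)) i
  have hw : w k = v := by
    cases k with
    | zero => simp [w]
    | succ k => simp [w]
  obtain ⟨p, hp⟩ := exists_path_of_tail k (fun i => up i (w i)) (by
    intro i hi
    rw [hup]
    have : k ≠ i + 1 := by omega
    simp only [w, this, dite_false])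
  exact ⟨p, by rw [hp k le_rfl, hup, hw]⟩

theorem exists_replace (p : x.PathSpace) (k : ℕ) (e : x.Edge k) (h : ran e = ran (p.1 k)) :
    ∃ q : x.PathSpace, q.1 k = e ∧ ∀ i, k < i → q.1 i = p.1 i := by
  obtain ⟨q, hq⟩ := exists_path_of_tail k (Function.update p.1 k e) (by
    intro i hi
    rcases eq_or_lt_of_le hi with rfl | hi
    · rw [Function.update_self, Function.update_of_ne (by omega), h, p.2]
    · rw [Function.update_of_ne (by omega), Function.update_of_ne (by omega), p.2])
  exact ⟨q, by rw [hq k le_rfl, Function.update_self],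
    fun i hi => by rw [hq i hi.le, Function.update_of_ne (by omega)]⟩

theorem exists_below (c : ∀ k, x.V (k + 1) → x.Edge k) (hc : ∀ k v, ran (c k v) = v)
    (p : x.PathSpace) (n : ℕ) :
    ∃ q : x.PathSpace, (∀ i < n, q.1 i = c i (ran (q.1 i))) ∧ ∀ i, n ≤ i → q.1 i = p.1 i := by
  induction n generalizing p with
  | zero => exact ⟨p, fun i hi => absurd hi (Nat.not_lt_zero i), fun _ _ => rfl⟩
  | succ n ih =>
    obtain ⟨p', hp', hp''⟩ := exists_replace p n (c n (ran (p.1 n))) (hc _ _)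
    obtain ⟨q, hq, hq'⟩ := ih p'
    refine ⟨q, fun i hi => ?_, fun i hi => ?_⟩
    · rcases Nat.lt_succ_iff_lt_or_eq.1 hi with h | rfl
      · exact hq i h
      · rw [hq' i le_rfl, hp', hc]
    · rw [hq' i (by omega), hp'' i hi]

theorem exists_min_below (p : x.PathSpace) (n : ℕ) :
    ∃ q : x.PathSpace, (∀ i < n, IsMinEdge (q.1 i)) ∧ ∀ i, n ≤ i → q.1 i = p.1 i := by
  obtain ⟨q, hq, hq'⟩ := exists_below (fun _ => minEdge) (fun _ _ => rfl) p n
  exact ⟨q, fun i hi => by rw [hq i hi]; exact isMinEdge_minEdge _, hq'⟩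

theorem exists_max_below (p : x.PathSpace) (n : ℕ) :
    ∃ q : x.PathSpace, (∀ i < n, IsMaxEdge (q.1 i)) ∧ ∀ i, n ≤ i → q.1 i = p.1 i := by
  obtain ⟨q, hq, hq'⟩ := exists_below (fun _ => maxEdge) (fun _ _ => rfl) p n
  exact ⟨q, fun i hi => by rw [hq i hi]; exact isMaxEdge_maxEdge _, hq'⟩

/-- Greedy expansion of `τ`: from the top level down, choose the edge whose subtower contains the
height and subtract its offset. The final remainder is `t`. -/
theorem exists_hgt_eq {l : x.V 0 → ℝ} (k : ℕ) (p : x.PathSpace) {τ : ℝ} (h₀ : 0 ≤ τ)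
    (h₁ : τ < ht l k (src (p.1 k))) :
    ∃ q : x.PathSpace, ∃ t, (∀ i, k ≤ i → q.1 i = p.1 i) ∧ 0 ≤ t ∧ t < l (src (q.1 0)) ∧
      hgt l q k + t = τ := by
  induction k generalizing p τ with
  | zero => exact ⟨p, τ, fun _ _ => rfl, h₀, by simpa using h₁, by simp⟩
  | succ k ih =>
    obtain ⟨e, he, h2, h3⟩ := exists_edge_of_lt h₀ h₁
    obtain ⟨p', hp', hp''⟩ := exists_replace p k e (by rw [he, p.2])
    obtain ⟨q, t, hq, ht0, ht1, hqt⟩ := ih p' (τ := τ - off l e) (by linarith)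
      (by rw [hp']; linarith)
    refine ⟨q, t, fun i hi => ?_, ht0, ht1, ?_⟩
    · rw [hq i (by omega), hp'' i (by omega)]
    · rw [hgt_succ, hq k le_rfl, hp']
      linarith

/-! ### Compactness -/

instance instDiscreteTopologyEdge (k : ℕ) : DiscreteTopology (x.Edge k) := inferInstance

theorem continuous_coord (k : ℕ) : Continuous fun p : x.PathSpace => p.1 k :=
  (continuous_apply k).comp continuous_subtype_val

theorem isClosed_coord (k : ℕ) (s : Set (x.Edge k)) : IsClosed {p : x.PathSpace | p.1 k ∈ s} :=
  (isClosed_discrete s).preimage (continuous_coord k)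

instance instCompactSpacePathSpace : CompactSpace x.PathSpace := by
  have : IsClosed {p : ∀ k, x.Edge k | ∀ k, ran (p k) = src (p (k + 1))} := by
    rw [Set.ofPred_forall]
    refine isClosed_iInter fun k => ?_
    have : Continuous fun p : ∀ k, x.Edge k => (p k, p (k + 1)) := by fun_prop
    exact (isClosed_discrete {e : x.Edge k × x.Edge (k + 1) | ran e.1 = src e.2}).preimage this
  exact isCompact_iff_compactSpace.1 this.isCompact

/-- Compactness: if no finite level sufficed, the pairs of counterexamples would form decreasing
non-empty closed sets, and a common point would contradict uniqueness for infinite paths. This turns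
proper ordering into a condition on finitely many levels. -/
theorem exists_level_of_unique (Q : ∀ k, x.Edge k → Prop) (n : ℕ)
    (huniq : ∀ p q : x.PathSpace, (∀ i, n ≤ i → Q i (p.1 i)) → (∀ i, n ≤ i → Q i (q.1 i)) →
      src (p.1 n) = src (q.1 n)) :
    ∃ M, n ≤ M ∧ ∀ p q : x.PathSpace, (∀ i, n ≤ i → i < M → Q i (p.1 i)) →
      (∀ i, n ≤ i → i < M → Q i (q.1 i)) → src (p.1 n) = src (q.1 n) := by
  by_contra! hcon
  let C : ℕ → Set (x.PathSpace × x.PathSpace) := fun j =>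
    {pq | (∀ i, n ≤ i → i < n + j → Q i (pq.1.1 i)) ∧ (∀ i, n ≤ i → i < n + j → Q i (pq.2.1 i)) ∧
      src (pq.1.1 n) ≠ src (pq.2.1 n)}
  have hclosed : ∀ j, IsClosed (C j) := by
    intro j
    have h1 : ∀ i, IsClosed {pq : x.PathSpace × x.PathSpace | n ≤ i → i < n + j → Q i (pq.1.1 i)} :=
      fun i => (isClosed_coord i {e | n ≤ i → i < n + j → Q i e}).preimage continuous_fst
    have h2 : ∀ i, IsClosed {pq : x.PathSpace × x.PathSpace | n ≤ i → i < n + j → Q i (pq.2.1 i)} :=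
      fun i => (isClosed_coord i {e | n ≤ i → i < n + j → Q i e}).preimage continuous_snd
    have h3 : IsClosed {pq : x.PathSpace × x.PathSpace | src (pq.1.1 n) ≠ src (pq.2.1 n)} :=
      (isClosed_discrete {e : x.Edge n × x.Edge n | src e.1 ≠ src e.2}).preimage
        (((continuous_coord n).comp continuous_fst).prodMk
          ((continuous_coord n).comp continuous_snd))
    have := (isClosed_iInter h1).inter ((isClosed_iInter h2).inter h3)
    convert this using 1
    ext pq
    simp only [C, Set.mem_ofPred_eq, Set.mem_inter_iff, Set.mem_iInter]
  obtain ⟨⟨p, q⟩, hpq⟩ := IsCompact.nonempty_iInter_of_sequence_nonempty_isCompact_isClosed C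
    (fun j pq h => ⟨fun i hi hi' => h.1 i hi (by omega), fun i hi hi' => h.2.1 i hi (by omega),
      h.2.2⟩)
    (fun j => by
      obtain ⟨p, q, hp, hq, h⟩ := hcon (n + j) (by omega)
      exact ⟨(p, q), hp, hq, h⟩)
    (hclosed 0).isCompact hclosed
  simp only [Set.mem_iInter] at hpq
  exact (hpq 0).2.2 (huniq p q (fun i hi => (hpq (i + 1)).1 i hi (by omega))
    fun i hi => (hpq (i + 1)).2.1 i hi (by omega))

/-- Replacing the edges below `n` by minimal ones keeps the source at level `n` and makes both paths
equal to the unique minimal one. -/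
theorem ProperlyOrdered.src_eq_of_min (h : x.ProperlyOrdered) {n : ℕ} {p q : x.PathSpace}
    (hp : ∀ i, n ≤ i → IsMinEdge (p.1 i)) (hq : ∀ i, n ≤ i → IsMinEdge (q.1 i)) :
    src (p.1 n) = src (q.1 n) := by
  obtain ⟨p', hp1, hp2⟩ := exists_min_below p n
  obtain ⟨q', hq1, hq2⟩ := exists_min_below q n
  have : p' = q' := h.1.unique
    (fun i => (lt_or_ge i n).elim (hp1 i) fun hi => by rw [hp2 i hi]; exact hp i hi)
    (fun i => (lt_or_ge i n).elim (hq1 i) fun hi => by rw [hq2 i hi]; exact hq i hi)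
  rw [← hp2 n le_rfl, ← hq2 n le_rfl, this]

theorem ProperlyOrdered.src_eq_of_max (h : x.ProperlyOrdered) {n : ℕ} {p q : x.PathSpace}
    (hp : ∀ i, n ≤ i → IsMaxEdge (p.1 i)) (hq : ∀ i, n ≤ i → IsMaxEdge (q.1 i)) :
    src (p.1 n) = src (q.1 n) := by
  obtain ⟨p', hp1, hp2⟩ := exists_max_below p n
  obtain ⟨q', hq1, hq2⟩ := exists_max_below q n
  have : p' = q' := h.2.unique
    (fun i => (lt_or_ge i n).elim (hp1 i) fun hi => by rw [hp2 i hi]; exact hp i hi)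
    (fun i => (lt_or_ge i n).elim (hq1 i) fun hi => by rw [hq2 i hi]; exact hq i hi)
  rw [← hp2 n le_rfl, ← hq2 n le_rfl, this]

theorem ProperlyOrdered.exists_level_min (h : x.ProperlyOrdered) (n : ℕ) :
    ∃ M, n ≤ M ∧ ∀ p q : x.PathSpace, (∀ i, n ≤ i → i < M → IsMinEdge (p.1 i)) →
      (∀ i, n ≤ i → i < M → IsMinEdge (q.1 i)) → src (p.1 n) = src (q.1 n) :=
  exists_level_of_unique (fun _ e => IsMinEdge e) n fun _ _ hp hq => h.src_eq_of_min hp hq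

theorem ProperlyOrdered.exists_level_max (h : x.ProperlyOrdered) (n : ℕ) :
    ∃ M, n ≤ M ∧ ∀ p q : x.PathSpace, (∀ i, n ≤ i → i < M → IsMaxEdge (p.1 i)) →
      (∀ i, n ≤ i → i < M → IsMaxEdge (q.1 i)) → src (p.1 n) = src (q.1 n) :=
  exists_level_of_unique (fun _ e => IsMaxEdge e) n fun _ _ hp hq => h.src_eq_of_max hp hq

/-! ### Strong minimality -/

theorem exists_path_of_finPath {k j : ℕ} (e : FinPath x k (k + j + 1)) (r : x.PathSpace)
    (hr : ran (e.1 (k + j) (by omega) (by omega)) = src (r.1 (k + j + 1))) :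
    ∃ p : x.PathSpace, (∀ i < k, IsMinEdge (p.1 i)) ∧
      (∀ i (h₁ : k ≤ i) (h₂ : i < k + j + 1), p.1 i = e.1 i h₁ h₂) ∧
      ∀ i, k + j + 1 ≤ i → p.1 i = r.1 i := by
  obtain ⟨p, hp⟩ := exists_path_of_tail k
    (fun i => if h : k ≤ i ∧ i < k + j + 1 then e.1 i h.1 h.2 else r.1 i) (by
      intro i hi
      by_cases h1 : i + 1 < k + j + 1
      · rw [dif_pos ⟨hi, by omega⟩, dif_pos ⟨by omega, h1⟩]
        exact e.2 i hi h1
      · by_cases h2 : i < k + j + 1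
        · obtain rfl : i = k + j := by omega
          rw [dif_pos ⟨hi, by omega⟩, dif_neg (by omega)]
          exact hr
        · rw [dif_neg (by omega), dif_neg (by omega)]
          exact r.2 i)
  obtain ⟨q, hq, hq'⟩ := exists_min_below p k
  refine ⟨q, hq, fun i h₁ h₂ => ?_, fun i hi => ?_⟩
  · rw [hq' i h₁, hp i h₁, dif_pos ⟨h₁, h₂⟩]
  · rw [hq' i (by omega), hp i (by omega), dif_neg (by omega)]

theorem StronglyMinimal.exists_paths (h : x.StronglyMinimal) (k : ℕ) :
    ∃ M, k < M ∧ ∀ (v : x.V k) (w : x.V M), ∃ p q : x.PathSpace,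
      src (p.1 k) = v ∧ src (q.1 k) = v ∧ src (p.1 M) = w ∧ src (q.1 M) = w ∧
      (∀ i < k, IsMinEdge (p.1 i)) ∧ (∀ i < k, IsMinEdge (q.1 i)) ∧
      ∃ n, k ≤ n ∧ n < M ∧ p.1 n ≠ q.1 n := by
  obtain ⟨j, hj⟩ := h k
  refine ⟨k + j + 1, by omega, fun v w => ?_⟩
  obtain ⟨e, f, hne, he1, he2, hf1, hf2⟩ := hj v w
  obtain ⟨r, hr⟩ := exists_path_through (k + j + 1) w
  obtain ⟨p, hp1, hp2, hp3⟩ := exists_path_of_finPath e r (by rw [he2, hr])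
  obtain ⟨q, hq1, hq2, hq3⟩ := exists_path_of_finPath f r (by rw [hf2, hr])
  refine ⟨p, q, ?_, ?_, ?_, ?_, hp1, hq1, ?_⟩
  · rw [hp2 k le_rfl (by omega), he1]
  · rw [hq2 k le_rfl (by omega), hf1]
  · rw [hp3 _ le_rfl, hr]
  · rw [hq3 _ le_rfl, hr]
  · by_contra! hcon
    apply hne
    apply Subtype.ext
    funext i h₁ h₂
    rw [← hp2, ← hq2, hcon i h₁ h₂]

/-- Two different paths from `v` to `w` are two disjoint copies of the tower over `v` inside the
tower over `w`. -/
theorem StronglyMinimal.two_mul_ht_le (h : x.StronglyMinimal) {l : x.V 0 → ℝ} (hl : ∀ v, 0 ≤ l v)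
    (k : ℕ) : ∃ M, k < M ∧ ∀ (v : x.V k) (w : x.V M), 2 * ht l k v ≤ ht l M w := by
  obtain ⟨M, hkM, hM⟩ := h.exists_paths k
  refine ⟨M, hkM, fun v w => ?_⟩
  obtain ⟨p, q, hp, hq, hpM, hqM, hp0, hq0, n, hn, hnM, hne⟩ := hM v w
  -- Below level `k` both paths are minimal, so their remainders at level `k` are the whole of `ht l
  -- k v`. The copy of `p` ends before the floor of `q`, and the copy of `q` lies above that floor.
  have key : ∀ p q : x.PathSpace, src (p.1 k) = v → src (q.1 k) = v → src (q.1 M) = w →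
      (∀ i < k, IsMinEdge (p.1 i)) → (∀ i < k, IsMinEdge (q.1 i)) → ∀ j, k ≤ j → j < M →
      EdgeLt (p.1 j) (q.1 j) → (∀ i, j < i → i < M → p.1 i = q.1 i) →
      2 * ht l k v ≤ ht l M w := by
    intro p q hp hq hqM hp0 hq0 j hj hjM hlt hagree
    have h1 := hgt_add_rest_le_of_edgeLt hl p q hjM hlt hagree
    have h2 : rest l p k ≤ rest l p j := rest_mono hl p hj
    have h3 : rest l q k ≤ rest l q M := rest_mono hl q hkM.le
    have h4 := hgt_eq_of_min l (Nat.zero_le k) (fun i _ hi => hp0 i hi)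
    have h5 := hgt_eq_of_min l (Nat.zero_le k) (fun i _ hi => hq0 i hi)
    have h6 := hgt_add_rest l q M
    have h7 := hgt_nonneg hl q j
    have h8 := hgt_nonneg hl p M
    rw [rest, h4, hp, hgt_zero] at h2
    rw [rest, h5, hq, hgt_zero] at h3
    rw [hqM] at h6
    linarith
  obtain ⟨j, hj, hjM, hlt | hlt, hagree⟩ := exists_edgeLt_of_ne p q hnM hne (by rw [hpM, hqM])
  · exact key p q hp hq hqM hp0 hq0 j (by omega) hjM hlt hagree
  · exact key q p hq hp hpM hq0 hp0 j (by omega) hjM hlt fun i h1 h2 => (hagree i h1 h2).symm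

theorem exists_pos_le {l : x.V 0 → ℝ} (hl : ∀ v, 0 < l v) : ∃ c, 0 < c ∧ ∀ v, c ≤ l v := by
  have : Nonempty (x.V 0) := ⟨⟨0, x.nV_pos 0⟩⟩
  obtain ⟨v, hv⟩ := Finite.exists_min l
  exact ⟨l v, hl v, hv⟩

theorem StronglyMinimal.exists_le_ht (h : x.StronglyMinimal) {l : x.V 0 → ℝ} (hl : ∀ v, 0 < l v)
    (C : ℝ) : ∃ K, ∀ k, K ≤ k → ∀ v, C ≤ ht l k v := by
  obtain ⟨c, hc, hcl⟩ := exists_pos_le hl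
  have hl' : ∀ v, 0 ≤ l v := fun v => (hl v).le
  have key : ∀ n : ℕ, ∃ K, ∀ v, c * 2 ^ n ≤ ht l K v := by
    intro n
    induction n with
    | zero => exact ⟨0, by simpa using hcl⟩
    | succ n ih =>
      obtain ⟨K, hK⟩ := ih
      obtain ⟨M, -, hM⟩ := h.two_mul_ht_le hl' K
      refine ⟨M, fun w => ?_⟩
      have h1 := hM ⟨0, x.nV_pos K⟩ w
      have h2 := hK ⟨0, x.nV_pos K⟩
      rw [pow_succ]
      linarith
  obtain ⟨n, hn⟩ := pow_unbounded_of_one_lt (C / c) (one_lt_two)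
  obtain ⟨K, hK⟩ := key n
  refine ⟨K, fun k hk v => le_ht_of_le hl' (fun v => le_trans ?_ (hK v)) hk v⟩
  rw [div_lt_iff₀ hc] at hn
  linarith

end OrderedBratteli
namespace OrderedBratteli

variable {x : OrderedBratteli}

/-! ### Segments of infinite paths and the gluing relation -/

/-- The segment of an infinite path between the levels `m` and `n`. -/
def seg (p : x.PathSpace) (m n : ℕ) : FinPath x m n := ⟨fun i _ _ => p.1 i, fun i _ _ => p.2 i⟩

theorem seg_lt_iff {p q : x.PathSpace} {m n : ℕ} :
    (seg p m n).Lt (seg q m n) ↔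
      ∃ j, m ≤ j ∧ j < n ∧ EdgeLt (p.1 j) (q.1 j) ∧ ∀ i, m ≤ i → i < n → j < i → p.1 i = q.1 i :=
  ⟨fun ⟨j, h₁, h₂, h₃, h₄⟩ => ⟨j, h₁, h₂, h₃, h₄⟩, fun ⟨j, h₁, h₂, h₃, h₄⟩ => ⟨j, h₁, h₂, h₃, h₄⟩⟩

/-- Finite paths can thus be handled as infinite ones, whose edges can be altered level by level. -/
theorem FinPath.exists_eq_seg {m n : ℕ} (h : m < n) (e : FinPath x m n) :
    ∃ p : x.PathSpace, e = seg p m n := by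
  obtain ⟨j, rfl⟩ : ∃ j, n = m + j + 1 := ⟨n - m - 1, by omega⟩
  obtain ⟨r, hr⟩ := exists_path_through (m + j + 1) (ran (e.1 (m + j) (by omega) (by omega)))
  obtain ⟨p, -, hp, -⟩ := exists_path_of_finPath e r hr.symm
  refine ⟨p, Subtype.ext ?_⟩
  funext i h₁ h₂
  exact (hp i h₁ h₂).symm

/-- The carry rule of an odometer. A path strictly between could differ from `p` last only at a
level `≥ j`, as `p` is maximal below, and likewise for `q`; there the two consecutive edges leave no
room. -/
theorem isSucc_seg {p q : x.PathSpace} {m n j : ℕ} (hmj : m ≤ j) (hjn : j < n)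
    (h₁ : (q.1 j).1 = (p.1 j).1) (h₂ : ((q.1 j).2 : ℕ) = (p.1 j).2 + 1)
    (hp : ∀ i, m ≤ i → i < j → IsMaxEdge (p.1 i)) (hq : ∀ i, m ≤ i → i < j → IsMinEdge (q.1 i))
    (hpq : ∀ i, j < i → i < n → q.1 i = p.1 i) : (seg p m n).IsSucc (seg q m n) := by
  refine ⟨seg_lt_iff.2 ⟨j, hmj, hjn, ⟨h₁.symm, by omega⟩, fun i _ h h' => (hpq i h' h).symm⟩, ?_⟩
  intro g
  obtain ⟨r, rfl⟩ := FinPath.exists_eq_seg (hmj.trans_lt hjn) g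
  rw [seg_lt_iff, seg_lt_iff]
  rintro ⟨⟨a, ha, han, ha1, ha2⟩, ⟨b, hb, hbn, hb1, hb2⟩⟩
  have haj : j ≤ a := not_lt.1 fun h => hp a ha h _ ha1
  have hbj : j ≤ b := not_lt.1 fun h => hq b hb h _ hb1
  rcases lt_trichotomy a b with hab | rfl | hab
  · rw [← ha2 b hb hbn hab, hpq b (by omega) hbn] at hb1
    exact not_edgeLt_self _ hb1
  · rcases eq_or_lt_of_le haj with rfl | haj
    · have := ha1.2
      have := hb1.2
      omega
    · rw [hpq a haj han] at hb1
      exact not_edgeLt_self _ (ha1.trans hb1)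
  · rw [hb2 a ha han hab, hpq a (by omega) han] at ha1
    exact not_edgeLt_self _ ha1

theorem exists_path_edge {k : ℕ} (e : x.Edge k) : ∃ p : x.PathSpace, p.1 k = e := by
  obtain ⟨r, hr⟩ := exists_path_through (k + 1) (ran e)
  obtain ⟨p, hp, -⟩ := exists_replace r k e (by rw [← hr, r.2])
  exact ⟨p, hp⟩

theorem adjacent_of_next {k : ℕ} {e f : x.Edge k} (h₁ : f.1 = e.1)
    (h₂ : (f.2 : ℕ) = e.2 + 1) : x.Adjacent k (src e) (src f) := by
  obtain ⟨p, hp⟩ := exists_path_edge e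
  obtain ⟨q, hq, hq'⟩ := exists_replace p k f (by rw [hp]; exact h₁)
  refine Or.inl ⟨k + 1, Nat.lt_succ_self k, seg p k (k + 1), seg q k (k + 1), ?_, ?_, ?_⟩
  · exact congrArg src hp
  · exact congrArg src hq
  · refine isSucc_seg le_rfl (Nat.lt_succ_self k) ?_ ?_ (fun i h h' => by omega)
      (fun i h h' => by omega) (fun i h h' => by omega)
    · rw [hp, hq, h₁]
    · rw [hp, hq, h₂]

/-- This makes wrapping compatible with gluing. Extending two successive paths downwards by a
maximal and a minimal edge leaves nothing between them at the new level. -/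
theorem Adjacent.src_maxEdge_minEdge {k : ℕ} {v₁ v₂ : x.V (k + 1)} (h : x.Adjacent (k + 1) v₁ v₂) :
    x.Adjacent k (src (maxEdge v₁)) (src (minEdge v₂)) := by
  rcases h with ⟨n, hn, e, f, he, hf, hs⟩ | ⟨pmax, pmin, hmax, hmin, h1, h2⟩
  · obtain ⟨p, rfl⟩ := e.exists_eq_seg hn
    obtain ⟨q, rfl⟩ := f.exists_eq_seg hn
    replace he : src (p.1 (k + 1)) = v₁ := he
    replace hf : src (q.1 (k + 1)) = v₂ := hf
    obtain ⟨p', hp', hp⟩ := exists_replace p k (maxEdge v₁) (by rw [p.2, he]; rfl)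
    obtain ⟨q', hq', hq⟩ := exists_replace q k (minEdge v₂) (by rw [q.2, hf]; rfl)
    refine Or.inl ⟨n, by omega, seg p' k n, seg q' k n, congrArg src hp', congrArg src hq', ?_, ?_⟩
    · obtain ⟨j, h1, h2, h3, h4⟩ := seg_lt_iff.1 hs.1
      refine seg_lt_iff.2 ⟨j, by omega, h2, ?_, fun i _ h6 h7 => ?_⟩
      · rwa [hp j (by omega), hq j (by omega)]
      · rw [hp i (by omega), hq i (by omega)]
        exact h4 i (by omega) h6 h7
    · intro g
      obtain ⟨r, rfl⟩ := g.exists_eq_seg (m := k) (by omega)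
      rw [seg_lt_iff, seg_lt_iff]
      rintro ⟨⟨a, ha, han, ha1, ha2⟩, ⟨b, hb, hbn, hb1, hb2⟩⟩
      have hak : a ≠ k := by
        rintro rfl
        rw [hp'] at ha1
        exact isMaxEdge_maxEdge _ _ ha1
      have hbk : b ≠ k := by
        rintro rfl
        rw [hq'] at hb1
        exact isMinEdge_minEdge _ _ hb1
      refine hs.2 (seg r (k + 1) n) ⟨seg_lt_iff.2 ⟨a, by omega, han, ?_, ?_⟩,
        seg_lt_iff.2 ⟨b, by omega, hbn, ?_, ?_⟩⟩
      · rwa [hp a (by omega)] at ha1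
      · intro i h1 h2 h3
        rw [← hp i (by omega)]
        exact ha2 i (by omega) h2 h3
      · rwa [hq b (by omega)] at hb1
      · intro i h1 h2 h3
        rw [← hq i (by omega)]
        exact hb2 i (by omega) h2 h3
  · refine Or.inr ⟨pmax, pmin, hmax, hmin, ?_, ?_⟩
    · rw [(hmax k).eq_maxEdge, pmax.2, h1]
    · rw [(hmin k).eq_minEdge, pmin.2, h2]

/-! ### The adic map -/

/-- `q` is the successor of `p`, and `n` is the first index at which `p` is not maximal. -/
structure IsNext (p q : x.PathSpace) (n : ℕ) : Prop where
  max : ∀ i < n, IsMaxEdge (p.1 i)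
  min : ∀ i < n, IsMinEdge (q.1 i)
  fst : (q.1 n).1 = (p.1 n).1
  snd : ((q.1 n).2 : ℕ) = (p.1 n).2 + 1
  tail : ∀ i, n < i → q.1 i = p.1 i

theorem IsNext.not_isMaxEdge {p q : x.PathSpace} {n : ℕ} (h : IsNext p q n) :
    ¬ IsMaxEdge (p.1 n) := fun hm => hm (q.1 n) ⟨h.fst.symm, by have := h.snd; omega⟩

theorem IsNext.not_isMinEdge {p q : x.PathSpace} {n : ℕ} (h : IsNext p q n) :
    ¬ IsMinEdge (q.1 n) := fun hm => hm (p.1 n) ⟨h.fst.symm, by have := h.snd; omega⟩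

theorem IsNext.isSucc {p q : x.PathSpace} {n : ℕ} (h : IsNext p q n) {m N : ℕ} (hm : m ≤ n)
    (hN : n < N) : (seg p m N).IsSucc (seg q m N) :=
  isSucc_seg hm hN h.fst h.snd (fun i _ hi => h.max i hi) (fun i _ hi => h.min i hi)
    fun i hi _ => h.tail i hi

theorem IsNext.isSuccessor {p q : x.PathSpace} {n : ℕ} (h : IsNext p q n) : IsSuccessor p q :=
  ⟨n, h.max, h.not_isMaxEdge, h.isSucc (Nat.zero_le n) (Nat.lt_succ_self n), h.tail⟩

theorem exists_isNext {p : x.PathSpace} {n : ℕ} (h : ∀ i < n, IsMaxEdge (p.1 i))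
    (hn : ¬ IsMaxEdge (p.1 n)) : ∃ q, IsNext p q n := by
  obtain ⟨f, hf1, hf2⟩ := exists_next hn
  obtain ⟨q, hq, hq'⟩ := exists_replace p n f hf1
  obtain ⟨r, hr, hr'⟩ := exists_min_below q n
  have hrn : r.1 n = f := by rw [hr' n le_rfl, hq]
  exact ⟨r, h, hr, by rw [hrn, hf1], by rw [hrn, hf2],
    fun i hi => by rw [hr' i hi.le, hq' i hi]⟩

theorem exists_isNext_of_min {q : x.PathSpace} {n : ℕ} (h : ∀ i < n, IsMinEdge (q.1 i))
    (hn : ¬ IsMinEdge (q.1 n)) : ∃ p, IsNext p q n := by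
  obtain ⟨f, hf1, hf2⟩ := exists_prev hn
  obtain ⟨p, hp, hp'⟩ := exists_replace q n f hf1
  obtain ⟨r, hr, hr'⟩ := exists_max_below p n
  have hrn : r.1 n = f := by rw [hr' n le_rfl, hp]
  exact ⟨r, hr, h, by rw [hrn, hf1], by rw [hrn, hf2],
    fun i hi => by rw [hr' i hi.le, hp' i hi]⟩

/-- The odometer formula also yields an immediate successor of `p`. If it differed from `q`, the two
would be comparable and one would lie strictly between `p` and the other. -/
theorem IsSuccessor.exists_isNext {p q : x.PathSpace} (h : IsSuccessor p q) :
    ∃ n, IsNext p q n := by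
  obtain ⟨n, h1, h2, h3, h4⟩ := h
  obtain ⟨r, hr⟩ := OrderedBratteli.exists_isNext h1 h2
  suffices q = r by exact ⟨n, this ▸ hr⟩
  by_contra hne
  have hlt : (seg p 0 (n + 1)).IsSucc (seg q 0 (n + 1)) := h3
  have hlt' := hr.isSucc (Nat.zero_le n) (Nat.lt_succ_self n)
  obtain ⟨i, hi⟩ : ∃ i, q.1 i ≠ r.1 i := by
    by_contra! h
    exact hne (Subtype.ext (funext h))
  have hin : i < n + 1 := by
    by_contra hcon
    exact hi (by rw [h4 i (by omega), hr.tail i (by omega)])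
  obtain ⟨j, -, hj, hj' | hj', hj''⟩ := exists_edgeLt_of_ne q r hin hi
    (by rw [h4 _ (by omega), hr.tail _ (by omega)])
  · exact hlt'.2 _ ⟨hlt.1, seg_lt_iff.2 ⟨j, Nat.zero_le j, hj, hj', fun i _ h h' => hj'' i h' h⟩⟩
  · exact hlt.2 _ ⟨hlt'.1, seg_lt_iff.2 ⟨j, Nat.zero_le j, hj, hj',
      fun i _ h h' => (hj'' i h' h).symm⟩⟩

theorem exists_not_max_first {p : x.PathSpace} (h : ¬ IsMaxPath p) :
    ∃ n, (∀ i < n, IsMaxEdge (p.1 i)) ∧ ¬ IsMaxEdge (p.1 n) := by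
  classical
  have hex : ∃ n, ¬ IsMaxEdge (p.1 n) := not_forall.1 h
  exact ⟨Nat.find hex, fun i hi => not_not.1 (Nat.find_min hex hi), Nat.find_spec hex⟩

theorem exists_not_min_first {p : x.PathSpace} (h : ¬ IsMinPath p) :
    ∃ n, (∀ i < n, IsMinEdge (p.1 i)) ∧ ¬ IsMinEdge (p.1 n) := by
  classical
  have hex : ∃ n, ¬ IsMinEdge (p.1 n) := not_forall.1 h
  exact ⟨Nat.find hex, fun i hi => not_not.1 (Nat.find_min hex hi), Nat.find_spec hex⟩

theorem exists_isNext_adic {p : x.PathSpace} (h : ¬ IsMaxPath p) : ∃ n, IsNext p (adic p) n := by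
  obtain ⟨n, h1, h2⟩ := exists_not_max_first h
  obtain ⟨q, hq⟩ := exists_isNext h1 h2
  have hex : ∃ q, AdicStep p q := ⟨q, Or.inl hq.isSuccessor⟩
  have : AdicStep p (adic p) := by
    rw [adic, dif_pos hex]
    exact hex.choose_spec
  rcases this with h' | h'
  · exact h'.exists_isNext
  · exact absurd h'.1 h

theorem ProperlyOrdered.isMinPath_adic (hP : x.ProperlyOrdered) {p : x.PathSpace}
    (h : IsMaxPath p) : IsMinPath (adic p) := by
  obtain ⟨q, hq, -⟩ := hP.1
  have hex : ∃ q, AdicStep p q := ⟨q, Or.inr ⟨h, hq⟩⟩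
  have : AdicStep p (adic p) := by
    rw [adic, dif_pos hex]
    exact hex.choose_spec
  rcases this with h' | h'
  · obtain ⟨n, hn⟩ := h'.exists_isNext
    exact absurd (h n) hn.not_isMaxEdge
  · exact h'.2

theorem eq_below_of_min {p q : x.PathSpace} {n : ℕ} (hp : ∀ i < n, IsMinEdge (p.1 i))
    (hq : ∀ i < n, IsMinEdge (q.1 i)) (h : src (p.1 n) = src (q.1 n)) :
    ∀ i < n, p.1 i = q.1 i := by
  induction n with
  | zero => exact fun i hi => absurd hi (Nat.not_lt_zero i)
  | succ n ih =>
    have hn : p.1 n = q.1 n := (hp n (Nat.lt_succ_self n)).eq_of_ran_eq (hq n (Nat.lt_succ_self n))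
      (by rw [p.2, q.2, h])
    intro i hi
    rcases Nat.lt_succ_iff_lt_or_eq.1 hi with hi | rfl
    · exact ih (fun i hi => hp i (by omega)) (fun i hi => hq i (by omega)) (by rw [hn]) i hi
    · exact hn

theorem eq_below_of_max {p q : x.PathSpace} {n : ℕ} (hp : ∀ i < n, IsMaxEdge (p.1 i))
    (hq : ∀ i < n, IsMaxEdge (q.1 i)) (h : src (p.1 n) = src (q.1 n)) :
    ∀ i < n, p.1 i = q.1 i := by
  induction n with
  | zero => exact fun i hi => absurd hi (Nat.not_lt_zero i)
  | succ n ih =>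
    have hn : p.1 n = q.1 n := (hp n (Nat.lt_succ_self n)).eq_of_ran_eq (hq n (Nat.lt_succ_self n))
      (by rw [p.2, q.2, h])
    intro i hi
    rcases Nat.lt_succ_iff_lt_or_eq.1 hi with hi | rfl
    · exact ih (fun i hi => hp i (by omega)) (fun i hi => hq i (by omega)) (by rw [hn]) i hi
    · exact hn

theorem IsNext.left_unique {p p' q : x.PathSpace} {n n' : ℕ} (h : IsNext p q n)
    (h' : IsNext p' q n') : p = p' := by
  obtain rfl : n = n' := by
    rcases lt_trichotomy n n' with hn | hn | hn
    · exact absurd (h'.min n hn) h.not_isMinEdge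
    · exact hn
    · exact absurd (h.min n' hn) h'.not_isMinEdge
  have hn : p.1 n = p'.1 n := Edge.ext_val (by rw [← h.fst, ← h'.fst])
    (by have := h.snd; have := h'.snd; omega)
  apply Subtype.ext
  funext i
  rcases lt_trichotomy i n with hi | rfl | hi
  · exact eq_below_of_max h.max h'.max (by rw [hn]) i hi
  · exact hn
  · rw [← h.tail i hi, ← h'.tail i hi]

theorem IsNext.right_unique {p q q' : x.PathSpace} {n n' : ℕ} (h : IsNext p q n)
    (h' : IsNext p q' n') : q = q' := by
  obtain rfl : n = n' := by
    rcases lt_trichotomy n n' with hn | hn | hn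
    · exact absurd (h'.max n hn) h.not_isMaxEdge
    · exact hn
    · exact absurd (h.max n' hn) h'.not_isMaxEdge
  have hn : q.1 n = q'.1 n := Edge.ext_val (by rw [h.fst, h'.fst])
    (by have := h.snd; have := h'.snd; omega)
  apply Subtype.ext
  funext i
  rcases lt_trichotomy i n with hi | rfl | hi
  · exact eq_below_of_min h.min h'.min (by rw [hn]) i hi
  · exact hn
  · rw [h.tail i hi, h'.tail i hi]

theorem ProperlyOrdered.adic_injective (hP : x.ProperlyOrdered) :
    Function.Injective (adic : x.PathSpace → x.PathSpace) := by
  intro p p' h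
  by_cases hp : IsMaxPath p <;> by_cases hp' : IsMaxPath p'
  · exact hP.2.unique hp hp'
  · obtain ⟨n, hn⟩ := exists_isNext_adic hp'
    exact absurd (h ▸ hP.isMinPath_adic hp n) hn.not_isMinEdge
  · obtain ⟨n, hn⟩ := exists_isNext_adic hp
    exact absurd (h ▸ hP.isMinPath_adic hp' n) hn.not_isMinEdge
  · obtain ⟨n, hn⟩ := exists_isNext_adic hp
    obtain ⟨n', hn'⟩ := exists_isNext_adic hp'
    rw [← h] at hn'
    exact hn.left_unique hn'

theorem ProperlyOrdered.adic_surjective (hP : x.ProperlyOrdered) :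
    Function.Surjective (adic : x.PathSpace → x.PathSpace) := by
  intro q
  by_cases hq : IsMinPath q
  · obtain ⟨p, hp, -⟩ := hP.2
    exact ⟨p, hP.1.unique (hP.isMinPath_adic hp) hq⟩
  · obtain ⟨n, h1, h2⟩ := exists_not_min_first hq
    obtain ⟨p, hp⟩ := exists_isNext_of_min h1 h2
    obtain ⟨n', hn'⟩ := exists_isNext_adic (p := p) fun h => hp.not_isMaxEdge (h n)
    exact ⟨p, hn'.right_unique hp⟩

theorem eventually_agree (p : x.PathSpace) (N : ℕ) : ∀ᶠ p' in 𝓝 p, ∀ i < N, p'.1 i = p.1 i := by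
  have := (Set.finite_lt_nat N).eventually_all (l := 𝓝 p)
    (p := fun i (p' : x.PathSpace) => p'.1 i = p.1 i)
  refine this.2 fun i _ => ?_
  exact (continuous_coord i).continuousAt.eventually
    (mem_nhds_discrete.2 rfl : {e | e = p.1 i} ∈ 𝓝 (p.1 i))

/-- Away from the maximal path, any given edge of the image depends on finitely many edges. Near the
maximal path the image starts with a long minimal segment, and `exists_level_min` then determines
its first edges. -/
theorem ProperlyOrdered.continuous_adic (hP : x.ProperlyOrdered) :
    Continuous (adic : x.PathSpace → x.PathSpace) := by
  refine continuous_induced_rng.2 (continuous_pi fun k => continuous_iff_continuousAt.2 fun p => ?_)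
  suffices ∀ᶠ p' in 𝓝 p, (adic p').1 k = (adic p).1 k from
    tendsto_const_nhds.congr' (this.mono fun _ h => h.symm)
  by_cases hp : IsMaxPath p
  · obtain ⟨M, hM, hM'⟩ := hP.exists_level_min (k + 1)
    filter_upwards [eventually_agree p M] with p' hp'
    have hm := hP.isMinPath_adic hp
    have hmin : ∀ i < M, IsMinEdge ((adic p').1 i) := by
      by_cases h : IsMaxPath p'
      · exact fun i _ => hP.isMinPath_adic h i
      · obtain ⟨n, hn⟩ := exists_isNext_adic h
        have : M ≤ n := not_lt.1 fun h => hn.not_isMaxEdge (by rw [hp' n h]; exact hp n)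
        exact fun i hi => hn.min i (by omega)
    refine (hmin k (by omega)).eq_of_ran_eq (hm k) ?_
    rw [(adic p').2, (adic p).2]
    exact hM' _ _ (fun i _ hi => hmin i hi) fun i _ _ => hm i
  · obtain ⟨n, hn⟩ := exists_isNext_adic hp
    filter_upwards [eventually_agree p (n + k + 1)] with p' hp'
    have hp'n : ¬ IsMaxPath p' := fun h => hn.not_isMaxEdge (by rw [← hp' n (by omega)]; exact h n)
    obtain ⟨n', hn'⟩ := exists_isNext_adic hp'n
    obtain rfl : n = n' := by
      rcases lt_trichotomy n n' with h | h | h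
      · exact absurd (hn'.max n h) (by rw [hp' n (by omega)]; exact hn.not_isMaxEdge)
      · exact h
      · exact absurd (hn.max n' h) (by rw [← hp' n' (by omega)]; exact hn'.not_isMaxEdge)
    have hq : (adic p').1 n = (adic p).1 n := Edge.ext_val
      (by rw [hn'.fst, hn.fst, hp' n (by omega)])
      (by rw [hn'.snd, hn.snd, hp' n (by omega)])
    rcases lt_trichotomy k n with hk | rfl | hk
    · exact eq_below_of_min hn'.min hn.min (by rw [hq]) k hk
    · exact hq
    · rw [hn'.tail k hk, hn.tail k hk, hp' k (by omega)]

/-- The adic map of a properly ordered diagram, as a homeomorphism. -/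
noncomputable def ProperlyOrdered.adicHomeo (hP : x.ProperlyOrdered) :
    x.PathSpace ≃ₜ x.PathSpace :=
  Continuous.homeoOfEquivCompactToT2
    (f := Equiv.ofBijective adic ⟨hP.adic_injective, hP.adic_surjective⟩) hP.continuous_adic

/-! ### How the adic map moves heights -/

theorem IsNext.hgt_src {p q : x.PathSpace} {n : ℕ} (h : IsNext p q n) (l : x.V 0 → ℝ) {k : ℕ}
    (hk : n < k) :
    hgt l q k = hgt l p k + l (src (p.1 0)) ∧ src (q.1 k) = src (p.1 k) := by
  refine ⟨?_, by rw [h.tail k hk]⟩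
  induction k, Nat.succ_le_of_lt hk using Nat.le_induction with
  | base =>
    have h1 := hgt_eq_of_min l (Nat.zero_le n) fun i _ hi => h.min i hi
    have h2 := rest_eq_of_max l (Nat.zero_le n) fun i _ hi => h.max i hi
    rw [rest_zero, rest] at h2
    rw [Nat.succ_eq_add_one, hgt_succ, hgt_succ, h1, off_next l h.fst h.snd, hgt_zero]
    linarith
  | succ k hk ih =>
    rw [hgt_succ, hgt_succ, h.tail k (by omega), ih (by omega)]
    ring

/-- Seen from level `k`, either the successor is the next floor of the same tower, or `p` is on the
top floor and its image on the bottom floor of an adjacent tower. The maximal path falls under the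
second case at every level. -/
theorem ProperlyOrdered.adic_hgt (hP : x.ProperlyOrdered) (l : x.V 0 → ℝ) (p : x.PathSpace)
    (k : ℕ) :
    (hgt l (adic p) k = hgt l p k + l (src (p.1 0)) ∧ src ((adic p).1 k) = src (p.1 k)) ∨
    (hgt l (adic p) k = 0 ∧ rest l p k = l (src (p.1 0)) ∧
      x.Adjacent k (src (p.1 k)) (src ((adic p).1 k))) := by
  by_cases hp : IsMaxPath p
  · have hm := hP.isMinPath_adic hp
    refine Or.inr ⟨?_, ?_, Or.inr ⟨p, adic p, hp, hm, rfl, rfl⟩⟩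
    · exact hgt_eq_of_min l (Nat.zero_le k) fun i _ _ => hm i
    · rw [rest_eq_of_max l (Nat.zero_le k) fun i _ _ => hp i, rest_zero]
  · obtain ⟨n, hn⟩ := exists_isNext_adic hp
    rcases lt_or_ge n k with hk | hk
    · exact Or.inl (hn.hgt_src l hk)
    · refine Or.inr ⟨?_, ?_, Or.inl ⟨n + 1, by omega, seg p k (n + 1), seg (adic p) k (n + 1), rfl,
        rfl, hn.isSucc hk (Nat.lt_succ_self n)⟩⟩
      · exact hgt_eq_of_min l (Nat.zero_le k) fun i _ hi => hn.min i (by omega)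
      · rw [rest_eq_of_max l (Nat.zero_le k) fun i _ hi => hn.max i (by omega), rest_zero]

end OrderedBratteli
namespace OrderedBratteli

variable {x : OrderedBratteli}

/-! ### The graphs -/

/-- The standing assumptions on the growth rate and the edge lengths. -/
structure Admissible (lam : ℝ) (l : x.V 0 → ℝ) : Prop where
  one_lt : 1 < lam
  pos : ∀ v, 0 < l v

variable {lam : ℝ} {l : x.V 0 → ℝ}

namespace Admissible

theorem nonneg (hA : Admissible lam l) (v : x.V 0) : 0 ≤ l v := (hA.pos v).le

theorem lam_pos (hA : Admissible lam l) : 0 < lam := one_pos.trans hA.one_lt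

theorem scale_pos (hA : Admissible lam l) (k : ℕ) : 0 < (lam⁻¹) ^ k :=
  pow_pos (inv_pos.2 hA.lam_pos) k

theorem len_pos (hA : Admissible lam l) (k : ℕ) (v : x.V k) : 0 < x.len lam l k v :=
  mul_pos (hA.scale_pos k) (ht_pos hA.pos k v)

end Admissible

/-- The point of `Γ^k` at height `τ` over the beginning of the edge `e_v`, where heights are
measured before the rescaling by `λ^{-k}`; heights outside `[0, ht l k v]` are truncated. -/
noncomputable def gpt (hA : Admissible lam l) {k : ℕ} (v : x.V k) (τ : ℝ) : x.Graph lam l k :=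
  pt v (Set.projIcc 0 (x.len lam l k v) (hA.len_pos k v).le ((lam⁻¹) ^ k * τ))

theorem continuous_gpt (hA : Admissible lam l) {k : ℕ} (v : x.V k) : Continuous (gpt hA v) :=
  continuous_quot_mk.comp (continuous_sigmaMk.comp
    (continuous_projIcc.comp (continuous_const.mul continuous_id)))

theorem scale_mem (hA : Admissible lam l) {k : ℕ} {v : x.V k} {τ : ℝ} (h₀ : 0 ≤ τ)
    (h₁ : τ ≤ ht l k v) : (lam⁻¹) ^ k * τ ∈ Set.Icc 0 (x.len lam l k v) :=
  ⟨mul_nonneg (hA.scale_pos k).le h₀, mul_le_mul_of_nonneg_left h₁ (hA.scale_pos k).le⟩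

theorem gpt_eq_pt (hA : Admissible lam l) {k : ℕ} {v : x.V k} {τ : ℝ} (h₀ : 0 ≤ τ)
    (h₁ : τ ≤ ht l k v) : gpt hA v τ = pt v ⟨_, scale_mem hA h₀ h₁⟩ := by
  rw [gpt, Set.projIcc_of_mem _ (scale_mem hA h₀ h₁)]

theorem pt_eq_gpt (hA : Admissible lam l) {k : ℕ} {v : x.V k}
    (s : Set.Icc (0 : ℝ) (x.len lam l k v)) {τ : ℝ} (hs : (s : ℝ) = (lam⁻¹) ^ k * τ) :
    pt v s = gpt hA v τ := by
  rw [gpt, ← hs, Set.projIcc_val]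

theorem mem_of_scale (hA : Admissible lam l) {k : ℕ} {v : x.V k}
    (s : Set.Icc (0 : ℝ) (x.len lam l k v)) {τ : ℝ} (hs : (s : ℝ) = (lam⁻¹) ^ k * τ) :
    0 ≤ τ ∧ τ ≤ ht l k v := by
  have h := s.2
  rw [hs] at h
  exact ⟨nonneg_of_mul_nonneg_right h.1 (hA.scale_pos k),
    le_of_mul_le_mul_left h.2 (hA.scale_pos k)⟩

theorem exists_scale (hA : Admissible lam l) (k : ℕ) (s : ℝ) : ∃ τ, s = (lam⁻¹) ^ k * τ :=
  ⟨((lam⁻¹) ^ k)⁻¹ * s, by rw [mul_inv_cancel_left₀ (hA.scale_pos k).ne']⟩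

theorem exists_gpt (hA : Admissible lam l) {k : ℕ} (y : x.Graph lam l k) :
    ∃ v τ, 0 ≤ τ ∧ τ ≤ ht l k v ∧ y = gpt hA v τ := by
  induction y using Quot.ind with
  | mk a =>
    obtain ⟨v, s⟩ := a
    obtain ⟨τ, hτ⟩ := exists_scale hA k s
    exact ⟨v, τ, (mem_of_scale hA s hτ).1, (mem_of_scale hA s hτ).2, pt_eq_gpt hA s hτ⟩

theorem gpt_glue (hA : Admissible lam l) {k : ℕ} {v w : x.V k} (h : x.Adjacent k v w) :
    gpt hA v (ht l k v) = gpt hA w 0 := by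
  rw [gpt_eq_pt hA (ht_pos hA.pos k v).le le_rfl, gpt_eq_pt hA le_rfl (ht_pos hA.pos k w).le]
  exact Quot.sound ⟨h, rfl, mul_zero _⟩

open Classical in
/-- The edge and the position of a point in the interior of an edge. -/
noncomputable def coord {k : ℕ} : x.Graph lam l k → Option (x.V k × ℝ) :=
  Quot.lift (fun a => if 0 < (a.2 : ℝ) ∧ (a.2 : ℝ) < x.len lam l k a.1 then
    some (a.1, (a.2 : ℝ)) else none) (by
      rintro a b ⟨-, ha, hb⟩
      rw [if_neg (by rw [ha]; exact fun h => lt_irrefl _ h.2),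
        if_neg (by rw [hb]; exact fun h => lt_irrefl _ h.1)])

theorem coord_gpt (hA : Admissible lam l) {k : ℕ} {v : x.V k} {τ : ℝ} (h₀ : 0 < τ)
    (h₁ : τ < ht l k v) : coord (gpt hA v τ) = some (v, (lam⁻¹) ^ k * τ) := by
  rw [gpt_eq_pt hA h₀.le h₁.le]
  exact if_pos ⟨mul_pos (hA.scale_pos k) h₀, mul_lt_mul_of_pos_left h₁ (hA.scale_pos k)⟩

theorem coord_gpt_zero (hA : Admissible lam l) {k : ℕ} (v : x.V k) :
    coord (gpt hA v 0) = none := by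
  rw [gpt_eq_pt hA le_rfl (ht_pos hA.pos k v).le]
  exact if_neg fun h => by simp at h

theorem coord_gpt_ht (hA : Admissible lam l) {k : ℕ} (v : x.V k) :
    coord (gpt hA v (ht l k v)) = none := by
  rw [gpt_eq_pt hA (ht_pos hA.pos k v).le le_rfl]
  exact if_neg fun h => lt_irrefl _ h.2

theorem gpt_inj (hA : Admissible lam l) {k : ℕ} {v w : x.V k} {τ σ : ℝ} (h₀ : 0 < τ)
    (h₁ : τ < ht l k v) (h₂ : 0 ≤ σ) (h₃ : σ ≤ ht l k w) (h : gpt hA v τ = gpt hA w σ) :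
    v = w ∧ τ = σ := by
  have hc := congrArg coord h
  rw [coord_gpt hA h₀ h₁] at hc
  rcases eq_or_lt_of_le h₂ with rfl | h₂
  · rw [coord_gpt_zero] at hc
    exact absurd hc (by simp)
  rcases eq_or_lt_of_le h₃ with rfl | h₃
  · rw [coord_gpt_ht] at hc
    exact absurd hc (by simp)
  rw [coord_gpt hA h₂ h₃, Option.some_inj, Prod.mk.injEq] at hc
  exact ⟨hc.1, mul_left_cancel₀ (hA.scale_pos k).ne' hc.2⟩

theorem isVertex_gpt_zero (hA : Admissible lam l) {k : ℕ} (v : x.V k) :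
    IsVertex (gpt hA v 0) := by
  rw [gpt_eq_pt hA le_rfl (ht_pos hA.pos k v).le]
  exact ⟨v, _, rfl, Or.inl (mul_zero _)⟩

theorem IsVertex.coord_eq_none {k : ℕ} {y : x.Graph lam l k}
    (h : IsVertex y) : coord y = none := by
  obtain ⟨v, s, rfl, hs⟩ := h
  refine if_neg fun h => ?_
  rcases hs with hs | hs <;> simp only [hs] at h
  · exact lt_irrefl _ h.1
  · exact lt_irrefl _ h.2

theorem IsVertex.eq_zero_or_eq_ht (hA : Admissible lam l) {k : ℕ} {v : x.V k} {τ : ℝ}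
    (h : IsVertex (gpt hA v τ)) (h₀ : 0 ≤ τ) (h₁ : τ ≤ ht l k v) : τ = 0 ∨ τ = ht l k v := by
  by_contra! hcon
  have := h.coord_eq_none
  rw [coord_gpt hA (lt_of_le_of_ne h₀ hcon.1.symm) (lt_of_le_of_ne h₁ hcon.2)] at this
  exact absurd this (by simp)

/-! ### The graphs are Hausdorff -/

theorem continuous_graph_lift {k : ℕ} (F : x.PreGraph lam l k → ℝ)
    (hF : ∀ v, Continuous fun s => F ⟨v, s⟩)
    (h : ∀ a b : x.PreGraph lam l k,
      x.Adjacent k a.1 b.1 ∧ (a.2 : ℝ) = x.len lam l k a.1 ∧ (b.2 : ℝ) = 0 → F a = F b) :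
    Continuous (Quot.lift F h : x.Graph lam l k → ℝ) :=
  continuous_quot_lift h (continuous_sigma hF)

/-- A function on the edges descends to the quotient once it agrees at glued end points. Two bump
functions on an edge recover interior positions, and an interpolated indicator separates vertices.
-/
theorem eq_of_forall_continuous (hA : Admissible lam l) {k : ℕ} {y z : x.Graph lam l k}
    (h : ∀ f : x.Graph lam l k → ℝ, Continuous f → f y = f z) : y = z := by
  classical
  let L := x.len lam l k
  have hL : ∀ v, 0 < L v := hA.len_pos k
  have hbump : ∀ (n : ℕ) (v : x.V k) (a b : x.PreGraph lam l k),
      Quot.mk _ a = y → Quot.mk _ b = z →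
      (if a.1 = v then (a.2 : ℝ) ^ (n + 1) * (L v - a.2) else 0) =
        (if b.1 = v then (b.2 : ℝ) ^ (n + 1) * (L v - b.2) else 0) := by
    rintro n v a b rfl rfl
    refine h _ (continuous_graph_lift
      (fun a => if a.1 = v then (a.2 : ℝ) ^ (n + 1) * (L v - a.2) else 0) ?_ ?_)
    · intro w
      by_cases hw : w = v
      · simp only [hw, if_true]
        fun_prop
      · simp only [hw, if_false]
        exact continuous_const
    · rintro ⟨v₁, s₁⟩ ⟨v₂, s₂⟩ ⟨-, h1, h2⟩
      simp only at h1 h2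
      simp only [h1, h2]
      split_ifs with h3 h4 h4
      · simp [L, h3]
      · simp [L, h3]
      · simp
      · rfl
  have hinner : ∀ a b : x.PreGraph lam l k, Quot.mk _ a = y → Quot.mk _ b = z →
      0 < (a.2 : ℝ) → (a.2 : ℝ) < L a.1 → a = b := by
    rintro ⟨v, s⟩ ⟨w, t⟩ ha hb h0 h1
    have e0 := hbump 0 v _ _ ha hb
    have e1 := hbump 1 v _ _ ha hb
    simp only [if_true] at e0 e1
    have hpos : 0 < (s : ℝ) * (L v - s) := mul_pos h0 (sub_pos.2 h1)
    by_cases hw : w = v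
    · subst hw
      simp only [if_true] at e0 e1
      -- The quotient of the bumps `s² (L - s)` and `s (L - s)` is the position `s`.
      have : ((s : ℝ) - t) * (s * (L w - s)) = 0 := by
        have e0' : (s : ℝ) * (L w - s) = t * (L w - t) := by linear_combination e0
        have e1' : (s : ℝ) * (s * (L w - s)) = t * (t * (L w - t)) := by linear_combination e1
        rw [← e0'] at e1'
        linear_combination e1'
      rcases mul_eq_zero.1 this with h2 | h2
      · obtain rfl : s = t := Subtype.ext (by linarith)
        rfl
      · exact absurd h2 hpos.ne'
    · simp only [hw, if_false] at e0
      simp only [zero_add, pow_one] at e0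
      exact absurd e0 hpos.ne'
  have hvert : ∀ a b : x.PreGraph lam l k, Quot.mk _ a = y → Quot.mk _ b = z →
      ((a.2 : ℝ) = 0 ∨ (a.2 : ℝ) = L a.1) → ((b.2 : ℝ) = 0 ∨ (b.2 : ℝ) = L b.1) → y = z := by
    intro a b ha hb ha' hb'
    let start : ∀ v, x.Graph lam l k := fun v => pt v ⟨0, le_rfl, (hL v).le⟩
    let fin : ∀ v, x.Graph lam l k := fun v => pt v ⟨L v, (hL v).le, le_rfl⟩
    -- The indicator of the vertex `y` on the end points, extended linearly along every edge.
    let F : x.PreGraph lam l k → ℝ := fun a =>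
      (1 - a.2 / L a.1) * (if start a.1 = y then 1 else 0) +
        (a.2 / L a.1) * (if fin a.1 = y then 1 else 0)
    have hF : ∀ c : x.PreGraph lam l k, ((c.2 : ℝ) = 0 ∨ (c.2 : ℝ) = L c.1) →
        F c = if Quot.mk _ c = y then 1 else 0 := by
      rintro ⟨v, s⟩ (hc | hc)
      · have : (Quot.mk _ ⟨v, s⟩ : x.Graph lam l k) = start v :=
          congrArg (pt v) (Subtype.ext hc)
        rw [this]
        simp only at hc
        simp [F, hc]
      · have : (Quot.mk _ ⟨v, s⟩ : x.Graph lam l k) = fin v :=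
          congrArg (pt v) (Subtype.ext hc)
        rw [this]
        simp only at hc
        simp [F, hc, div_self (hL v).ne']
    have hrel : ∀ a b : x.PreGraph lam l k,
        x.Adjacent k a.1 b.1 ∧ (a.2 : ℝ) = x.len lam l k a.1 ∧ (b.2 : ℝ) = 0 → F a = F b := by
      rintro a b ⟨h1, h2, h3⟩
      rw [hF a (Or.inr h2), hF b (Or.inl h3), Quot.sound ⟨h1, h2, h3⟩]
    have hcont : Continuous (Quot.lift F hrel : x.Graph lam l k → ℝ) :=
      continuous_graph_lift F (fun v => by
        have : ∀ c₁ c₂ : ℝ, Continuous fun s : Set.Icc (0 : ℝ) (x.len lam l k v) =>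
            (1 - (s : ℝ) / L v) * c₁ + (s : ℝ) / L v * c₂ := by
          intros
          fun_prop
        exact this (if start v = y then 1 else 0) (if fin v = y then 1 else 0)) hrel
    have : F a = F b := (congrArg (Quot.lift F hrel) ha).trans
      ((h _ hcont).trans (congrArg (Quot.lift F hrel) hb).symm)
    rw [hF a ha', hF b hb', if_pos ha] at this
    by_contra hne
    rw [if_neg (by rw [hb]; exact fun h => hne h.symm)] at this
    exact one_ne_zero this
  have hinner' : ∀ a b : x.PreGraph lam l k, Quot.mk _ a = y → Quot.mk _ b = z →
      0 < (b.2 : ℝ) → (b.2 : ℝ) < L b.1 → 0 < (a.2 : ℝ) ∧ (a.2 : ℝ) < L a.1 := by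
    rintro ⟨v, s⟩ ⟨w, t⟩ ha hb h0 h1
    have e0 := hbump 0 w _ _ ha hb
    simp only [if_true] at e0
    have hpos : 0 < (t : ℝ) * (L w - t) := mul_pos h0 (sub_pos.2 h1)
    by_cases hw : v = w
    · subst hw
      simp only [if_true, zero_add, pow_one] at e0
      rw [← e0] at hpos
      have hs := s.2.1
      have hs' : (s : ℝ) ≤ L v := s.2.2
      refine ⟨lt_of_le_of_ne hs fun h => ?_, lt_of_le_of_ne hs' fun h => ?_⟩
      · rw [← h] at hpos
        simp at hpos
      · rw [h] at hpos
        simp at hpos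
    · simp only [hw, if_false, zero_add, pow_one] at e0
      exact absurd e0 hpos.ne
  obtain ⟨a, ha⟩ := Quot.exists_rep y
  obtain ⟨b, hb⟩ := Quot.exists_rep z
  by_cases h1 : 0 < (a.2 : ℝ) ∧ (a.2 : ℝ) < L a.1
  · rw [← ha, ← hb, hinner a b ha hb h1.1 h1.2]
  · have ha' : (a.2 : ℝ) = 0 ∨ (a.2 : ℝ) = L a.1 := by
      by_contra! hcon
      exact h1 ⟨lt_of_le_of_ne a.2.2.1 hcon.1.symm, lt_of_le_of_ne a.2.2.2 hcon.2⟩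
    refine hvert a b ha hb ha' ?_
    by_contra! hcon
    exact h1 (hinner' a b ha hb (lt_of_le_of_ne b.2.2.1 hcon.1.symm)
      (lt_of_le_of_ne b.2.2.2 hcon.2))

theorem Admissible.t2Space_graph (hA : Admissible lam l) (k : ℕ) :
    T2Space (x.Graph lam l k) := by
  refine ⟨fun y z hne => ?_⟩
  obtain ⟨f, hf, hyz⟩ : ∃ f : x.Graph lam l k → ℝ, Continuous f ∧ f y ≠ f z := by
    by_contra! h
    exact hne (eq_of_forall_continuous hA h)
  exact separated_by_continuous hf hyz

theorem Admissible.t2Space_solenoid (hA : Admissible lam l) : T2Space (x.Solenoid lam l) := by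
  have := hA.t2Space_graph
  infer_instance

/-! ### The wrapping maps -/

theorem sum_len_eq_off (lam : ℝ) (l : x.V 0 → ℝ) {k : ℕ} (e : x.Edge k) :
    (∑ j ∈ Finset.univ.filter (fun j : Fin (x.into k e.1).length => j < e.2),
        x.len lam l k ((x.into k e.1).get j)) = (lam⁻¹) ^ k * off l e := by
  rw [off, partialHt, Finset.mul_sum]
  rfl

theorem wraps_gpt (hA : Admissible lam l) {k : ℕ} (e : x.Edge k) {τ : ℝ} (h₀ : 0 ≤ τ)
    (h₁ : τ ≤ ht l k (src e)) : Wraps (gpt hA (ran e) (off l e + τ)) (gpt hA (src e) τ) := by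
  have h2 := off_nonneg hA.nonneg e
  have h3 := off_add_le hA.nonneg e
  refine ⟨e, _, _, gpt_eq_pt hA (by linarith) (by linarith), gpt_eq_pt hA h₀ h₁, ?_⟩
  rw [sum_len_eq_off]
  simp only [pow_succ]
  have := hA.lam_pos.ne'
  field_simp

theorem wraps_iff (hA : Admissible lam l) {k : ℕ} {z : x.Graph lam l (k + 1)}
    {y : x.Graph lam l k} : Wraps z y ↔ ∃ (e : x.Edge k) (τ : ℝ), 0 ≤ τ ∧ τ ≤ ht l k (src e) ∧
      z = gpt hA (ran e) (off l e + τ) ∧ y = gpt hA (src e) τ := by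
  constructor
  · rintro ⟨e, s, t, rfl, rfl, h⟩
    obtain ⟨τ, hτ⟩ := exists_scale hA k t
    refine ⟨e, τ, (mem_of_scale hA t hτ).1, (mem_of_scale hA t hτ).2, pt_eq_gpt hA s ?_,
      pt_eq_gpt hA t hτ⟩
    rw [sum_len_eq_off, hτ, ← mul_add] at h
    have := hA.lam_pos.ne'
    rw [pow_succ, mul_right_comm, ← h]
    field_simp
  · rintro ⟨e, τ, h₀, h₁, rfl, rfl⟩
    exact wraps_gpt hA e h₀ h₁

open Classical in
/-- The action of the wrapping map on the vertices of the graph. -/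
noncomputable def vertexMap (hA : Admissible lam l) {k : ℕ} :
    x.Graph lam l (k + 1) → x.Graph lam l k :=
  Quot.lift (fun a => if (a.2 : ℝ) = 0 then gpt hA (src (minEdge a.1)) 0 else
    gpt hA (src (maxEdge a.1)) (ht l k (src (maxEdge a.1)))) (by
      rintro a b ⟨h, ha, hb⟩
      rw [if_neg (by rw [ha]; exact (hA.len_pos _ _).ne'), if_pos hb]
      exact gpt_glue hA h.src_maxEdge_minEdge)

theorem vertexMap_gpt_zero (hA : Admissible lam l) {k : ℕ} (v : x.V (k + 1)) :
    vertexMap hA (gpt hA v 0) = gpt hA (src (minEdge v)) 0 := by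
  rw [gpt_eq_pt hA le_rfl (ht_pos hA.pos _ v).le]
  exact if_pos (mul_zero _)

theorem vertexMap_gpt_ht (hA : Admissible lam l) {k : ℕ} (v : x.V (k + 1)) :
    vertexMap hA (gpt hA v (ht l (k + 1) v)) =
      gpt hA (src (maxEdge v)) (ht l k (src (maxEdge v))) := by
  rw [gpt_eq_pt hA (ht_pos hA.pos _ v).le le_rfl]
  exact if_neg (hA.len_pos _ _).ne'

theorem isMinEdge_of_off_eq_zero (hA : Admissible lam l) {k : ℕ} {e : x.Edge k}
    (h : off l e = 0) : IsMinEdge e := fun f hf => by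
  have h1 := off_add_le_of_edgeLt hA.nonneg hf
  have h2 := off_nonneg hA.nonneg f
  have h3 := ht_pos hA.pos k (src f)
  linarith

theorem isMaxEdge_of_off_add_eq (hA : Admissible lam l) {k : ℕ} {e : x.Edge k}
    (h : off l e + ht l k (src e) = ht l (k + 1) (ran e)) : IsMaxEdge e := fun f hf => by
  have h1 := off_add_le_of_edgeLt hA.nonneg hf
  have h2 := off_add_le hA.nonneg f
  have h3 := ht_pos hA.pos k (src f)
  have h4 : ran f = ran e := hf.1.symm
  rw [h4] at h2
  linarith

theorem vertexMap_eq_of_wraps (hA : Admissible lam l) {k : ℕ} {e : x.Edge k} {τ : ℝ}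
    (h₀ : 0 ≤ τ) (h₁ : τ ≤ ht l k (src e))
    (h : off l e + τ = 0 ∨ off l e + τ = ht l (k + 1) (ran e)) :
    vertexMap hA (gpt hA (ran e) (off l e + τ)) = gpt hA (src e) τ := by
  have h2 := off_nonneg hA.nonneg e
  have h3 := off_add_le hA.nonneg e
  rcases h with h | h
  · have hτ : τ = 0 := by linarith
    have he := isMinEdge_of_off_eq_zero hA (e := e) (by linarith)
    rw [h, hτ, vertexMap_gpt_zero, ← he.eq_minEdge]
  · have hτ : τ = ht l k (src e) := by linarith
    have he := isMaxEdge_of_off_add_eq hA (e := e) (by linarith)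
    rw [h, hτ, vertexMap_gpt_ht, ← he.eq_maxEdge]

/-- Two edges can share a height only at the seam between consecutive ones, because an edge in
between would contribute a positive height; the two points at the seam are glued. -/
theorem gpt_eq_of_edgeLt (hA : Admissible lam l) {k : ℕ} {e f : x.Edge k} {τ σ : ℝ}
    (h : EdgeLt e f) (hτ : τ ≤ ht l k (src e)) (hσ : 0 ≤ σ) (heq : off l e + τ = off l f + σ) :
    gpt hA (src e) τ = gpt hA (src f) σ := by
  have h1 := off_add_le_of_edgeLt hA.nonneg h
  obtain rfl : σ = 0 := by linarith
  obtain rfl : τ = ht l k (src e) := by linarith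
  obtain ⟨g, hg1, hg2⟩ := exists_next (e := e) fun hm => hm f h
  have hgf : g = f := by
    refine Edge.ext_val (hg1.trans h.1) ?_
    by_contra hne
    have h2 := off_add_le_of_edgeLt hA.nonneg (e := g) (f := f)
      ⟨hg1.trans h.1, by have := h.2; omega⟩
    rw [off_next l hg1 hg2] at h2
    linarith [ht_pos hA.pos k (src g)]
  subst hgf
  exact gpt_glue hA (adjacent_of_next hg1 hg2)

/-- An interior point determines its height and hence the image, up to a seam between glued edges.
For a vertex with several representatives, both images are values of `vertexMap`, which is well
defined on the quotient. -/
theorem Wraps.unique (hA : Admissible lam l) {k : ℕ} {z : x.Graph lam l (k + 1)}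
    {y y' : x.Graph lam l k} (h : Wraps z y) (h' : Wraps z y') : y = y' := by
  obtain ⟨e, τ, h₀, h₁, rfl, rfl⟩ := (wraps_iff hA).1 h
  obtain ⟨f, σ, h₂, h₃, hz, rfl⟩ := (wraps_iff hA).1 h'
  have he0 := off_nonneg hA.nonneg e
  have he1 := off_add_le hA.nonneg e
  have hf0 := off_nonneg hA.nonneg f
  have hf1 := off_add_le hA.nonneg f
  by_cases hinner : 0 < off l e + τ ∧ off l e + τ < ht l (k + 1) (ran e)
  · obtain ⟨hr, heq⟩ := gpt_inj hA hinner.1 hinner.2 (by linarith) (by linarith) hz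
    by_cases hef : e = f
    · subst hef
      rw [show τ = σ by linarith]
    · rcases edgeLt_or_edgeLt hr hef with hlt | hlt
      · exact gpt_eq_of_edgeLt hA hlt h₁ h₂ heq
      · exact (gpt_eq_of_edgeLt hA hlt h₃ h₀ heq.symm).symm
  · have hinner' : ¬ (0 < off l f + σ ∧ off l f + σ < ht l (k + 1) (ran f)) := fun hc => by
      obtain ⟨hr, heq⟩ := gpt_inj hA hc.1 hc.2 (by linarith) (by linarith) hz.symm
      rw [heq, hr] at hc
      exact hinner hc
    have key : ∀ (e : x.Edge k) (τ : ℝ), 0 ≤ off l e + τ → off l e + τ ≤ ht l (k + 1) (ran e) →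
        ¬ (0 < off l e + τ ∧ off l e + τ < ht l (k + 1) (ran e)) →
        off l e + τ = 0 ∨ off l e + τ = ht l (k + 1) (ran e) := by
      intro e τ h0 h1 h2
      by_contra! hcon
      exact h2 ⟨lt_of_le_of_ne h0 hcon.1.symm, lt_of_le_of_ne h1 hcon.2⟩
    rw [← vertexMap_eq_of_wraps hA h₀ h₁ (key e τ (by linarith) (by linarith) hinner),
      ← vertexMap_eq_of_wraps hA h₂ h₃ (key f σ (by linarith) (by linarith) hinner'), hz]

theorem solenoid_eq_below (hA : Admissible lam l) {y z : x.Solenoid lam l} {k : ℕ}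
    (h : y.1 k = z.1 k) : ∀ i ≤ k, y.1 i = z.1 i := by
  intro i hi
  induction k, hi using Nat.le_induction with
  | base => exact h
  | succ k _ ih => exact ih ((y.2 k).unique hA (h ▸ z.2 k))

/-- A coordinate determines all lower ones. Points can thus be compared at levels so high that the
motion considered stays in one edge. -/
theorem solenoid_ext (hA : Admissible lam l) {y z : x.Solenoid lam l}
    (h : ∀ K, ∃ k, K ≤ k ∧ y.1 k = z.1 k) : y = z := by
  apply Subtype.ext
  funext i
  obtain ⟨k, hk, hyz⟩ := h i
  exact solenoid_eq_below hA hyz i hk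

end OrderedBratteli
namespace OrderedBratteli

variable {x : OrderedBratteli} {lam : ℝ} {l : x.V 0 → ℝ}

/-! ### The parametrization of the solenoid over one fundamental domain -/

theorem continuous_comp_coord {α : Type*} [TopologicalSpace α] (k : ℕ) (f : x.Edge k → α) :
    Continuous fun p : x.PathSpace => f (p.1 k) :=
  continuous_of_discreteTopology.comp (continuous_coord k)

theorem continuous_hgt (l : x.V 0 → ℝ) (k : ℕ) : Continuous fun p : x.PathSpace => hgt l p k := by
  induction k with
  | zero => exact continuous_const
  | succ k ih => exact (continuous_comp_coord k (off l)).add ih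

/-- The point of the solenoid at height `t`, truncated to `[0, l (s(p))]`, over the path `p`. -/
noncomputable def baseParam (hA : Admissible lam l) (y : x.PathSpace × ℝ) : x.Solenoid lam l :=
  ⟨fun k => gpt hA (src (y.1.1 k)) (hgt l y.1 k + max 0 (min y.2 (l (src (y.1.1 0))))), fun k => by
    have h0 : 0 ≤ max 0 (min y.2 (l (src (y.1.1 0)))) := le_max_left _ _
    have h1 : max 0 (min y.2 (l (src (y.1.1 0)))) ≤ l (src (y.1.1 0)) :=
      max_le (hA.nonneg _) (min_le_right _ _)
    have h2 := hgt_nonneg hA.nonneg y.1 k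
    have h3 := le_rest hA.nonneg y.1 k
    have h4 := hgt_add_rest l y.1 k
    beta_reduce
    rw [← y.1.2 k, hgt_succ, add_assoc]
    exact wraps_gpt hA (y.1.1 k) (by linarith) (by linarith)⟩

theorem baseParam_apply (hA : Admissible lam l) {p : x.PathSpace} {t : ℝ} (h₀ : 0 ≤ t)
    (h₁ : t ≤ l (src (p.1 0))) (k : ℕ) :
    (baseParam hA (p, t)).1 k = gpt hA (src (p.1 k)) (hgt l p k + t) := by
  simp only [baseParam]
  rw [min_eq_left h₁, max_eq_right h₀]

theorem continuous_baseParam (hA : Admissible lam l) :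
    Continuous (baseParam hA : x.PathSpace × ℝ → x.Solenoid lam l) := by
  refine continuous_induced_rng.2 (continuous_pi fun k => ?_)
  have h1 : Continuous fun a : x.V k × ℝ => gpt hA a.1 a.2 :=
    continuous_prod_of_discrete_left.2 fun v => continuous_gpt hA v
  have h2 : Continuous fun y : x.PathSpace × ℝ =>
      (src (y.1.1 k), hgt l y.1 k + max 0 (min y.2 (l (src (y.1.1 0))))) :=
    ((continuous_comp_coord k src).comp continuous_fst).prodMk
      (((continuous_hgt l k).comp continuous_fst).add (continuous_const.max
        (continuous_snd.min ((continuous_comp_coord 0 fun e => l (src e)).comp continuous_fst))))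
  exact h1.comp h2

/-- At each level, the top of a floor is either the bottom of the next floor of the same tower or
the end of an edge, which is glued to the beginning of the edge of the successor. -/
theorem baseParam_glue (hA : Admissible lam l) (hP : x.ProperlyOrdered) (p : x.PathSpace) :
    baseParam hA (p, l (src (p.1 0))) = baseParam hA (adic p, 0) := by
  apply Subtype.ext
  funext k
  rw [baseParam_apply hA (hA.nonneg _) le_rfl, baseParam_apply hA le_rfl (hA.nonneg _), add_zero]
  rcases hP.adic_hgt l p k with ⟨h1, h2⟩ | ⟨h1, h2, h3⟩
  · rw [h1, h2]
  · rw [h1, ← h2, hgt_add_rest, gpt_glue hA h3]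

/-- The closed region under the graph of the roof function. -/
def domain (l : x.V 0 → ℝ) : Set (x.PathSpace × ℝ) := {y | 0 ≤ y.2 ∧ y.2 ≤ l (src (y.1.1 0))}

theorem isCompact_domain (l : x.V 0 → ℝ) : IsCompact (domain l) := by
  obtain ⟨C, hC⟩ : ∃ C, ∀ v, l v ≤ C := by
    obtain ⟨C, hC⟩ := (Set.finite_range l).bddAbove
    exact ⟨C, fun v => hC ⟨v, rfl⟩⟩
  have hcl : IsClosed (domain l) :=
    (isClosed_le continuous_const continuous_snd).inter (isClosed_le continuous_snd
      ((continuous_comp_coord 0 fun e => l (src e)).comp continuous_fst))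
  exact (isCompact_univ.prod (isCompact_Icc (a := (0 : ℝ)) (b := C))).of_isClosed_subset hcl
    fun y hy => ⟨Set.mem_univ _, hy.1, hy.2.trans (hC _)⟩

theorem exists_baseParam_coord (hA : Admissible lam l) {k : ℕ} (y : x.Graph lam l k) :
    ∃ a ∈ domain l, (baseParam hA a).1 k = y := by
  obtain ⟨v, τ, h0, h1, rfl⟩ := exists_gpt hA y
  obtain ⟨p, rfl⟩ := exists_path_through k v
  rcases eq_or_lt_of_le h1 with rfl | h1
  · obtain ⟨q, hq, hq'⟩ := exists_max_below p k
    refine ⟨(q, l (src (q.1 0))), ⟨hA.nonneg _, le_rfl⟩, ?_⟩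
    have := rest_eq_of_max l (Nat.zero_le k) fun i _ hi => hq i hi
    rw [rest_zero] at this
    rw [baseParam_apply hA (hA.nonneg _) le_rfl, ← this, hgt_add_rest, hq' k le_rfl]
  · obtain ⟨q, t, hq, ht0, ht1, hqt⟩ := exists_hgt_eq k p h0 h1
    refine ⟨(q, t), ⟨ht0, ht1.le⟩, ?_⟩
    rw [baseParam_apply hA ht0 ht1.le, hqt, hq k le_rfl]

/-- For each `k` the parameters in the compact fundamental domain with the right `k`-th coordinate
form a non-empty closed set. These sets decrease since a coordinate determines the lower ones. -/
theorem exists_baseParam (hA : Admissible lam l) (z : x.Solenoid lam l) :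
    ∃ a ∈ domain l, baseParam hA a = z := by
  have := hA.t2Space_graph
  let C : ℕ → Set (x.PathSpace × ℝ) := fun k => domain l ∩ {a | (baseParam hA a).1 k = z.1 k}
  have hcl : ∀ k, IsClosed {a : x.PathSpace × ℝ | (baseParam hA a).1 k = z.1 k} := fun k =>
    isClosed_eq ((continuous_apply k).comp (continuous_subtype_val.comp (continuous_baseParam hA)))
      continuous_const
  obtain ⟨a, ha⟩ := IsCompact.nonempty_iInter_of_sequence_nonempty_isCompact_isClosed C
    (fun k a h => ⟨h.1, solenoid_eq_below hA h.2 k (Nat.le_succ k)⟩)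
    (fun k => by
      obtain ⟨a, ha, ha'⟩ := exists_baseParam_coord hA (z.1 k)
      exact ⟨a, ha, ha'⟩)
    ((isCompact_domain l).inter_right (hcl 0))
    (fun k => (isCompact_domain l).isClosed.inter (hcl k))
  simp only [Set.mem_iInter] at ha
  exact ⟨a, (ha 0).1, Subtype.ext (funext fun k => (ha k).2)⟩

theorem exists_baseParam_lt (hA : Admissible lam l) (hP : x.ProperlyOrdered)
    (z : x.Solenoid lam l) :
    ∃ p t, 0 ≤ t ∧ t < l (src (p.1 0)) ∧ baseParam hA (p, t) = z := by
  obtain ⟨⟨p, t⟩, ⟨h0, h1⟩, rfl⟩ := exists_baseParam hA z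
  rcases eq_or_lt_of_le h1 with h1 | h1
  · simp only at h1
    subst h1
    exact ⟨adic p, 0, le_rfl, hA.pos _, (baseParam_glue hA hP p).symm⟩
  · exact ⟨p, t, h0, h1, rfl⟩

/-- Different initial segments occupy disjoint half-open floors of a tower. -/
theorem eq_below_of_hgt_add_eq (hA : Admissible lam l) {p q : x.PathSpace} {t u : ℝ}
    (ht : t < l (src (p.1 0))) (ht₀ : 0 ≤ t) (hu : u < l (src (q.1 0))) (hu₀ : 0 ≤ u) {k : ℕ}
    (h₁ : src (p.1 k) = src (q.1 k)) (h₂ : hgt l p k + t = hgt l q k + u) :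
    ∀ i < k, p.1 i = q.1 i := by
  intro i hi
  by_contra hne
  obtain ⟨j, -, hj, hlt | hlt, hagree⟩ := exists_edgeLt_of_ne p q hi hne h₁
  · have h3 := hgt_add_rest_le_of_edgeLt hA.nonneg p q hj hlt hagree
    have h4 := le_rest hA.nonneg p j
    have h5 := hgt_nonneg hA.nonneg q j
    linarith
  · have h3 := hgt_add_rest_le_of_edgeLt hA.nonneg q p hj hlt fun i h h' => (hagree i h h').symm
    have h4 := le_rest hA.nonneg q j
    have h5 := hgt_nonneg hA.nonneg p j
    linarith

/-- From level `K` on the coordinates are interior: heights only grow, and `t` below the roof keeps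
the point away from the top. Interior points determine tower and height, hence the floor. -/
theorem baseParam_inj_of_pos (hA : Admissible lam l) {p q : x.PathSpace} {t u : ℝ}
    (ht₀ : 0 ≤ t) (ht : t < l (src (p.1 0))) (hu₀ : 0 ≤ u) (hu : u < l (src (q.1 0)))
    (h : baseParam hA (p, t) = baseParam hA (q, u)) {K : ℕ} (hK : 0 < hgt l p K + t) :
    (p, t) = (q, u) := by
  have key : ∀ k, K ≤ k → src (p.1 k) = src (q.1 k) ∧ hgt l p k + t = hgt l q k + u := by
    intro k hk
    have h1 : (baseParam hA (p, t)).1 k = (baseParam hA (q, u)).1 k := by rw [h]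
    rw [baseParam_apply hA ht₀ ht.le, baseParam_apply hA hu₀ hu.le] at h1
    have h2 : hgt l p K ≤ hgt l p k := hgt_mono hA.nonneg p hk
    have h3 := le_rest hA.nonneg p k
    have h4 := hgt_add_rest l p k
    have h5 := le_rest hA.nonneg q k
    have h6 := hgt_add_rest l q k
    have h7 := hgt_nonneg hA.nonneg q k
    exact gpt_inj hA (by linarith) (by linarith) (by linarith) (by linarith) h1
  have hall : ∀ i, p.1 i = q.1 i := fun i =>
    eq_below_of_hgt_add_eq hA ht ht₀ hu hu₀ (key (K + i + 1) (by omega)).1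
      (key (K + i + 1) (by omega)).2 i (by omega)
  obtain rfl : p = q := Subtype.ext (funext hall)
  have := (key K le_rfl).2
  rw [show t = u by linarith]

theorem isMinPath_of_hgt_eq_zero (hA : Admissible lam l) {p : x.PathSpace}
    (h : ∀ k, hgt l p k = 0) : IsMinPath p := fun k => by
  have := h (k + 1)
  rw [hgt_succ, h k, add_zero] at this
  exact isMinEdge_of_off_eq_zero hA this

/-- When no coordinate becomes interior, both heights vanish at every level; both points then are
the unique minimal path at height 0. -/
theorem baseParam_inj (hA : Admissible lam l) (hP : x.ProperlyOrdered) {p q : x.PathSpace}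
    {t u : ℝ} (ht₀ : 0 ≤ t) (ht : t < l (src (p.1 0))) (hu₀ : 0 ≤ u) (hu : u < l (src (q.1 0)))
    (h : baseParam hA (p, t) = baseParam hA (q, u)) : (p, t) = (q, u) := by
  by_cases h1 : ∃ K, 0 < hgt l p K + t
  · obtain ⟨K, hK⟩ := h1
    exact baseParam_inj_of_pos hA ht₀ ht hu₀ hu h hK
  by_cases h2 : ∃ K, 0 < hgt l q K + u
  · obtain ⟨K, hK⟩ := h2
    exact (baseParam_inj_of_pos hA hu₀ hu ht₀ ht h.symm hK).symm
  push Not at h1 h2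
  have hp : ∀ k, hgt l p k = 0 := fun k => by
    have := hgt_nonneg hA.nonneg p k
    linarith [h1 k]
  have hq : ∀ k, hgt l q k = 0 := fun k => by
    have := hgt_nonneg hA.nonneg q k
    linarith [h2 k]
  rw [hP.1.unique (isMinPath_of_hgt_eq_zero hA hp) (isMinPath_of_hgt_eq_zero hA hq)]
  have h3 := h1 0
  have h4 := h2 0
  simp only [hgt_zero, zero_add] at h3 h4
  rw [show t = u by linarith]

/-! ### The parametrization of the solenoid by `X_B × ℝ` -/

/-- The map whose orbits are the classes of the suspension. -/
noncomputable def fwd (l : x.V 0 → ℝ) (y : x.PathSpace × ℝ) : x.PathSpace × ℝ :=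
  (adic y.1, y.2 - l (src (y.1.1 0)))

/-- The inverse of `fwd`. -/
noncomputable def bwd (hP : x.ProperlyOrdered) (l : x.V 0 → ℝ) (y : x.PathSpace × ℝ) :
    x.PathSpace × ℝ :=
  (hP.adicHomeo.symm y.1, y.2 + l (src ((hP.adicHomeo.symm y.1).1 0)))

theorem ProperlyOrdered.adic_symm (hP : x.ProperlyOrdered) (p : x.PathSpace) :
    adic (hP.adicHomeo.symm p) = p := hP.adicHomeo.apply_symm_apply p

theorem ProperlyOrdered.symm_adic (hP : x.ProperlyOrdered) (p : x.PathSpace) :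
    hP.adicHomeo.symm (adic p) = p := hP.adicHomeo.symm_apply_apply p

theorem bwd_fwd (hP : x.ProperlyOrdered) (l : x.V 0 → ℝ) (y : x.PathSpace × ℝ) :
    bwd hP l (fwd l y) = y := by
  simp [bwd, fwd, hP.symm_adic]

theorem fwd_bwd (hP : x.ProperlyOrdered) (l : x.V 0 → ℝ) (y : x.PathSpace × ℝ) :
    fwd l (bwd hP l y) = y := by
  simp [bwd, fwd, hP.adic_symm]

theorem continuous_roof (l : x.V 0 → ℝ) :
    Continuous fun y : x.PathSpace × ℝ => l (src (y.1.1 0)) :=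
  (continuous_comp_coord 0 fun e => l (src e)).comp continuous_fst

theorem continuous_fwd (hP : x.ProperlyOrdered) (l : x.V 0 → ℝ) : Continuous (fwd l) :=
  (hP.continuous_adic.comp continuous_fst).prodMk (continuous_snd.sub (continuous_roof l))

theorem continuous_bwd (hP : x.ProperlyOrdered) (l : x.V 0 → ℝ) : Continuous (bwd hP l) := by
  have : Continuous fun y : x.PathSpace × ℝ => hP.adicHomeo.symm y.1 :=
    hP.adicHomeo.symm.continuous.comp continuous_fst
  exact this.prodMk (continuous_snd.add ((continuous_comp_coord 0 fun e => l (src e)).comp this))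

/-- The parametrization of the solenoid on the region that is reached from the fundamental domain
by at most `n` applications of `fwd` or `bwd`. -/
noncomputable def paramAux (hA : Admissible lam l) (hP : x.ProperlyOrdered) :
    ℕ → x.PathSpace × ℝ → x.Solenoid lam l
  | 0, y => baseParam hA y
  -- The pieces overlap at height 0 and at the roof, where `baseParam_glue` makes them agree.
  | n + 1, y => if y.2 ≤ 0 then paramAux hA hP n (bwd hP l y) else
      if y.2 ≤ l (src (y.1.1 0)) then baseParam hA y else paramAux hA hP n (fwd l y)

theorem paramAux_of_mem (hA : Admissible lam l) (hP : x.ProperlyOrdered) (n : ℕ)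
    {y : x.PathSpace × ℝ} (h₀ : 0 ≤ y.2) (h₁ : y.2 ≤ l (src (y.1.1 0))) :
    paramAux hA hP n y = baseParam hA y := by
  induction n generalizing y with
  | zero => rfl
  | succ n ih =>
    rw [paramAux]
    split_ifs with h2
    · have h3 : y.2 = 0 := le_antisymm h2 h₀
      have h4 : bwd hP l y = (hP.adicHomeo.symm y.1, l (src ((hP.adicHomeo.symm y.1).1 0))) := by
        rw [bwd, h3, zero_add]
      rw [h4, ih (hA.nonneg _) le_rfl, baseParam_glue hA hP, hP.adic_symm, ← h3]
    · rfl

theorem continuous_paramAux (hA : Admissible lam l) (hP : x.ProperlyOrdered) (n : ℕ) :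
    Continuous (paramAux hA hP n) := by
  induction n with
  | zero => exact continuous_baseParam hA
  | succ n ih =>
    simp only [paramAux]
    refine Continuous.if_le (ih.comp (continuous_bwd hP l)) (Continuous.if_le
      (continuous_baseParam hA) (ih.comp (continuous_fwd hP l)) continuous_snd
      (continuous_roof l) ?_) continuous_snd continuous_const ?_
    · rintro ⟨p, t⟩ h
      simp only at h
      subst h
      have h1 : fwd l (p, l (src (p.1 0))) = (adic p, 0) := by simp [fwd]
      rw [h1, paramAux_of_mem hA hP n le_rfl (hA.nonneg _), baseParam_glue hA hP]
    · rintro y h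
      have := paramAux_of_mem hA hP (n + 1) (y := y) h.ge (by rw [h]; exact hA.nonneg _)
      rw [if_pos (by rw [h]; exact hA.nonneg _), ← this, paramAux, if_pos h.le]

/-- A positive lower bound of the roof function. -/
noncomputable def Admissible.minLen (hA : Admissible lam l) : ℝ := (exists_pos_le hA.pos).choose

theorem Admissible.minLen_pos (hA : Admissible lam l) : 0 < hA.minLen :=
  (exists_pos_le hA.pos).choose_spec.1

theorem Admissible.minLen_le (hA : Admissible lam l) (v : x.V 0) : hA.minLen ≤ l v :=
  (exists_pos_le hA.pos).choose_spec.2 v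

/-- Each use of `fwd` or `bwd` moves the height towards the fundamental domain by at least `minLen`,
so in this range `n` uses suffice and a larger budget changes nothing. -/
theorem paramAux_succ (hA : Admissible lam l) (hP : x.ProperlyOrdered) (n : ℕ)
    {y : x.PathSpace × ℝ} (h₀ : -(n * hA.minLen) ≤ y.2)
    (h₁ : y.2 ≤ l (src (y.1.1 0)) + n * hA.minLen) :
    paramAux hA hP (n + 1) y = paramAux hA hP n y := by
  induction n generalizing y with
  | zero =>
    simp only [Nat.cast_zero, zero_mul, neg_zero, add_zero] at h₀ h₁
    rw [paramAux_of_mem hA hP _ h₀ h₁, paramAux_of_mem hA hP _ h₀ h₁]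
  | succ n ih =>
    rw [paramAux]
    conv_rhs => rw [paramAux]
    push_cast at h₀ h₁
    have hc := hA.minLen_pos
    have hnc : 0 ≤ (n : ℝ) * hA.minLen := by positivity
    split_ifs with h2 h3
    · have := hA.minLen_le (src ((hP.adicHomeo.symm y.1).1 0))
      apply ih <;> simp only [bwd] <;> linarith
    · rfl
    · have := hA.minLen_le (src ((adic y.1).1 0))
      apply ih <;> simp only [fwd] <;> linarith

/-- The parametrization of the solenoid by `X_B × ℝ`. -/
noncomputable def param (hA : Admissible lam l) (hP : x.ProperlyOrdered) (y : x.PathSpace × ℝ) :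
    x.Solenoid lam l :=
  paramAux hA hP ⌈|y.2| / hA.minLen⌉₊ y

theorem param_eq_paramAux (hA : Admissible lam l) (hP : x.ProperlyOrdered) {n : ℕ}
    {y : x.PathSpace × ℝ} (h : |y.2| ≤ n * hA.minLen) : param hA hP y = paramAux hA hP n y := by
  have hc := hA.minLen_pos
  have hle : ⌈|y.2| / hA.minLen⌉₊ ≤ n := Nat.ceil_le.2 ((div_le_iff₀ hc).2 h)
  have h0 : |y.2| ≤ (⌈|y.2| / hA.minLen⌉₊ : ℕ) * hA.minLen :=
    (div_le_iff₀ hc).1 (Nat.le_ceil _)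
  rw [param]
  generalize ⌈|y.2| / hA.minLen⌉₊ = m at hle h0
  induction n, hle using Nat.le_induction with
  | base => rfl
  | succ n hmn ih =>
    have h1 : |y.2| ≤ n * hA.minLen := h0.trans
      (mul_le_mul_of_nonneg_right (by exact_mod_cast hmn) hc.le)
    rw [ih h1, paramAux_succ hA hP n]
    · linarith [neg_abs_le y.2]
    · linarith [le_abs_self y.2, hA.nonneg (src (y.1.1 0))]

theorem exists_nat_abs_le (hA : Admissible lam l) (t : ℝ) : ∃ n : ℕ, |t| < n * hA.minLen := by
  obtain ⟨n, hn⟩ := exists_nat_gt (|t| / hA.minLen)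
  exact ⟨n, (div_lt_iff₀ hA.minLen_pos).1 hn⟩

theorem continuous_param (hA : Admissible lam l) (hP : x.ProperlyOrdered) :
    Continuous (param hA hP) := by
  refine continuous_iff_continuousAt.2 fun y => ?_
  obtain ⟨n, hn⟩ := exists_nat_abs_le hA y.2
  refine (continuous_paramAux hA hP n).continuousAt.congr ?_
  have : ∀ᶠ y' : x.PathSpace × ℝ in 𝓝 y, |y'.2| < n * hA.minLen :=
    (continuous_snd.abs.continuousAt (x := y)).eventually_lt continuousAt_const hn
  filter_upwards [this] with y' hy'
  exact (param_eq_paramAux hA hP hy'.le).symm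

theorem param_of_mem (hA : Admissible lam l) (hP : x.ProperlyOrdered) {p : x.PathSpace} {t : ℝ}
    (h₀ : 0 ≤ t) (h₁ : t ≤ l (src (p.1 0))) : param hA hP (p, t) = baseParam hA (p, t) :=
  paramAux_of_mem hA hP _ h₀ h₁

theorem param_fwd (hA : Admissible lam l) (hP : x.ProperlyOrdered) (y : x.PathSpace × ℝ) :
    param hA hP (fwd l y) = param hA hP y := by
  obtain ⟨n, hn⟩ := exists_nat_abs_le hA y.2
  obtain ⟨m, hm⟩ := exists_nat_abs_le hA (fwd l y).2
  have hc := hA.minLen_pos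
  have h1 : |y.2| ≤ ((n + m : ℕ) : ℝ) * hA.minLen := by push_cast; nlinarith [abs_nonneg y.2]
  have h2 : |y.2| ≤ ((n + m + 1 : ℕ) : ℝ) * hA.minLen := by
    push_cast at h1 ⊢; linarith
  have h3 : |(fwd l y).2| ≤ ((n + m : ℕ) : ℝ) * hA.minLen := by
    push_cast; nlinarith [abs_nonneg (fwd l y).2]
  have h4 : |(fwd l y).2| ≤ ((n + m + 1 : ℕ) : ℝ) * hA.minLen := by
    push_cast at h3 ⊢; linarith
  -- With budgets one apart, unfolding a single step suffices: below the roof `fwd l y` is sent back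
  -- to `y`, above it `y` is sent to `fwd l y`.
  by_cases h : y.2 ≤ l (src (y.1.1 0))
  · rw [param_eq_paramAux hA hP h4, param_eq_paramAux hA hP h1, paramAux,
      if_pos (by simp only [fwd]; linarith), bwd_fwd]
  · have h0 : ¬ y.2 ≤ 0 := fun h0 => h (h0.trans (hA.nonneg _))
    rw [param_eq_paramAux hA hP h3, param_eq_paramAux hA hP h2, paramAux, if_neg h0, if_neg h]

theorem param_adic (hA : Admissible lam l) (hP : x.ProperlyOrdered) (p : x.PathSpace) (t : ℝ) :
    param hA hP (adic p, t) = param hA hP (p, t + l (src (p.1 0))) := by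
  rw [← param_fwd hA hP (p, t + l (src (p.1 0)))]
  simp [fwd]

/-- While the height stays within the tower of `p` at level `k`, the `k`-th coordinate moves along
one edge, although the path below level `k` changes. The induction is on the number of floors that
may be crossed. -/
theorem param_apply (hA : Admissible lam l) (hP : x.ProperlyOrdered) {p : x.PathSpace} {t : ℝ}
    {k : ℕ} (h₀ : 0 ≤ hgt l p k + t) (h₁ : hgt l p k + t ≤ ht l k (src (p.1 k))) :
    (param hA hP (p, t)).1 k = gpt hA (src (p.1 k)) (hgt l p k + t) := by
  obtain ⟨n, hn⟩ := exists_nat_abs_le hA t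
  replace hn := hn.le
  have hc := hA.minLen_pos
  induction n generalizing p t with
  | zero =>
    have h : t = 0 := by simpa using hn
    rw [param_of_mem hA hP h.ge (by rw [h]; exact hA.nonneg _),
      baseParam_apply hA h.ge (by rw [h]; exact hA.nonneg _)]
  | succ n ih =>
    push_cast at hn
    rw [abs_le] at hn
    by_cases h2 : t < 0
    · obtain ⟨q, rfl⟩ := hP.adic_surjective p
      have hq := hA.minLen_le (src (q.1 0))
      rcases hP.adic_hgt l q k with ⟨h3, h4⟩ | ⟨h3, h4, h5⟩
      · rw [param_adic]
        rw [h3] at h₀ h₁ ⊢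
        rw [h4] at h₁ ⊢
        rw [add_right_comm, add_assoc] at h₀ h₁ ⊢
        by_cases h5 : 0 ≤ t + l (src (q.1 0))
        · rw [param_of_mem hA hP h5 (by linarith), baseParam_apply hA h5 (by linarith)]
        · push Not at h5
          exact ih h₀ h₁ (by rw [abs_of_neg h5]; linarith)
      · rw [h3] at h₀
        linarith
    · push Not at h2
      by_cases h3 : t ≤ l (src (p.1 0))
      · rw [param_of_mem hA hP h2 h3, baseParam_apply hA h2 h3]
      · push Not at h3
        have hp := hA.minLen_le (src (p.1 0))
        rcases hP.adic_hgt l p k with ⟨h4, h5⟩ | ⟨h4, h5, h6⟩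
        · have h7 := param_adic hA hP p (t - l (src (p.1 0)))
          rw [sub_add_cancel] at h7
          have h8 : hgt l p k + t = hgt l (adic p) k + (t - l (src (p.1 0))) := by
            rw [h4]
            ring
          rw [h8, ← h5] at h₁
          rw [h8] at h₀
          rw [← h7, h8, ← h5]
          exact ih h₀ h₁ (by rw [abs_of_nonneg (by linarith)]; linarith)
        · have := hgt_add_rest l p k
          linarith

/-! ### The conjugacy with the special flow -/

theorem suspension_mk_fwd (l : x.V 0 → ℝ) (y : x.PathSpace × ℝ) :
    (Quot.mk _ (fwd l y) : x.Suspension l) = Quot.mk _ y :=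
  (Quot.sound ⟨rfl, by simp [fwd]⟩).symm

theorem exists_suspension_rep (hA : Admissible lam l) (hP : x.ProperlyOrdered)
    (y : x.Suspension l) :
    ∃ p t, 0 ≤ t ∧ t < l (src (p.1 0)) ∧ y = Quot.mk _ (p, t) := by
  induction y using Quot.ind with
  | mk a =>
    obtain ⟨n, hn⟩ := exists_nat_abs_le hA a.2
    replace hn := hn.le
    have hc := hA.minLen_pos
    induction n generalizing a with
    | zero =>
      have h : a.2 = 0 := by simpa using hn
      exact ⟨a.1, 0, le_rfl, hA.pos _, by rw [← h]⟩
    | succ n ih =>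
      push_cast at hn
      rw [abs_le] at hn
      by_cases h2 : a.2 < 0
      · have hq := hA.minLen_le (src ((hP.adicHomeo.symm a.1).1 0))
        have h1 := suspension_mk_fwd l (bwd hP l a)
        rw [fwd_bwd] at h1
        by_cases h5 : 0 ≤ (bwd hP l a).2
        · exact ⟨_, _, h5, by simp only [bwd]; linarith, h1⟩
        · push Not at h5
          rw [h1]
          refine ih _ ?_
          rw [abs_of_neg h5]
          simp only [bwd]
          linarith
      · push Not at h2
        by_cases h3 : a.2 < l (src (a.1.1 0))
        · exact ⟨_, _, h2, h3, rfl⟩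
        · push Not at h3
          have hp := hA.minLen_le (src (a.1.1 0))
          rw [← suspension_mk_fwd]
          refine ih _ ?_
          simp only [fwd]
          rw [abs_of_nonneg (by linarith)]
          linarith

/-- The map from the suspension to the solenoid. -/
noncomputable def suspensionMap (hA : Admissible lam l) (hP : x.ProperlyOrdered) :
    x.Suspension l → x.Solenoid lam l :=
  Quot.lift (param hA hP) (by
    rintro ⟨p, t⟩ ⟨q, u⟩ ⟨h1, h2⟩
    simp only at h1 h2
    subst h1 h2
    exact (param_adic hA hP p u).symm)

theorem suspensionMap_bijective (hA : Admissible lam l) (hP : x.ProperlyOrdered) :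
    Function.Bijective (suspensionMap hA hP) := by
  constructor
  · intro y z h
    obtain ⟨p, t, ht0, ht, rfl⟩ := exists_suspension_rep hA hP y
    obtain ⟨q, u, hu0, hu, rfl⟩ := exists_suspension_rep hA hP z
    replace h : param hA hP (p, t) = param hA hP (q, u) := h
    rw [param_of_mem hA hP ht0 ht.le, param_of_mem hA hP hu0 hu.le] at h
    rw [baseParam_inj hA hP ht0 ht hu0 hu h]
  · intro z
    obtain ⟨p, t, ht0, ht, rfl⟩ := exists_baseParam_lt hA hP z
    exact ⟨Quot.mk _ (p, t), param_of_mem hA hP ht0 ht.le⟩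

theorem compactSpace_suspension (hA : Admissible lam l) (hP : x.ProperlyOrdered) :
    CompactSpace (x.Suspension l) := by
  have h := (isCompact_domain l).image
    (continuous_quot_mk : Continuous (Quot.mk _ : x.PathSpace × ℝ → x.Suspension l))
  refine ⟨?_⟩
  convert h
  refine (Set.eq_univ_of_forall fun y => ?_).symm
  obtain ⟨p, t, ht0, ht, rfl⟩ := exists_suspension_rep hA hP y
  exact ⟨(p, t), ⟨ht0, ht.le⟩, rfl⟩

/-- The homeomorphism from the suspension to the solenoid. -/
noncomputable def suspensionHomeo (hA : Admissible lam l) (hP : x.ProperlyOrdered) :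
    x.Suspension l ≃ₜ x.Solenoid lam l :=
  haveI := compactSpace_suspension hA hP
  haveI := hA.t2Space_solenoid
  Continuous.homeoOfEquivCompactToT2
    (f := Equiv.ofBijective (suspensionMap hA hP) (suspensionMap_bijective hA hP))
    (continuous_quot_lift _ (continuous_param hA hP))

theorem suspensionHomeo_mk (hA : Admissible lam l) (hP : x.ProperlyOrdered)
    (y : x.PathSpace × ℝ) : suspensionHomeo hA hP (Quot.mk _ y) = param hA hP y := rfl

theorem suspensionHomeo_base (hA : Admissible lam l) (hP : x.ProperlyOrdered) (p : x.PathSpace) :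
    suspensionHomeo hA hP (base l p) = baseParam hA (p, 0) :=
  param_of_mem hA hP le_rfl (hA.nonneg _)

theorem exists_param (hA : Admissible lam l) (hP : x.ProperlyOrdered) (z : x.Solenoid lam l) :
    ∃ p t, 0 ≤ t ∧ t < l (src (p.1 0)) ∧ z = param hA hP (p, t) := by
  obtain ⟨p, t, ht0, ht, rfl⟩ := exists_baseParam_lt hA hP z
  exact ⟨p, t, ht0, ht, (param_of_mem hA hP ht0 ht.le).symm⟩

/-- The special flow, transported to the solenoid. -/
noncomputable def solenoidMap (hA : Admissible lam l) (hP : x.ProperlyOrdered) (t : ℝ)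
    (z : x.Solenoid lam l) : x.Solenoid lam l :=
  suspensionHomeo hA hP (specialFlow t ((suspensionHomeo hA hP).symm z))

theorem solenoidMap_param (hA : Admissible lam l) (hP : x.ProperlyOrdered) (t : ℝ)
    (p : x.PathSpace) (u : ℝ) :
    solenoidMap hA hP t (param hA hP (p, u)) = param hA hP (p, u + t) := by
  rw [solenoidMap, ← suspensionHomeo_mk, Homeomorph.symm_apply_apply]
  rfl

theorem continuous_solenoidMap (hA : Admissible lam l) (hP : x.ProperlyOrdered) :
    Continuous (Function.uncurry (solenoidMap hA hP)) := by
  have := hA.t2Space_solenoid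
  have : CompactSpace (domain l) := isCompact_iff_compactSpace.1 (isCompact_domain l)
  let g : domain l → x.Solenoid lam l := fun a => baseParam hA a.1
  have hg : Continuous g := (continuous_baseParam hA).comp continuous_subtype_val
  have hgs : Function.Surjective g := fun z => by
    obtain ⟨a, ha, haz⟩ := exists_baseParam hA z
    exact ⟨⟨a, ha⟩, haz⟩
  -- A product with the identity of `ℝ` need not preserve quotient maps; here `g` is proper, as a
  -- map from a compact to a Hausdorff space, so the product is closed. Joint continuity can then be
  -- tested on the fundamental domain.
  have hq : IsQuotientMap (Prod.map (id : ℝ → ℝ) g) :=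
    (isProperMap_id.prodMap hg.isProperMap).isClosedMap.isQuotientMap
      (continuous_id.prodMap hg) (Function.surjective_id.prodMap hgs)
  rw [hq.continuous_iff]
  have hc : Continuous fun a : ℝ × domain l => param hA hP (a.2.1.1, a.2.1.2 + a.1) :=
    (continuous_param hA hP).comp (by fun_prop)
  refine hc.congr ?_
  rintro ⟨t, ⟨⟨p, u⟩, hu⟩⟩
  simp only [Function.comp, Prod.map, id, Function.uncurry, g]
  rw [← param_of_mem hA hP hu.1 hu.2, solenoidMap_param]

/-- The natural flow on the solenoid. -/
noncomputable def naturalFlow (hA : Admissible lam l) (hP : x.ProperlyOrdered) :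
    Flow ℝ (x.Solenoid lam l) where
  toFun := solenoidMap hA hP
  cont' := continuous_solenoidMap hA hP
  map_add' t₁ t₂ z := by
    obtain ⟨p, u, -, -, rfl⟩ := exists_param hA hP z
    rw [solenoidMap_param, solenoidMap_param, solenoidMap_param, add_comm t₁, add_assoc]
  map_zero' z := by
    obtain ⟨p, u, -, -, rfl⟩ := exists_param hA hP z
    rw [solenoidMap_param, add_zero]

theorem naturalFlow_param (hA : Admissible lam l) (hP : x.ProperlyOrdered) (t : ℝ)
    (p : x.PathSpace) (u : ℝ) :
    naturalFlow hA hP t (param hA hP (p, u)) = param hA hP (p, u + t) :=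
  solenoidMap_param hA hP t p u

theorem suspensionHomeo_specialFlow (hA : Admissible lam l) (hP : x.ProperlyOrdered) (t : ℝ)
    (y : x.Suspension l) :
    suspensionHomeo hA hP (specialFlow t y) = naturalFlow hA hP t (suspensionHomeo hA hP y) := by
  change _ = solenoidMap hA hP t (suspensionHomeo hA hP y)
  rw [solenoidMap, Homeomorph.symm_apply_apply]

theorem range_suspensionHomeo_base (hA : Admissible lam l) (hP : x.ProperlyOrdered) :
    Set.range (fun p : x.PathSpace => suspensionHomeo hA hP (base l p)) = x.mho lam l := by
  ext z
  constructor
  · rintro ⟨p, rfl⟩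
    change IsVertex ((suspensionHomeo hA hP (base l p)).1 0)
    rw [suspensionHomeo_base, baseParam_apply hA le_rfl (hA.nonneg _), hgt_zero, add_zero]
    exact isVertex_gpt_zero hA _
  · intro hz
    obtain ⟨p, t, ht0, ht, rfl⟩ := exists_baseParam_lt hA hP z
    change IsVertex ((baseParam hA (p, t)).1 0) at hz
    rw [baseParam_apply hA ht0 ht.le, hgt_zero, zero_add] at hz
    rcases hz.eq_zero_or_eq_ht hA ht0 (by rw [ht_zero]; exact ht.le) with h | h
    · exact ⟨p, by rw [h]; exact suspensionHomeo_base hA hP p⟩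
    · rw [ht_zero] at h
      exact absurd h ht.ne

end OrderedBratteli
namespace OrderedBratteli

variable {x : OrderedBratteli} {lam : ℝ} {l : x.V 0 → ℝ}

/-! ### Existence and uniqueness of the natural flow -/

theorem param_apply_of_mem (hA : Admissible lam l) (hP : x.ProperlyOrdered) {p : x.PathSpace}
    {t : ℝ} (h₀ : 0 ≤ t) (h₁ : t ≤ l (src (p.1 0))) (k : ℕ) :
    (param hA hP (p, t)).1 k = gpt hA (src (p.1 k)) (hgt l p k + t) := by
  rw [param_of_mem hA hP h₀ h₁, baseParam_apply hA h₀ h₁]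

/-- Staying below the roof excludes the upper end of an edge, so every coordinate is a beginning and
all heights vanish. -/
theorem eq_param_of_isVertex (hA : Admissible lam l) (hP : x.ProperlyOrdered)
    {z : x.Solenoid lam l} (hz : ∀ k, IsVertex (z.1 k)) {m : x.PathSpace} (hm : IsMinPath m) :
    z = param hA hP (m, 0) := by
  obtain ⟨p, t, ht0, ht, rfl⟩ := exists_param hA hP z
  have h0 : ∀ k, hgt l p k + t = 0 := by
    intro k
    have h1 := hz k
    have h2 := hgt_nonneg hA.nonneg p k
    have h3 := le_rest hA.nonneg p k
    have h4 := hgt_add_rest l p k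
    rw [param_apply_of_mem hA hP ht0 ht.le] at h1
    rcases h1.eq_zero_or_eq_ht hA (by linarith) (by linarith) with h | h
    · exact h
    · linarith
  have h1 : t = 0 := by simpa using h0 0
  subst h1
  have hp : IsMinPath p := isMinPath_of_hgt_eq_zero hA fun k => by simpa using h0 k
  rw [hP.1.unique hp hm]

theorem isNaturalFlow_naturalFlow (hA : Admissible lam l) (hP : x.ProperlyOrdered) :
    IsNaturalFlow (naturalFlow hA hP) where
  translate z k v s s' t hz hs0 hs1 hs0' hs1' hss' := by
    obtain ⟨p, u, hu0, hu, rfl⟩ := exists_param hA hP z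
    obtain ⟨σ, hσ⟩ := exists_scale hA k s
    have hσ0 : 0 < σ := by
      rw [hσ] at hs0
      exact pos_of_mul_pos_right hs0 (hA.scale_pos k).le
    have hσ1 : σ < ht l k v := by
      rw [hσ, len_eq] at hs1
      exact lt_of_mul_lt_mul_left hs1 (hA.scale_pos k).le
    have h1 := hgt_nonneg hA.nonneg p k
    have h2 := le_rest hA.nonneg p k
    have h3 := hgt_add_rest l p k
    rw [param_apply_of_mem hA hP hu0 hu.le, pt_eq_gpt hA s hσ] at hz
    obtain ⟨rfl, rfl⟩ := gpt_inj hA hσ0 hσ1 (by linarith) (by linarith) hz.symm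
    have hs' : (s' : ℝ) = (lam⁻¹) ^ k * (hgt l p k + (u + t)) := by
      rw [hss', hσ]
      ring
    have h4 := mem_of_scale hA s' hs'
    rw [naturalFlow_param, param_apply hA hP h4.1 h4.2, pt_eq_gpt hA s' hs']
  forward z hz p hp t ht0 ht k := by
    have h0 : hgt l p k = 0 := hgt_eq_of_min l (Nat.zero_le k) fun i _ _ => hp i
    have h2 := le_rest hA.nonneg p k
    rw [rest, h0] at h2
    refine ⟨⟨_, scale_mem hA ht0.le (by linarith)⟩, rfl, ?_⟩
    rw [eq_param_of_isVertex hA hP hz hp, naturalFlow_param, zero_add,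
      param_apply_of_mem hA hP ht0.le ht.le, h0, zero_add, gpt_eq_pt hA ht0.le (by linarith)]
  backward z hz p hp t ht0 ht1 k := by
    have h0 : rest l p k = l (src (p.1 0)) := by
      rw [rest_eq_of_max l (Nat.zero_le k) fun i _ _ => hp i, rest_zero]
    have h1 := hgt_add_rest l p k
    have h2 := hgt_nonneg hA.nonneg p k
    have h3 : 0 ≤ ht l k (src (p.1 k)) - t := by linarith
    have h4 : ht l k (src (p.1 k)) - t ≤ ht l k (src (p.1 k)) := by linarith
    refine ⟨⟨_, scale_mem hA h3 h4⟩, by simp only [len_eq]; ring, ?_⟩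
    -- The vertex point is the minimal path at height 0, which is also the maximal path at roof
    -- height; the backward motion descends from there.
    rw [eq_param_of_isVertex hA hP hz (hP.isMinPath_adic hp), naturalFlow_param, param_adic,
      param_apply_of_mem hA hP (by linarith) (by linarith), ← gpt_eq_pt hA h3 h4]
    congr 1
    linarith

/-- If start and target are interior to one edge at level `K`, they are so at all higher levels, by
monotonicity of `hgt` and `rest`. The clause on interior points then fixes all high coordinates. -/
theorem IsNaturalFlow.apply_param (hA : Admissible lam l) (hP : x.ProperlyOrdered)
    {Ψ : Flow ℝ (x.Solenoid lam l)} (hΨ : IsNaturalFlow Ψ) {q : x.PathSpace} {w t : ℝ} {K : ℕ}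
    (h₀ : 0 < hgt l q K + w) (h₁ : 0 < hgt l q K + (w + t)) (h₂ : w < rest l q K)
    (h₃ : w + t < rest l q K) : Ψ t (param hA hP (q, w)) = param hA hP (q, w + t) := by
  refine solenoid_ext hA fun N => ⟨N + K, by omega, ?_⟩
  have hK : K ≤ N + K := by omega
  generalize N + K = k at hK
  have h4 : hgt l q K ≤ hgt l q k := hgt_mono hA.nonneg q hK
  have h5 : rest l q K ≤ rest l q k := rest_mono hA.nonneg q hK
  have h6 := hgt_add_rest l q k
  have h7 : (0 : ℝ) ≤ hgt l q k + w := by linarith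
  have h8 : hgt l q k + w ≤ ht l k (src (q.1 k)) := by linarith
  have h9 : (0 : ℝ) ≤ hgt l q k + (w + t) := by linarith
  have h10 : hgt l q k + (w + t) ≤ ht l k (src (q.1 k)) := by linarith
  have hc := hA.scale_pos k
  rw [param_apply hA hP h9 h10, gpt_eq_pt hA h9 h10]
  refine hΨ.translate _ k _ ⟨_, scale_mem hA h7 h8⟩ _ t ?_ ?_ ?_ ?_ ?_ ?_
  · rw [param_apply hA hP h7 h8, gpt_eq_pt hA h7 h8]
  · exact mul_pos hc (by linarith)
  · exact mul_lt_mul_of_pos_left (b := hgt l q k + w) (c := ht l k (src (q.1 k))) (by linarith) hc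
  · exact mul_pos hc (by linarith)
  · exact mul_lt_mul_of_pos_left (b := hgt l q k + (w + t)) (c := ht l k (src (q.1 k))) (by linarith) hc
  · simp only
    ring

theorem isVertex_param_of_isMinPath (hA : Admissible lam l) (hP : x.ProperlyOrdered)
    {m : x.PathSpace} (hm : IsMinPath m) (k : ℕ) : IsVertex ((param hA hP (m, 0)).1 k) := by
  rw [param_apply_of_mem hA hP le_rfl (hA.nonneg _),
    hgt_eq_of_min l (Nat.zero_le k) fun i _ _ => hm i, hgt_zero, add_zero]
  exact isVertex_gpt_zero hA _

theorem IsNaturalFlow.apply_param_min_of_pos (hA : Admissible lam l) (hP : x.ProperlyOrdered)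
    (hS : x.StronglyMinimal) {Ψ : Flow ℝ (x.Solenoid lam l)} (hΨ : IsNaturalFlow Ψ)
    {m : x.PathSpace} (hm : IsMinPath m) {t : ℝ} (ht : 0 < t) :
    Ψ t (param hA hP (m, 0)) = param hA hP (m, t) := by
  have hl := hA.pos (src (m.1 0))
  have hm0 : ∀ k, hgt l m k = 0 := fun k => hgt_eq_of_min l (Nat.zero_le k) fun i _ _ => hm i
  -- The clause at vertices only covers times below the roof. After a short time `t₀` the point is
  -- interior, and the remaining time fits into the edge of a level at which all heights exceed `t`.
  obtain ⟨t₀, h0, h1, h2⟩ : ∃ t₀, 0 < t₀ ∧ t₀ < l (src (m.1 0)) ∧ t₀ ≤ t :=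
    ⟨min t (l (src (m.1 0)) / 2), lt_min ht (by linarith),
      (min_le_right _ _).trans_lt (by linarith), min_le_left _ _⟩
  have key : Ψ t₀ (param hA hP (m, 0)) = param hA hP (m, t₀) := by
    apply Subtype.ext
    funext k
    obtain ⟨s, hs, hs'⟩ := hΨ.forward _ (isVertex_param_of_isMinPath hA hP hm) m hm t₀ h0 h1 k
    rw [hs', param_apply_of_mem hA hP h0.le h1.le, hm0, zero_add, pt_eq_gpt hA s hs]
  obtain ⟨K, hK⟩ := hS.exists_le_ht hA.pos (t + 1)
  have hK' : t + 1 ≤ rest l m K := by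
    rw [rest, hm0, sub_zero]
    exact hK K le_rfl _
  have h3 : t = (t - t₀) + t₀ := by ring
  have h4 := hm0 K
  have h5 : Ψ (t - t₀) (param hA hP (m, t₀)) = param hA hP (m, t₀ + (t - t₀)) :=
    hΨ.apply_param hA hP (K := K) (by linarith) (by linarith) (by linarith) (by linarith)
  rw [h3, Flow.map_add, key, h5, add_comm]

theorem IsNaturalFlow.apply_param_min_of_neg (hA : Admissible lam l) (hP : x.ProperlyOrdered)
    (hS : x.StronglyMinimal) {Ψ : Flow ℝ (x.Solenoid lam l)} (hΨ : IsNaturalFlow Ψ)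
    {m : x.PathSpace} (hm : IsMinPath m) {t : ℝ} (ht : 0 < t) :
    Ψ (-t) (param hA hP (m, 0)) = param hA hP (m, -t) := by
  obtain ⟨p, hp, -⟩ := hP.2
  obtain rfl : adic p = m := hP.1.unique (hP.isMinPath_adic hp) hm
  have hl := hA.pos (src (p.1 0))
  have hrest : ∀ k, rest l p k = l (src (p.1 0)) := fun k => by
    rw [rest_eq_of_max l (Nat.zero_le k) fun i _ _ => hp i, rest_zero]
  obtain ⟨t₀, h0, h1, h2⟩ : ∃ t₀, 0 < t₀ ∧ t₀ < l (src (p.1 0)) ∧ t₀ ≤ t :=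
    ⟨min t (l (src (p.1 0)) / 2), lt_min ht (by linarith),
      (min_le_right _ _).trans_lt (by linarith), min_le_left _ _⟩
  have key : Ψ (-t₀) (param hA hP (adic p, 0)) = param hA hP (p, l (src (p.1 0)) - t₀) := by
    apply Subtype.ext
    funext k
    obtain ⟨s, hs, hs'⟩ := hΨ.backward _ (isVertex_param_of_isMinPath hA hP hm) p hp t₀ h0 h1 k
    replace hs : (s : ℝ) = (lam⁻¹) ^ k * (OrderedBratteli.ht l k (src (p.1 k)) - t₀) := by
      rw [mul_sub]
      exact hs
    rw [hs', param_apply_of_mem hA hP (by linarith) (by linarith), pt_eq_gpt hA s hs]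
    congr 1
    linarith [hgt_add_rest l p k, hrest k]
  obtain ⟨K, hK⟩ := hS.exists_le_ht hA.pos (t + 1)
  have h4 := hgt_add_rest l p K
  have h5 := hK K le_rfl (src (p.1 K))
  have h6 := hrest K
  have h3 : -t = -(t - t₀) + -t₀ := by ring
  rw [h3, Flow.map_add, key, hΨ.apply_param hA hP (K := K), param_adic]
  · congr 2
    ring
  all_goals linarith

theorem IsNaturalFlow.apply_param_min (hA : Admissible lam l) (hP : x.ProperlyOrdered)
    (hS : x.StronglyMinimal) {Ψ : Flow ℝ (x.Solenoid lam l)} (hΨ : IsNaturalFlow Ψ)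
    {m : x.PathSpace} (hm : IsMinPath m) (t : ℝ) :
    Ψ t (param hA hP (m, 0)) = param hA hP (m, t) := by
  rcases lt_trichotomy t 0 with ht | rfl | ht
  · have := hΨ.apply_param_min_of_neg hA hP hS hm (neg_pos.2 ht)
    rwa [neg_neg] at this
  · exact Flow.map_zero_apply _ _
  · exact hΨ.apply_param_min_of_pos hA hP hS hm ht

theorem exists_hgt_eq_add {p q : x.PathSpace} {K : ℕ} (h : ∀ k, K ≤ k → p.1 k = q.1 k)
    (l : x.V 0 → ℝ) : ∃ d, ∀ k, K ≤ k → hgt l q k = hgt l p k + d := by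
  refine ⟨hgt l q K - hgt l p K, fun k hk => ?_⟩
  induction k, hk using Nat.le_induction with
  | base => ring
  | succ k hk ih =>
    rw [hgt_succ, hgt_succ, ih, h k hk]
    ring

/-- Paths with a common tail lie on one orbit: from level `K` on their heights differ by a constant,
which is the time needed. -/
theorem exists_param_eq_of_tail (hA : Admissible lam l) (hP : x.ProperlyOrdered)
    {p q : x.PathSpace} {K : ℕ} (h : ∀ k, K ≤ k → p.1 k = q.1 k) {w : ℝ} (h₀ : 0 ≤ w)
    (h₁ : w < l (src (q.1 0))) : ∃ s, param hA hP (q, w) = param hA hP (p, s) := by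
  obtain ⟨d, hd⟩ := exists_hgt_eq_add h l
  refine ⟨d + w, solenoid_ext hA fun N => ⟨N + K, by omega, ?_⟩⟩
  have hK : K ≤ N + K := by omega
  generalize N + K = k at hK
  have h2 := hgt_nonneg hA.nonneg q k
  have h3 := le_rest hA.nonneg q k
  have h4 := hgt_add_rest l q k
  have h5 : hgt l q k + w = hgt l p k + (d + w) := by rw [hd k hK]; ring
  rw [param_apply_of_mem hA hP h₀ h₁.le, h5, ← h k hK, ← param_apply hA hP]
  · linarith
  · rw [h k hK]
    linarith

/-- Each non-maximal edge leaves a later subtower above the floor of `q`, of height at least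
`minLen`. -/
theorem exists_lt_rest (hA : Admissible lam l) {q : x.PathSpace}
    (h : ∀ K, ∃ k, K ≤ k ∧ ¬ IsMaxEdge (q.1 k)) (C : ℝ) : ∃ K, C < rest l q K := by
  have hc := hA.minLen_pos
  have key : ∀ n : ℕ, ∃ K, n * hA.minLen ≤ rest l q K := by
    intro n
    induction n with
    | zero => exact ⟨0, by simpa using hA.nonneg _⟩
    | succ n ih =>
      obtain ⟨K, hK⟩ := ih
      obtain ⟨k, hk, hmax⟩ := h K
      simp only [IsMaxEdge, not_forall, not_not] at hmax
      obtain ⟨f, hf⟩ := hmax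
      have h1 := rest_add_ht_src_le hA.nonneg q (Nat.lt_succ_self k) hf
      have h2 : hA.minLen ≤ ht l k (src f) := le_ht_of_le hA.nonneg (k := 0)
        (fun v => by rw [ht_zero]; exact hA.minLen_le v) (Nat.zero_le k) _
      have h3 : rest l q K ≤ rest l q k := rest_mono hA.nonneg q hk
      exact ⟨k + 1, by push_cast; linarith⟩
  obtain ⟨n, hn⟩ := exists_nat_gt (C / hA.minLen)
  obtain ⟨K, hK⟩ := key n
  exact ⟨K, ((div_lt_iff₀ hc).1 hn).trans_le hK⟩

theorem exists_lt_hgt (hA : Admissible lam l) {q : x.PathSpace}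
    (h : ∀ K, ∃ k, K ≤ k ∧ ¬ IsMinEdge (q.1 k)) (C : ℝ) : ∃ K, C < hgt l q K := by
  have hc := hA.minLen_pos
  have key : ∀ n : ℕ, ∃ K, n * hA.minLen ≤ hgt l q K := by
    intro n
    induction n with
    | zero => exact ⟨0, by simp⟩
    | succ n ih =>
      obtain ⟨K, hK⟩ := ih
      obtain ⟨k, hk, hmin⟩ := h K
      simp only [IsMinEdge, not_forall, not_not] at hmin
      obtain ⟨f, hf⟩ := hmin
      have h1 := off_add_le_of_edgeLt hA.nonneg hf
      have h2 : hA.minLen ≤ ht l k (src f) := le_ht_of_le hA.nonneg (k := 0)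
        (fun v => by rw [ht_zero]; exact hA.minLen_le v) (Nat.zero_le k) _
      have h3 : hgt l q K ≤ hgt l q k := hgt_mono hA.nonneg q hk
      have h4 := off_nonneg hA.nonneg f
      exact ⟨k + 1, by rw [hgt_succ]; push_cast; linarith⟩
  obtain ⟨n, hn⟩ := exists_nat_gt (C / hA.minLen)
  obtain ⟨K, hK⟩ := key n
  exact ⟨K, ((div_lt_iff₀ hc).1 hn).trans_le hK⟩

/-- A path that is eventually maximal or eventually minimal lies on the orbit of the vertex point.
For any other path both `hgt` and `rest` are unbounded, so a motion of any duration stays inside one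
edge of some level. -/
theorem IsNaturalFlow.eq_naturalFlow (hA : Admissible lam l) (hP : x.ProperlyOrdered)
    (hS : x.StronglyMinimal) {Ψ : Flow ℝ (x.Solenoid lam l)} (hΨ : IsNaturalFlow Ψ) :
    Ψ = naturalFlow hA hP := by
  obtain ⟨m, hm, -⟩ := hP.1
  obtain ⟨pm, hpm, -⟩ := hP.2
  have horbit : ∀ (s t : ℝ), Ψ t (param hA hP (m, s)) = naturalFlow hA hP t (param hA hP (m, s)) := by
    intro s t
    rw [naturalFlow_param, ← hΨ.apply_param_min hA hP hS hm s, ← Flow.map_add,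
      hΨ.apply_param_min hA hP hS hm, add_comm]
  refine Flow.ext fun t z => ?_
  obtain ⟨q, w, hw0, hw, rfl⟩ := exists_param hA hP z
  by_cases hmax : ∃ K, ∀ k, K ≤ k → IsMaxEdge (q.1 k)
  · obtain ⟨K, hK⟩ := hmax
    have hpq : ∀ k, K ≤ k → pm.1 k = q.1 k := fun k hk => (hpm k).eq_of_ran_eq (hK k hk) (by
      rw [pm.2, q.2]
      exact hP.src_eq_of_max (fun i _ => hpm i) fun i hi => hK i (by omega))
    obtain ⟨s, hs⟩ := exists_param_eq_of_tail hA hP hpq hw0 hw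
    obtain rfl : adic pm = m := hP.1.unique (hP.isMinPath_adic hpm) hm
    have := param_adic hA hP pm (s - l (src (pm.1 0)))
    rw [sub_add_cancel] at this
    rw [hs, ← this]
    exact horbit _ t
  by_cases hmin : ∃ K, ∀ k, K ≤ k → IsMinEdge (q.1 k)
  · obtain ⟨K, hK⟩ := hmin
    have hpq : ∀ k, K ≤ k → m.1 k = q.1 k := fun k hk => (hm k).eq_of_ran_eq (hK k hk) (by
      rw [m.2, q.2]
      exact hP.src_eq_of_min (fun i _ => hm i) fun i hi => hK i (by omega))
    obtain ⟨s, hs⟩ := exists_param_eq_of_tail hA hP hpq hw0 hw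
    rw [hs]
    exact horbit _ t
  push Not at hmax hmin
  obtain ⟨K₁, hK₁⟩ := exists_lt_rest hA hmax (w + |t|)
  obtain ⟨K₂, hK₂⟩ := exists_lt_hgt hA hmin |t|
  have h1 : rest l q K₁ ≤ rest l q (K₁ + K₂) := rest_mono hA.nonneg q (by omega)
  have h2 : hgt l q K₂ ≤ hgt l q (K₁ + K₂) := hgt_mono hA.nonneg q (by omega)
  have h3 := abs_nonneg t
  have h4 := le_abs_self t
  have h5 := neg_abs_le t
  rw [naturalFlow_param, hΨ.apply_param hA hP (K := K₁ + K₂)] <;> linarith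

end OrderedBratteli
namespace OrderedBratteli

variable {x : OrderedBratteli} {lam : ℝ} {l : x.V 0 → ℝ}

/-! ### The path metric of the graphs: upper bounds -/

theorem Joined.nonneg {k : ℕ} {a b : x.Graph lam l k} {L : ℝ} (h : Joined a b L) : 0 ≤ L := by
  induction h with
  | refl => exact le_rfl
  | step v s t L _ ih => positivity

theorem bddBelow_joined {k : ℕ} (a b : x.Graph lam l k) : BddBelow {L | Joined a b L} :=
  ⟨0, fun _ h => h.nonneg⟩

theorem graphDist_nonneg {k : ℕ} (a b : x.Graph lam l k) : 0 ≤ graphDist a b :=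
  Real.sInf_nonneg fun _ h => Joined.nonneg h

theorem Joined.graphDist_le {k : ℕ} {a b : x.Graph lam l k} {L : ℝ} (h : Joined a b L) :
    graphDist a b ≤ L := csInf_le (bddBelow_joined a b) h

theorem graphDist_self {k : ℕ} (a : x.Graph lam l k) : graphDist a a = 0 :=
  le_antisymm Joined.refl.graphDist_le (graphDist_nonneg a a)

/-- Two edges of `Γ^k` are neighbours if they have a common point. -/
def edgeGraph (x : OrderedBratteli) (lam : ℝ) (l : x.V 0 → ℝ) (k : ℕ) : SimpleGraph (x.V k) :=
  SimpleGraph.fromRel fun v w => ∃ s t, (pt v s : x.Graph lam l k) = pt w t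

theorem edgeGraph_reachable_of_pt_eq {k : ℕ} {v w : x.V k} {s : Set.Icc (0 : ℝ) (x.len lam l k v)}
    {t : Set.Icc (0 : ℝ) (x.len lam l k w)} (h : (pt v s : x.Graph lam l k) = pt w t) :
    (edgeGraph x lam l k).Reachable v w := by
  by_cases hvw : v = w
  · rw [hvw]
  · exact SimpleGraph.Adj.reachable ((SimpleGraph.fromRel_adj _ _ _).2 ⟨hvw, Or.inl ⟨s, t, h⟩⟩)

theorem Joined.reachable {k : ℕ} {a b : x.Graph lam l k} {L : ℝ} (h : Joined a b L) :
    ∀ {v w : x.V k} {s : Set.Icc (0 : ℝ) (x.len lam l k v)}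
      {t : Set.Icc (0 : ℝ) (x.len lam l k w)}, a = pt v s → b = pt w t →
      (edgeGraph x lam l k).Reachable v w := by
  induction h with
  | refl => exact fun h1 h2 => edgeGraph_reachable_of_pt_eq (h1.symm.trans h2)
  | step u s' t' L _ ih => exact fun h1 h2 => (ih h1 rfl).trans (edgeGraph_reachable_of_pt_eq h2)

theorem abs_sub_le_of_mem_Icc {C L : ℝ} (hC : L ≤ C) (s t : Set.Icc (0 : ℝ) L) :
    |(s : ℝ) - t| ≤ C := by
  have h1 := s.2.1
  have h2 := s.2.2
  have h3 := t.2.1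
  have h4 := t.2.2
  rw [abs_le]
  constructor <;> linarith

theorem exists_joined_of_walk {k : ℕ} {C : ℝ} (hC : ∀ v, x.len lam l k v ≤ C) {v w : x.V k}
    (W : (edgeGraph x lam l k).Walk v w) {a : x.Graph lam l k}
    {s : Set.Icc (0 : ℝ) (x.len lam l k v)} {L : ℝ} (h : Joined a (pt v s) L)
    (t : Set.Icc (0 : ℝ) (x.len lam l k w)) :
    ∃ L', Joined a (pt w t) L' ∧ L' ≤ L + (W.length + 1) * C := by
  induction W generalizing L with
  | nil =>
    refine ⟨_, Joined.step _ s t L h, ?_⟩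
    simpa using abs_sub_le_of_mem_Icc (hC _) s t
  | @cons u₁ u₂ u₃ hadj W ih =>
    have hex : ∃ s' t', (pt u₁ s' : x.Graph lam l k) = pt u₂ t' := by
      rcases ((SimpleGraph.fromRel_adj _ _ _).1 hadj).2 with ⟨s', t', h'⟩ | ⟨s', t', h'⟩
      · exact ⟨s', t', h'⟩
      · exact ⟨t', s', h'.symm⟩
    obtain ⟨s', t', h'⟩ := hex
    have h1 := Joined.step _ s s' L h
    rw [h'] at h1
    obtain ⟨L', h2, h3⟩ := ih h1 t
    refine ⟨L', h2, h3.trans ?_⟩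
    have := abs_sub_le_of_mem_Icc (hC _) s s'
    rw [SimpleGraph.Walk.length_cons]
    push_cast
    linarith

/-- A walk without repetitions in `edgeGraph` runs through each edge at most once. -/
theorem graphDist_le {k : ℕ} {C : ℝ} (hC : ∀ v, x.len lam l k v ≤ C) (hC₀ : 0 ≤ C)
    (a b : x.Graph lam l k) : graphDist a b ≤ x.nV k * C := by
  by_cases hne : ∃ L, Joined a b L
  · obtain ⟨L, hL⟩ := hne
    obtain ⟨⟨v, s⟩, rfl⟩ := Quot.exists_rep a
    obtain ⟨⟨w, t⟩, rfl⟩ := Quot.exists_rep b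
    obtain ⟨W, hW⟩ := (hL.reachable (v := v) (w := w) (s := s) (t := t) rfl rfl).exists_isPath
    have hlen := hW.length_lt
    rw [Fintype.card_fin] at hlen
    obtain ⟨L', hL', hle⟩ := exists_joined_of_walk hC W (Joined.refl (a := pt v s)) t
    refine hL'.graphDist_le.trans (hle.trans ?_)
    rw [zero_add]
    exact mul_le_mul_of_nonneg_right (by exact_mod_cast hlen) hC₀
  -- Connectedness is not assumed here: for unjoined points the infimum of the empty set is 0.
  · have : {L | Joined a b L} = ∅ := Set.eq_empty_of_forall_notMem fun L hL => hne ⟨L, hL⟩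
    rw [graphDist, this, Real.sInf_empty]
    positivity

theorem exists_len_le (x : OrderedBratteli) (lam : ℝ) (l : x.V 0 → ℝ) (k : ℕ) :
    ∃ C, 0 ≤ C ∧ ∀ v, x.len lam l k v ≤ C := by
  obtain ⟨C, hC⟩ := (Set.finite_range (x.len lam l k)).bddAbove
  exact ⟨max 0 C, le_max_left _ _, fun v => (hC ⟨v, rfl⟩).trans (le_max_right _ _)⟩

theorem graphDist_le_graphDiam {k : ℕ} (a b : x.Graph lam l k) :
    graphDist a b ≤ x.graphDiam lam l k := by
  obtain ⟨C, hC0, hC⟩ := exists_len_le x lam l k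
  refine le_csSup ⟨x.nV k * C, ?_⟩ ⟨a, b, rfl⟩
  rintro r ⟨a, b, rfl⟩
  exact graphDist_le hC hC0 a b

theorem graphDiam_nonneg (x : OrderedBratteli) (lam : ℝ) (l : x.V 0 → ℝ) (k : ℕ) :
    0 ≤ x.graphDiam lam l k :=
  Real.sSup_nonneg (by rintro r ⟨a, b, rfl⟩; exact graphDist_nonneg a b)

theorem graphDiam_le {k : ℕ} {C : ℝ} (hC : ∀ v, x.len lam l k v ≤ C) (hC₀ : 0 ≤ C) :
    x.graphDiam lam l k ≤ x.nV k * C :=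
  Real.sSup_le (by rintro r ⟨a, b, rfl⟩; exact graphDist_le hC hC₀ a b) (by positivity)

theorem div_graphDiam_nonneg {k : ℕ} (a b : x.Graph lam l k) :
    0 ≤ graphDist a b / x.graphDiam lam l k :=
  div_nonneg (graphDist_nonneg a b) (graphDiam_nonneg x lam l k)

theorem div_graphDiam_le_one {k : ℕ} (a b : x.Graph lam l k) :
    graphDist a b / x.graphDiam lam l k ≤ 1 :=
  div_le_one_of_le₀ (graphDist_le_graphDiam a b) (graphDiam_nonneg x lam l k)

theorem Admissible.summable_geometric (hA : Admissible lam l) :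
    Summable fun k : ℕ => (lam⁻¹) ^ k :=
  summable_geometric_of_lt_one (inv_nonneg.2 hA.lam_pos.le) (inv_lt_one_of_one_lt₀ hA.one_lt)

theorem summable_solenoidDist (hA : Admissible lam l) (y z : x.Solenoid lam l) :
    Summable fun k : ℕ =>
      (lam⁻¹) ^ k * (graphDist (y.1 k) (z.1 k) / x.graphDiam lam l k) :=
  Summable.of_nonneg_of_le
    (fun k => mul_nonneg (hA.scale_pos k).le (div_graphDiam_nonneg _ _))
    (fun k => mul_le_of_le_one_right (hA.scale_pos k).le (div_graphDiam_le_one _ _))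
    hA.summable_geometric

theorem solenoidDist_nonneg (hA : Admissible lam l) (y z : x.Solenoid lam l) :
    0 ≤ solenoidDist y z :=
  tsum_nonneg fun k => mul_nonneg (hA.scale_pos k).le (div_graphDiam_nonneg _ _)

theorem le_solenoidDist (hA : Admissible lam l) (y z : x.Solenoid lam l) (k : ℕ) :
    (lam⁻¹) ^ k * (graphDist (y.1 k) (z.1 k) / x.graphDiam lam l k) ≤ solenoidDist y z :=
  (summable_solenoidDist hA y z).le_tsum k
    fun k _ => mul_nonneg (hA.scale_pos k).le (div_graphDiam_nonneg _ _)

/-- The normalized distances are at most 1, so the metric is bounded by the geometric tail from `n`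
on. -/
theorem solenoidDist_le_of_eq (hA : Admissible lam l) {y z : x.Solenoid lam l} {n : ℕ}
    (h : ∀ k < n, y.1 k = z.1 k) : solenoidDist y z ≤ lam * (lam⁻¹) ^ n / (lam - 1) := by
  rw [solenoidDist, ← (summable_solenoidDist hA y z).sum_add_tsum_nat_add n,
    Finset.sum_eq_zero, zero_add]
  · have hs := (summable_nat_add_iff n).2 hA.summable_geometric
    refine (Summable.tsum_le_tsum (fun k => ?_)
      ((summable_nat_add_iff n).2 (summable_solenoidDist hA y z)) hs).trans ?_
    · exact mul_le_of_le_one_right (hA.scale_pos _).le (div_graphDiam_le_one _ _)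
    · have hlam := hA.lam_pos
      have hlam1 : lam - 1 ≠ 0 := (sub_pos.2 hA.one_lt).ne'
      simp only [pow_add]
      rw [tsum_mul_right, tsum_geometric_of_lt_one (inv_nonneg.2 hlam.le)
        (inv_lt_one_of_one_lt₀ hA.one_lt)]
      apply le_of_eq
      have : (1 - lam⁻¹)⁻¹ = lam / (lam - 1) := by
        rw [← one_div, div_eq_div_iff (by
          have := inv_lt_one_of_one_lt₀ hA.one_lt
          linarith) hlam1]
        field_simp
      rw [this]
      ring
  · intro k hk
    rw [h k (Finset.mem_range.1 hk), graphDist_self, zero_div, mul_zero]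

/-! ### Upper bounds for the metric of the solenoid -/

theorem exists_first_ne {p q : x.PathSpace} (h : p ≠ q) :
    ∃ n, (∀ i < n, p.1 i = q.1 i) ∧ p.1 n ≠ q.1 n ∧ ∀ lam, pathDist lam p q = (lam⁻¹) ^ n := by
  have hne : {i : ℕ | p.1 i ≠ q.1 i}.Nonempty := by
    by_contra hcon
    apply h
    apply Subtype.ext
    funext i
    by_contra hi
    exact hcon ⟨i, hi⟩
  refine ⟨sInf {i : ℕ | p.1 i ≠ q.1 i}, fun i hi => ?_, Nat.sInf_mem hne, fun lam => ?_⟩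
  · by_contra hcon
    exact Nat.notMem_of_lt_sInf hi hcon
  · rw [pathDist, if_neg h]

theorem src_eq_of_eq_below {p q : x.PathSpace} {n : ℕ} (h : ∀ i < n, p.1 i = q.1 i)
    (h₀ : src (p.1 0) = src (q.1 0)) : src (p.1 n) = src (q.1 n) := by
  cases n with
  | zero => exact h₀
  | succ n => rw [← p.2, ← q.2, h n (Nat.lt_succ_self n)]

/-- The `k`-th coordinate depends only on the edges below `k` and the vertex at level `k`. So `n`
common edges and a common start fix `n + 1` coordinates, which gains a factor `λ`. -/
theorem baseParam_eq_of_eq_below (hA : Admissible lam l) {p q : x.PathSpace} {n : ℕ}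
    (h : ∀ i < n, p.1 i = q.1 i) (h₀ : src (p.1 0) = src (q.1 0)) :
    ∀ k < n + 1, (baseParam hA (p, 0)).1 k = (baseParam hA (q, 0)).1 k := by
  intro k hk
  have hk' : ∀ i < k, p.1 i = q.1 i := fun i hi => h i (by omega)
  rw [baseParam_apply hA le_rfl (hA.nonneg _), baseParam_apply hA le_rfl (hA.nonneg _),
    hgt_congr l hk', src_eq_of_eq_below hk' h₀]

theorem solenoidDist_self (y : x.Solenoid lam l) : solenoidDist y y = 0 := by
  simp [solenoidDist, graphDist_self]

theorem solenoidDist_baseParam_le_of_src_eq (hA : Admissible lam l) {p q : x.PathSpace}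
    (h₀ : src (p.1 0) = src (q.1 0)) :
    solenoidDist (baseParam hA (p, 0)) (baseParam hA (q, 0)) ≤ pathDist lam p q / (lam - 1) := by
  by_cases hpq : p = q
  · subst hpq
    rw [solenoidDist_self]
    simp [pathDist]
  · obtain ⟨n, hn, -, hd⟩ := exists_first_ne hpq
    rw [hd]
    refine (solenoidDist_le_of_eq hA (baseParam_eq_of_eq_below hA hn h₀)).trans (le_of_eq ?_)
    have := hA.lam_pos.ne'
    rw [pow_succ]
    field_simp

theorem solenoidDist_baseParam_le (hA : Admissible lam l) (p q : x.PathSpace) :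
    solenoidDist (baseParam hA (p, 0)) (baseParam hA (q, 0)) ≤
      lam * pathDist lam p q / (lam - 1) := by
  by_cases hpq : p = q
  · subst hpq
    rw [solenoidDist_self]
    simp [pathDist]
  · obtain ⟨n, hn, -, hd⟩ := exists_first_ne hpq
    rw [hd]
    cases n with
    -- If the first edges differ, the starts may differ and not even the coordinate at level 0 need
    -- agree.
    | zero => exact solenoidDist_le_of_eq hA fun k hk => absurd hk (Nat.not_lt_zero k)
    | succ n =>
      exact solenoidDist_le_of_eq hA fun k hk =>
        baseParam_eq_of_eq_below hA hn (by rw [hn 0 (Nat.succ_pos n)]) k (by omega)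

/-! ### The graphs are connected -/

theorem eqvGen_adjacent_src {k : ℕ} {e f : x.Edge k} (h : ran e = ran f) :
    Relation.EqvGen (x.Adjacent k) (src e) (src f) := by
  have key : ∀ (i : ℕ) (e : x.Edge k), (e.2 : ℕ) = i →
      Relation.EqvGen (x.Adjacent k) (src (minEdge (ran e))) (src e) := by
    intro i
    induction i with
    | zero =>
      intro e he
      rw [← ((isMinEdge_iff e).2 he).eq_minEdge]
      exact Relation.EqvGen.refl _
    | succ i ih =>
      intro e he
      obtain ⟨f, hf1, hf2⟩ := exists_prev (e := e) (by rw [isMinEdge_iff]; omega)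
      have h1 := ih f (by omega)
      rw [show ran f = ran e from hf1] at h1
      exact h1.trans _ _ _ (Relation.EqvGen.rel _ _ (adjacent_of_next hf1.symm hf2))
  exact ((key _ e rfl).symm _ _).trans _ _ _ (h ▸ key _ f rfl)

/-- Connectedness descends: the sources of the edges into one vertex form a chain of adjacent
vertices, and a gluing at level `k + 1` links the end of one chain to the beginning of another. -/
theorem eqvGen_adjacent_src_of_eqvGen {k : ℕ} {v w : x.V (k + 1)}
    (h : Relation.EqvGen (x.Adjacent (k + 1)) v w) : ∀ {e f : x.Edge k}, ran e = v → ran f = w →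
      Relation.EqvGen (x.Adjacent k) (src e) (src f) := by
  induction h with
  | rel v w h =>
    intro e f he hf
    have h1 := Relation.EqvGen.rel _ _ h.src_maxEdge_minEdge
    exact ((eqvGen_adjacent_src (by rw [he]; rfl)).trans _ _ _ h1).trans _ _ _
      (eqvGen_adjacent_src (by rw [hf]; rfl))
  | refl v =>
    intro e f he hf
    exact eqvGen_adjacent_src (he.trans hf.symm)
  | symm v w _ ih =>
    intro e f he hf
    exact (ih hf he).symm _ _
  | trans u v w _ _ ih₁ ih₂ =>
    intro e f he hf
    exact (ih₁ he (ran_minEdge v)).trans _ _ _ (ih₂ (ran_minEdge v) hf)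

theorem eqvGen_adjacent_of_src_eq (j : ℕ) : ∀ {k M : ℕ}, k + j = M → ∀ {p q : x.PathSpace},
    src (p.1 M) = src (q.1 M) → Relation.EqvGen (x.Adjacent k) (src (p.1 k)) (src (q.1 k)) := by
  induction j with
  | zero =>
    rintro k M rfl p q h
    rw [show src (p.1 k) = src (q.1 k) from h]
    exact Relation.EqvGen.refl _
  | succ j ih =>
    intro k M hM p q h
    exact eqvGen_adjacent_src_of_eqvGen (ih (k := k + 1) (by omega) h) (p.2 k) (q.2 k)

theorem StronglyMinimal.eqvGen_adjacent (hS : x.StronglyMinimal) {k : ℕ} (v w : x.V k) :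
    Relation.EqvGen (x.Adjacent k) v w := by
  obtain ⟨M, hkM, hM⟩ := hS.exists_paths k
  obtain ⟨p, -, hp, -, hpM, -⟩ := hM v ⟨0, x.nV_pos M⟩
  obtain ⟨q, -, hq, -, hqM, -⟩ := hM w ⟨0, x.nV_pos M⟩
  rw [← hp, ← hq]
  exact eqvGen_adjacent_of_src_eq (M - k) (by omega) (hpM.trans hqM.symm)

theorem exists_joined_of_eqvGen (hA : Admissible lam l) {k : ℕ} {v w : x.V k}
    (h : Relation.EqvGen (x.Adjacent k) v w) :
    ∀ {a : x.Graph lam l k} {s : Set.Icc (0 : ℝ) (x.len lam l k v)} {L : ℝ},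
      Joined a (pt v s) L → ∀ t : Set.Icc (0 : ℝ) (x.len lam l k w), ∃ L', Joined a (pt w t) L' := by
  have hreach : (edgeGraph x lam l k).Reachable v w := by
    induction h with
    | rel v w h =>
      have := gpt_glue hA h
      rw [gpt_eq_pt hA (ht_pos hA.pos k v).le le_rfl,
        gpt_eq_pt hA le_rfl (ht_pos hA.pos k w).le] at this
      exact edgeGraph_reachable_of_pt_eq this
    | refl v => exact SimpleGraph.Reachable.refl v
    | symm v w _ ih => exact ih.symm
    | trans u v w _ _ ih₁ ih₂ => exact ih₁.trans ih₂
  intro a s L hL t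
  obtain ⟨C, -, hC⟩ := exists_len_le x lam l k
  obtain ⟨W⟩ := hreach
  obtain ⟨L', h', -⟩ := exists_joined_of_walk hC W hL t
  exact ⟨L', h'⟩

theorem exists_joined (hA : Admissible lam l) (hS : x.StronglyMinimal) {k : ℕ}
    (a b : x.Graph lam l k) : ∃ L, Joined a b L := by
  obtain ⟨⟨v, s⟩, rfl⟩ := Quot.exists_rep a
  obtain ⟨⟨w, t⟩, rfl⟩ := Quot.exists_rep b
  exact exists_joined_of_eqvGen hA (hS.eqvGen_adjacent v w) (Joined.refl (a := pt v s)) t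

/-! ### The path metric of the graphs: lower bounds -/

/-- Functions that are 1-Lipschitz along every edge serve as test functions for lower bounds of the
path metric. -/
theorem abs_sub_le_graphDist (hA : Admissible lam l) (hS : x.StronglyMinimal) {k : ℕ}
    (F : x.Graph lam l k → ℝ)
    (hF : ∀ v (s t : Set.Icc (0 : ℝ) (x.len lam l k v)), |F (pt v s) - F (pt v t)| ≤ |(s : ℝ) - t|)
    (a b : x.Graph lam l k) : |F a - F b| ≤ graphDist a b := by
  -- Connectedness is essential here, since the infimum over an empty set of lengths would be 0.
  refine le_csInf (exists_joined hA hS a b) ?_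
  intro L hL
  induction hL with
  | refl => simp
  | step v s t L _ ih =>
    calc |F a - F (pt v t)| = |(F a - F (pt v s)) + (F (pt v s) - F (pt v t))| := by ring_nf
      _ ≤ |F a - F (pt v s)| + |F (pt v s) - F (pt v t)| := abs_add_le _ _
      _ ≤ _ := add_le_add ih (hF v s t)

open Classical in
/-- The distance from the point at position `c` of the edge `e_v` in the circle that results from
identifying the end points of `e_v` and collapsing all the other edges. -/
noncomputable def circleDist {k : ℕ} (v : x.V k)
    (c : Set.Icc (0 : ℝ) (x.len lam l k v)) : x.Graph lam l k → ℝ :=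
  Quot.lift (fun a => if a.1 = v then min |(a.2 : ℝ) - c| (x.len lam l k v - |(a.2 : ℝ) - c|) else
      min |0 - (c : ℝ)| (x.len lam l k v - |0 - (c : ℝ)|)) (by
    rintro ⟨v₁, s₁⟩ ⟨v₂, s₂⟩ ⟨-, h₁, h₂⟩
    simp only at h₁ h₂
    simp only [h₁, h₂]
    -- Both ends of `e_v` have the same distance from `c` on the circle, and the other edges
    -- collapse to that point; so the function descends to the quotient.
    have key : min |x.len lam l k v - (c : ℝ)| (x.len lam l k v - |x.len lam l k v - (c : ℝ)|) =
        min |0 - (c : ℝ)| (x.len lam l k v - |0 - (c : ℝ)|) := by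
      rw [abs_of_nonneg (sub_nonneg.2 c.2.2), zero_sub, abs_neg, abs_of_nonneg c.2.1, sub_sub_cancel,
        min_comm]
    split_ifs with h h' h'
    · rw [h, key]
    · rw [h, key]
    · rfl
    · rfl)

theorem circleDist_lipschitz {k : ℕ} (v : x.V k) (c : Set.Icc (0 : ℝ) (x.len lam l k v))
    (w : x.V k) (s t : Set.Icc (0 : ℝ) (x.len lam l k w)) :
    |circleDist v c (pt w s) - circleDist v c (pt w t)| ≤ |(s : ℝ) - t| := by
  by_cases hw : w = v
  · subst hw
    have h1 : circleDist w c (pt w s) = min |(s : ℝ) - c| (x.len lam l k w - |(s : ℝ) - c|) :=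
      if_pos rfl
    have h2 : circleDist w c (pt w t) = min |(t : ℝ) - c| (x.len lam l k w - |(t : ℝ) - c|) :=
      if_pos rfl
    have h3 : |(|(s : ℝ) - c| - |(t : ℝ) - c|)| ≤ |(s : ℝ) - t| := by
      have := abs_abs_sub_abs_le ((s : ℝ) - c) (t - c)
      rwa [sub_sub_sub_cancel_right] at this
    rw [h1, h2]
    refine (abs_min_sub_min_le_max _ _ _ _).trans (max_le h3 ?_)
    rw [sub_sub_sub_cancel_left, abs_sub_comm]
    exact h3
  · have h1 : circleDist v c (pt w s) = circleDist v c (pt w t) := by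
      exact (if_neg hw).trans (if_neg hw).symm
    rw [h1, sub_self, abs_zero]
    exact abs_nonneg _

theorem circleDist_gpt (hA : Admissible lam l) {k : ℕ} {v : x.V k} {σ τ : ℝ} (h₀ : 0 ≤ σ)
    (h₁ : σ ≤ ht l k v) (h₂ : 0 ≤ τ) (h₃ : τ ≤ ht l k v) :
    circleDist v ⟨_, scale_mem hA h₀ h₁⟩ (gpt hA v τ) =
      (lam⁻¹) ^ k * min |τ - σ| (ht l k v - |τ - σ|) := by
  rw [gpt_eq_pt hA h₂ h₃]
  refine (if_pos rfl).trans ?_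
  simp only [len_eq]
  rw [← mul_sub, abs_mul, abs_of_pos (hA.scale_pos k), ← mul_sub,
    mul_min_of_nonneg _ _ (hA.scale_pos k).le]

/-- Both arcs between the two points of the circle have length at least `m`. Stating both orders
avoids the symmetry of `graphDist`. -/
theorem le_graphDist_of_eq (hA : Admissible lam l) (hS : x.StronglyMinimal) {k : ℕ} {v : x.V k}
    {σ τ m : ℝ} (h₀ : 0 ≤ σ) (h₁ : σ + m ≤ τ) (hm : 0 ≤ m) (h₂ : τ ≤ ht l k v)
    (h₃ : m ≤ σ + (ht l k v - τ)) :
    (lam⁻¹) ^ k * m ≤ graphDist (gpt hA v σ) (gpt hA v τ) ∧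
      (lam⁻¹) ^ k * m ≤ graphDist (gpt hA v τ) (gpt hA v σ) := by
  have hσ : σ ≤ ht l k v := by linarith
  have key := abs_sub_le_graphDist hA hS (circleDist v ⟨_, scale_mem hA h₀ hσ⟩)
    (circleDist_lipschitz v _)
  have e1 := circleDist_gpt hA h₀ hσ h₀ hσ
  have e2 := circleDist_gpt hA h₀ hσ (by linarith : 0 ≤ τ) h₂
  rw [sub_self, abs_zero, min_eq_left (by linarith), mul_zero] at e1
  rw [abs_of_nonneg (by linarith)] at e2
  have h4 : (lam⁻¹) ^ k * m ≤ (lam⁻¹) ^ k * min (τ - σ) (ht l k v - (τ - σ)) :=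
    mul_le_mul_of_nonneg_left (le_min (by linarith) (by linarith)) (hA.scale_pos k).le
  constructor
  · have := (le_abs_self _).trans ((abs_sub_comm _ _).le.trans (key (gpt hA v σ) (gpt hA v τ)))
    rw [e1, e2, sub_zero] at this
    exact h4.trans this
  · have := (le_abs_self _).trans (key (gpt hA v τ) (gpt hA v σ))
    rw [e1, e2, sub_zero] at this
    exact h4.trans this

theorem le_graphDist_of_ne (hA : Admissible lam l) (hS : x.StronglyMinimal) {k : ℕ} {v w : x.V k}
    (hvw : v ≠ w) {σ m : ℝ} (τ : ℝ) (hm : 0 ≤ m) (h₀ : m ≤ σ) (h₁ : m ≤ ht l k v - σ) :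
    (lam⁻¹) ^ k * m ≤ graphDist (gpt hA v σ) (gpt hA w τ) ∧
      (lam⁻¹) ^ k * m ≤ graphDist (gpt hA w τ) (gpt hA v σ) := by
  have hv := (ht_pos hA.pos k v).le
  have key := abs_sub_le_graphDist hA hS (circleDist v ⟨_, scale_mem hA le_rfl hv⟩)
    (circleDist_lipschitz v _)
  have e1 := circleDist_gpt hA le_rfl hv (by linarith : 0 ≤ σ) (by linarith)
  have e2 : circleDist v ⟨_, scale_mem hA le_rfl hv⟩ (gpt hA w τ) = 0 := by
    refine (if_neg (Ne.symm hvw)).trans ?_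
    simp [(hA.len_pos k v).le]
  rw [sub_zero, abs_of_nonneg (by linarith)] at e1
  have h4 : (lam⁻¹) ^ k * m ≤ (lam⁻¹) ^ k * min σ (ht l k v - σ) :=
    mul_le_mul_of_nonneg_left (le_min (by linarith) (by linarith)) (hA.scale_pos k).le
  constructor
  · have := (le_abs_self _).trans (key (gpt hA v σ) (gpt hA w τ))
    rw [e1, e2, sub_zero] at this
    exact h4.trans this
  · have := (le_abs_self _).trans ((abs_sub_comm _ _).le.trans (key (gpt hA w τ) (gpt hA v σ)))
    rw [e1, e2, sub_zero] at this
    exact h4.trans this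

/-- If the points lie on the same edge at level `M`, the floors are apart by a remainder of one path
plus a height of the other, and `hends` leaves room on the complementary arc as well. If the edges
differ, it suffices that one point is far from both ends of its edge. -/
theorem le_graphDist_baseParam (hA : Admissible lam l) (hS : x.StronglyMinimal)
    {p q : x.PathSpace} {n M : ℕ} (hnM : n < M) (hne : p.1 n ≠ q.1 n) {m : ℝ} (hm₀ : 0 ≤ m)
    (hm : ∀ i, n ≤ i → ∀ u : x.V i, m ≤ ht l i u)
    (hends : (m ≤ rest l p n ∧ m ≤ rest l q n) ∨ (m ≤ hgt l p n ∧ m ≤ hgt l q n))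
    (hmin : ∀ p q : x.PathSpace, (∀ i, n + 1 ≤ i → i < M → IsMinEdge (p.1 i)) →
      (∀ i, n + 1 ≤ i → i < M → IsMinEdge (q.1 i)) → src (p.1 (n + 1)) = src (q.1 (n + 1)))
    (hmax : ∀ p q : x.PathSpace, (∀ i, n + 1 ≤ i → i < M → IsMaxEdge (p.1 i)) →
      (∀ i, n + 1 ≤ i → i < M → IsMaxEdge (q.1 i)) → src (p.1 (n + 1)) = src (q.1 (n + 1))) :
    (lam⁻¹) ^ M * m ≤ graphDist ((baseParam hA (p, 0)).1 M) ((baseParam hA (q, 0)).1 M) := by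
  have hl := hA.nonneg
  rw [baseParam_apply hA le_rfl (hl _), baseParam_apply hA le_rfl (hl _), add_zero, add_zero]
  have hrp : rest l p n ≤ rest l p M := rest_mono hl p hnM.le
  have hrq : rest l q n ≤ rest l q M := rest_mono hl q hnM.le
  have hhp : hgt l p n ≤ hgt l p M := hgt_mono hl p hnM.le
  have hhq : hgt l q n ≤ hgt l q M := hgt_mono hl q hnM.le
  have hsp := hgt_add_rest l p M
  have hsq := hgt_add_rest l q M
  have hp0 := hgt_nonneg hl p M
  have hq0 := hgt_nonneg hl q M
  have hp1 := (hl _).trans (le_rest hl p M)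
  have hq1 := (hl _).trans (le_rest hl q M)
  by_cases hsrc : src (p.1 M) = src (q.1 M)
  · obtain ⟨j, hnj, hjM, hlt | hlt, hagree⟩ := exists_edgeLt_of_ne p q hnM hne hsrc
    · have h1 := hgt_add_rest_le_of_edgeLt hl p q hjM hlt hagree
      have h2 : rest l p n ≤ rest l p j := rest_mono hl p hnj
      have h3 : hgt l q n ≤ hgt l q j := hgt_mono hl q hnj
      have h4 := (hl _).trans (le_rest hl p j)
      have h5 := hgt_nonneg hl q j
      rw [hsrc]
      refine (le_graphDist_of_eq hA hS hp0 ?_ hm₀ (by linarith) ?_).1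
      · rcases hends with h | h <;> linarith [h.1, h.2]
      · rcases hends with h | h <;> linarith [h.1, h.2]
    · have h1 := hgt_add_rest_le_of_edgeLt hl q p hjM hlt fun i h h' => (hagree i h h').symm
      have h2 : rest l q n ≤ rest l q j := rest_mono hl q hnj
      have h3 : hgt l p n ≤ hgt l p j := hgt_mono hl p hnj
      have h4 := (hl _).trans (le_rest hl q j)
      have h5 := hgt_nonneg hl p j
      rw [← hsrc]
      rw [← hsrc] at hsq
      refine (le_graphDist_of_eq hA hS hq0 ?_ hm₀ (by linarith) ?_).2
      · rcases hends with h | h <;> linarith [h.1, h.2]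
      · rcases hends with h | h <;> linarith [h.1, h.2]
  -- When the remainders are large, failure means that both heights at `M` are below `m`. Then
  -- neither path passes a smaller edge from level `n` on, so both are minimal up to `M`, and `hmin`
  -- forces the same edge at `n`. The other case is the mirror image with maximal edges.
  · have key : (m ≤ hgt l p M ∧ m ≤ rest l p M) ∨ (m ≤ hgt l q M ∧ m ≤ rest l q M) := by
      rcases hends with h | h
      · by_contra! hcon
        have hp : ∀ i, n ≤ i → i < M → IsMinEdge (p.1 i) := fun i hi hiM f hf => by
          linarith [hcon.1 (not_lt.1 fun h' => by
            linarith [ht_src_le_hgt hl p hiM hf, hm i hi (src f)])]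
        have hq : ∀ i, n ≤ i → i < M → IsMinEdge (q.1 i) := fun i hi hiM f hf => by
          linarith [hcon.2 (not_lt.1 fun h' => by
            linarith [ht_src_le_hgt hl q hiM hf, hm i hi (src f)])]
        refine hne ((hp n le_rfl hnM).eq_of_ran_eq (hq n le_rfl hnM) ?_)
        rw [p.2, q.2]
        exact hmin p q (fun i hi => hp i (by omega)) fun i hi => hq i (by omega)
      · by_contra! hcon
        have hp : ∀ i, n ≤ i → i < M → IsMaxEdge (p.1 i) := fun i hi hiM f hf => by
          linarith [hcon.1 (by linarith), rest_add_ht_src_le hl p hiM hf, hm i hi (src f),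
            (hl _).trans (le_rest hl p i)]
        have hq : ∀ i, n ≤ i → i < M → IsMaxEdge (q.1 i) := fun i hi hiM f hf => by
          linarith [hcon.2 (by linarith), rest_add_ht_src_le hl q hiM hf, hm i hi (src f),
            (hl _).trans (le_rest hl q i)]
        refine hne ((hp n le_rfl hnM).eq_of_ran_eq (hq n le_rfl hnM) ?_)
        rw [p.2, q.2]
        exact hmax p q (fun i hi => hp i (by omega)) fun i hi => hq i (by omega)
    rcases key with ⟨h1, h2⟩ | ⟨h1, h2⟩
    · exact (le_graphDist_of_ne hA hS hsrc _ hm₀ h1 (by linarith)).1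
    · exact (le_graphDist_of_ne hA hS (Ne.symm hsrc) _ hm₀ h1 (by linarith)).2

theorem le_solenoidDist_of_le_graphDist (hA : Admissible lam l) {y z : x.Solenoid lam l} {M : ℕ}
    {m B : ℝ} (hm : 0 < m) (hB : ∀ v, ht l M v ≤ B)
    (h : (lam⁻¹) ^ M * m ≤ graphDist (y.1 M) (z.1 M)) :
    (lam⁻¹) ^ M * (m / (x.nV M * B)) ≤ solenoidDist y z := by
  refine le_trans ?_ (le_solenoidDist hA y z M)
  have hc := hA.scale_pos M
  refine mul_le_mul_of_nonneg_left ?_ hc.le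
  have hB0 : 0 < B := (ht_pos hA.pos M ⟨0, x.nV_pos M⟩).trans_le (hB _)
  have hn : (0 : ℝ) < x.nV M := by exact_mod_cast x.nV_pos M
  have hpos : 0 < graphDist (y.1 M) (z.1 M) := (mul_pos hc hm).trans_le h
  have hdiam : 0 < x.graphDiam lam l M := hpos.trans_le (graphDist_le_graphDiam _ _)
  have hle : x.graphDiam lam l M ≤ x.nV M * ((lam⁻¹) ^ M * B) :=
    graphDiam_le (fun v => mul_le_mul_of_nonneg_left (hB v) hc.le) (by positivity)
  calc m / (x.nV M * B) = ((lam⁻¹) ^ M * m) / (x.nV M * ((lam⁻¹) ^ M * B)) := by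
        rw [mul_left_comm, mul_div_mul_left _ _ hc.ne']
    _ ≤ graphDist (y.1 M) (z.1 M) / x.graphDiam lam l M :=
        div_le_div₀ hpos.le h hdiam hle

end OrderedBratteli

/-! ### Recurrence: non-vanishing frequency and sublinear gaps of visits -/

namespace Ergodic

variable {α : Type*} [MeasurableSpace α] {f : α → α} {μ : Measure α} [IsProbabilityMeasure μ]
  {E : Set α}

/-- The orbit of almost every point visits a set of positive measure with frequencies that do not
tend to zero. -/
theorem ae_not_tendsto_birkhoffAverage_indicator (hf : Ergodic f μ) (hE : MeasurableSet E)
    (hμ : μ E ≠ 0) :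
    ∀ᵐ x ∂μ, ¬ Tendsto (fun n => birkhoffAverage ℝ f (E.indicator fun _ => (1 : ℝ)) n x)
      atTop (𝓝 0) := by
  set g : α → ℝ := E.indicator fun _ => (1 : ℝ) with hg
  have hg0 : ∀ x, 0 ≤ g x := fun x => Set.indicator_nonneg (fun _ _ => zero_le_one) x
  have hg1 : ∀ x, g x ≤ 1 := fun x => Set.indicator_le_self' (fun _ _ => zero_le_one) x
  have hgm : Measurable g := measurable_const.indicator hE
  have hsm : ∀ n, Measurable (birkhoffAverage ℝ f g n) := by
    intro n
    have : birkhoffAverage ℝ f g n = fun x => (n : ℝ)⁻¹ * ∑ k ∈ Finset.range n, g (f^[k] x) := rfl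
    rw [this]
    exact (Finset.measurable_sum _ fun k _ =>
      hgm.comp (hf.measurable.iterate k)).const_mul _
  have hA0 : ∀ n x, 0 ≤ birkhoffAverage ℝ f g n x := fun n x =>
    mul_nonneg (by positivity) (Finset.sum_nonneg fun _ _ => hg0 _)
  have hA1 : ∀ n x, birkhoffAverage ℝ f g n x ≤ 1 := by
    intro n x
    have h : birkhoffSum f g n x ≤ n := by
      calc birkhoffSum f g n x ≤ ∑ _k ∈ Finset.range n, (1 : ℝ) :=
            Finset.sum_le_sum fun _ _ => hg1 _
        _ = n := by simp
    change (n : ℝ)⁻¹ * birkhoffSum f g n x ≤ 1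
    rw [inv_mul_eq_div]
    exact div_le_one_of_le₀ h (by positivity)
  set S : Set α := {x | Tendsto (fun n => birkhoffAverage ℝ f g n x) atTop (𝓝 0)} with hS
  have hSm : MeasurableSet S := measurableSet_tendsto (𝓝 0) hsm
  have hb : Bornology.IsBounded (Set.range g) :=
    (Metric.isBounded_Icc (0 : ℝ) 1).subset (by rintro _ ⟨x, rfl⟩; exact ⟨hg0 x, hg1 x⟩)
  -- Averages of a bounded function at `x` and at `f x` differ by a null sequence.
  have hinv : f ⁻¹' S = S := by
    ext x
    have hd := tendsto_birkhoffAverage_apply_sub_birkhoffAverage' ℝ hb f x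
    constructor
    · intro h
      have := (show Tendsto (fun n => birkhoffAverage ℝ f g n (f x)) atTop (𝓝 0) from h).sub hd
      simp only [sub_sub_cancel, sub_zero] at this
      exact this
    · intro h
      have := (show Tendsto (fun n => birkhoffAverage ℝ f g n x) atTop (𝓝 0) from h).add hd
      simp only [add_sub_cancel, add_zero] at this
      exact this
  -- By ergodicity `S` is null or conull. In the latter case dominated convergence would send the
  -- integrals of the averages, all equal to the measure of `E`, to 0.
  refine (hf.toPreErgodic.ae_mem_or_ae_notMem hSm hinv).resolve_left fun hall => hμ ?_
  have hinner : ∀ n : ℕ, 0 < n → ∫ x, birkhoffAverage ℝ f g n x ∂μ = μ.real E := by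
    intro n hn
    have hi : Integrable g μ := (integrable_const (1 : ℝ)).indicator hE
    have h1 : ∀ k, ∫ x, g (f^[k] x) ∂μ = μ.real E := fun k => by
      have hk := hf.toMeasurePreserving.iterate k
      rw [← integral_map (f := g) hk.measurable.aemeasurable (hgm.aestronglyMeasurable), hk.map_eq,
        hg, integral_indicator_const _ hE]
      simp
    change ∫ x, (n : ℝ)⁻¹ * ∑ k ∈ Finset.range n, g (f^[k] x) ∂μ = _
    rw [integral_const_mul, integral_finsetSum]
    · simp only [h1, Finset.sum_const, Finset.card_range, nsmul_eq_mul]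
      field_simp
    · intro k _
      exact (hf.toMeasurePreserving.iterate k).integrable_comp_of_integrable hi
  have hlim : Tendsto (fun n => ∫ x, birkhoffAverage ℝ f g n x ∂μ) atTop (𝓝 (∫ _x, (0 : ℝ) ∂μ)) := by
    refine tendsto_integral_of_dominated_convergence (fun _ => 1)
      (fun n => (hsm n).aestronglyMeasurable) (integrable_const _) (fun n => ae_of_all _ fun x => ?_)
      hall
    rw [Real.norm_of_nonneg (hA0 n x)]; exact hA1 n x
  have hE0 : μ.real E = 0 := by
    refine tendsto_nhds_unique (Tendsto.congr' ?_ tendsto_const_nhds) (by simpa using hlim)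
    filter_upwards [eventually_gt_atTop 0] with n hn using (hinner n hn).symm
  exact (measureReal_eq_zero_iff).1 hE0

/-- With finitely many visits the Birkhoff sums stay bounded, and the averages tend to 0. -/
theorem ae_frequently_iterate_mem (hf : Ergodic f μ) (hE : MeasurableSet E) (hμ : μ E ≠ 0) :
    ∀ᵐ x ∂μ, ∃ᶠ n in atTop, f^[n] x ∈ E := by
  filter_upwards [hf.ae_not_tendsto_birkhoffAverage_indicator hE hμ] with x hx hfin
  refine hx ?_
  obtain ⟨N, hN⟩ := eventually_atTop.1 hfin
  refine Tendsto.congr' ?_ (tendsto_inv_atTop_nhds_zero_nat.mul_const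
    (birkhoffSum f (E.indicator fun _ => (1 : ℝ)) N x) |>.trans (by simp))
  filter_upwards [eventually_ge_atTop N] with n hn
  change _ = (n : ℝ)⁻¹ * birkhoffSum f _ n x
  congr 1
  refine Finset.sum_subset (Finset.range_subset_range.2 hn) fun k _ hk => ?_
  exact Set.indicator_of_notMem (hN k (by simpa using hk)) _

/-- The sum of the measures of the sets of points of `E` whose first `k` iterates avoid `E` is at
most the total mass. -/
theorem tsum_measure_return_gt_le (hf : MeasurePreserving f μ μ) (hE : MeasurableSet E) :
    ∑' k, μ (E ∩ {x | ∀ i, i < k → f^[i + 1] x ∉ E}) ≤ 1 := by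
  have hm : ∀ k, MeasurableSet {x | ∀ i, i < k → f^[i] x ∉ E} := fun k => by
    have : {x | ∀ i, i < k → f^[i] x ∉ E} = ⋂ i, ⋂ (_ : i < k), (f^[i] ⁻¹' E)ᶜ := by
      ext x; simp
    rw [this]
    exact MeasurableSet.iInter fun i => MeasurableSet.iInter fun _ =>
      ((hf.measurable.iterate i) hE).compl
  refine ENNReal.tsum_le_of_sum_range_le fun n => ?_
  -- By invariance, avoiding `E` at times `0, …, n - 1` is as likely as at times `1, …, n`;
  -- splitting the latter event by whether the point itself is in `E` gives the next term of the
  -- sum.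
  have key : ∀ n, ∑ k ∈ Finset.range n, μ (E ∩ {x | ∀ i, i < k → f^[i + 1] x ∉ E}) +
      μ {x | ∀ i, i < n → f^[i] x ∉ E} = 1 := by
    intro n
    induction n with
    | zero => simp
    | succ n ih =>
      rw [Finset.sum_range_succ, add_assoc, ← ih]
      congr 1
      rw [← hf.measure_preimage (hm n).nullMeasurableSet,
        ← measure_inter_add_sdiff (f ⁻¹' {x | ∀ i, i < n → f^[i] x ∉ E}) hE]
      congr 2
      · rw [Set.inter_comm]; rfl
      · ext x
        constructor
        · intro h
          refine ⟨fun i hi => h (i + 1) (by omega), h 0 (by omega)⟩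
        · rintro ⟨h1, h2⟩ i hi
          cases i with
          | zero => exact h2
          | succ i => exact h1 i (by omega)
  exact le_self_add.trans (key n).le

theorem _root_.ENNReal.tsum_comp_div (a : ℕ → ENNReal) (q : ℕ) [NeZero q] :
    ∑' n, a (n / q) = q * ∑' k, a k := by
  have h := (Nat.divModEquiv q).tsum_eq (fun z : ℕ × Fin q => a z.1)
  rw [show (fun n => a (n / q)) = fun n => (fun z : ℕ × Fin q => a z.1) (Nat.divModEquiv q n) from rfl,
    h, ENNReal.tsum_prod (f := fun k (_ : Fin q) => a k)]
  simp [ENNReal.tsum_mul_left]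

/-- Almost surely, the gaps between the visits to a set of positive measure are sublinear. -/
theorem ae_exists_visit_le (hf : Ergodic f μ) (hE : MeasurableSet E) (hμ : μ E ≠ 0) :
    ∀ᵐ x ∂μ, ∀ q : ℕ, 0 < q → ∃ n₀, ∀ n, n₀ ≤ n → ∃ k, n ≤ k ∧ k ≤ n + n / q ∧ f^[k] x ∈ E := by
  have hBC : ∀ q : ℕ, 0 < q → ∀ᵐ x ∂μ, ∀ᶠ n in atTop,
      x ∉ f^[n] ⁻¹' (E ∩ {x | ∀ i, i < n / q → f^[i + 1] x ∉ E}) := by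
    intro q hq
    have : NeZero q := ⟨hq.ne'⟩
    -- Borel–Cantelli for the event that a visit at time `n` is not followed by a return within `n /
    -- q`. Each value of `n / q` occurs `q` times, so the probabilities sum to at most `q`.
    refine ae_eventually_notMem (ne_of_lt ?_)
    have hmeas : ∀ n, μ (f^[n] ⁻¹' (E ∩ {x | ∀ i, i < n / q → f^[i + 1] x ∉ E})) =
        μ (E ∩ {x | ∀ i, i < n / q → f^[i + 1] x ∉ E}) := fun n => by
      refine (hf.toMeasurePreserving.iterate n).measure_preimage (MeasurableSet.nullMeasurableSet ?_)
      refine hE.inter ?_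
      have : {x | ∀ i, i < n / q → f^[i + 1] x ∉ E} =
          ⋂ i, ⋂ (_ : i < n / q), (f^[i + 1] ⁻¹' E)ᶜ := by
        ext x; simp
      rw [this]
      exact MeasurableSet.iInter fun i => MeasurableSet.iInter fun _ =>
        ((hf.measurable.iterate (i + 1)) hE).compl
    simp only [hmeas]
    rw [ENNReal.tsum_comp_div (fun k => μ (E ∩ {x | ∀ i, i < k → f^[i + 1] x ∉ E})) q]
    refine lt_of_le_of_lt (mul_le_mul_right (tsum_measure_return_gt_le hf.toMeasurePreserving hE) _) ?_
    simp
  have hall : ∀ᵐ x ∂μ, ∀ q : ℕ, 0 < q → ∀ᶠ n in atTop,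
      x ∉ f^[n] ⁻¹' (E ∩ {x | ∀ i, i < n / q → f^[i + 1] x ∉ E}) :=
    ae_all_iff.2 fun q => by
      by_cases hq : 0 < q
      · filter_upwards [hBC q hq] with x hx _ using hx
      · exact ae_of_all _ fun x h => absurd h hq
  filter_upwards [hall, hf.ae_frequently_iterate_mem hE hμ] with x hx hinf q hq
  obtain ⟨N, hN⟩ := eventually_atTop.1 (hx q hq)
  obtain ⟨m, hNm, hm⟩ := frequently_atTop.1 hinf N
  -- the last visit before `n` returns within its allotted time
  have key : ∀ n, m ≤ n → ∃ k, n ≤ k ∧ k ≤ n + n / q ∧ f^[k] x ∈ E := by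
    intro n hn
    induction n, hn using Nat.le_induction with
    | base => exact ⟨m, le_rfl, Nat.le_add_right _ _, hm⟩
    | succ n hn ih =>
      obtain ⟨k, h1, h2, h3⟩ := ih
      rcases h1.eq_or_lt with rfl | h1
      · have h4 := hN n (hNm.trans hn)
        have h5 : ∃ i, i < n / q ∧ f^[i + 1] (f^[n] x) ∈ E := by
          by_contra hcon
          push Not at hcon
          exact h4 ⟨h3, hcon⟩
        obtain ⟨i, hi, h6⟩ := h5
        refine ⟨n + (i + 1), by omega, ?_, ?_⟩
        · have : n / q ≤ (n + 1) / q := Nat.div_le_div_right (by omega)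
          omega
        · rw [← Function.iterate_add_apply] at h6
          rwa [Nat.add_comm]
      · refine ⟨k, h1, ?_, h3⟩
        have : n / q ≤ (n + 1) / q := Nat.div_le_div_right (by omega)
        omega
  exact ⟨m, key⟩

end Ergodic

namespace OrderedBratteli

/-! ### Finite blocks that mix and that have a common extremal source -/

/-- The labels of the sources of the edges into the vertex `v` at a site. -/
def siteList (a : Site) (v : ℕ) : List ℕ :=
  if h : v < a.2.1 then (a.2.2 ⟨v, h⟩).map Fin.val else []

/-- The number of paths from the vertex `u` of level `0` to the vertex `v` of level `k`. -/
def pathCount (s : ℕ → Site) (u : ℕ) : ℕ → ℕ → ℕ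
  | 0, v => if u = v then 1 else 0
  | k + 1, v => ((siteList (s k) v).map (pathCount s u k)).sum

/-- The source of the minimal path from level `0` to the vertex `v` of level `k`. -/
def minSrc (s : ℕ → Site) : ℕ → ℕ → ℕ
  | 0, v => v
  | k + 1, v => minSrc s k ((siteList (s k) v).headD 0)

/-- The source of the maximal path from level `0` to the vertex `v` of level `k`. -/
def maxSrc (s : ℕ → Site) : ℕ → ℕ → ℕ
  | 0, v => v
  | k + 1, v => maxSrc s k ((siteList (s k) v).getLastD 0)

/-- The first `N` levels join any two vertices by at least two paths, and the minimal paths as well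
as the maximal paths through them have a common source. -/
def IsGoodBlock (N : ℕ) (s : ℕ → Site) : Prop :=
  (∀ u < (s 0).1, ∀ v < (s N).1, 2 ≤ pathCount s u N v) ∧
  (∀ v < (s N).1, ∀ w < (s N).1, minSrc s N v = minSrc s N w) ∧
  (∀ v < (s N).1, ∀ w < (s N).1, maxSrc s N v = maxSrc s N w)

theorem pathCount_congr {s s' : ℕ → Site} (u k : ℕ) (h : ∀ i < k, s i = s' i) (v : ℕ) :
    pathCount s u k v = pathCount s' u k v := by
  induction k generalizing v with
  | zero => rfl
  | succ k ih =>
    have := funext (ih fun i hi => h i (by omega))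
    rw [pathCount, pathCount, h k (by omega)]
    exact congrArg (fun g => ((siteList (s' k) v).map g).sum) this

theorem minSrc_congr {s s' : ℕ → Site} (k : ℕ) (h : ∀ i < k, s i = s' i) (v : ℕ) :
    minSrc s k v = minSrc s' k v := by
  induction k generalizing v with
  | zero => rfl
  | succ k ih => rw [minSrc, minSrc, h k (by omega), ih fun i hi => h i (by omega)]

theorem maxSrc_congr {s s' : ℕ → Site} (k : ℕ) (h : ∀ i < k, s i = s' i) (v : ℕ) :
    maxSrc s k v = maxSrc s' k v := by
  induction k generalizing v with
  | zero => rfl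
  | succ k ih => rw [maxSrc, maxSrc, h k (by omega), ih fun i hi => h i (by omega)]

theorem IsGoodBlock.congr {N : ℕ} {s s' : ℕ → Site} (hs : IsGoodBlock N s)
    (h : ∀ i < N + 1, s i = s' i) : IsGoodBlock N s' := by
  have h' : ∀ i < N, s i = s' i := fun i hi => h i (by omega)
  obtain ⟨h1, h2, h3⟩ := hs
  rw [h 0 (by omega), h N (by omega)] at h1
  rw [h N (by omega)] at h2 h3
  refine ⟨fun u hu v hv => ?_, fun v hv w hw => ?_, fun v hv w hw => ?_⟩
  · rw [← pathCount_congr u N h']; exact h1 u hu v hv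
  · rw [← minSrc_congr N h', ← minSrc_congr N h']; exact h2 v hv w hw
  · rw [← maxSrc_congr N h', ← maxSrc_congr N h']; exact h3 v hv w hw

/-- The set is the preimage of a subset of a countable discrete space under finitely many sites.
Good blocks are stated with raw sites and natural numbers so that this applies. -/
theorem measurableSet_of_site {P : (ℕ → Site) → Prop} {n : ℕ}
    (hP : ∀ s s', P s → (∀ i < n, s i = s' i) → P s') :
    MeasurableSet {x : OrderedBratteli | P x.site} := by
  let _ : MeasurableSpace Site := ⊤
  let r : OrderedBratteli → Fin n → Site := fun x i => x.site i
  have hr : Measurable r := by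
    refine measurable_pi_iff.2 fun i => ?_
    refine Measurable.mono (comap_measurable fun x : OrderedBratteli => x.site i) ?_ le_rfl
    exact le_iSup (fun k : ℕ => MeasurableSpace.comap (fun x : OrderedBratteli => x.site k) ⊤) i
  have : {x : OrderedBratteli | P x.site} = r ⁻¹' (r '' {x | P x.site}) := by
    refine (Set.subset_preimage_image _ _).antisymm ?_
    rintro y ⟨x, hx, hxy⟩
    exact hP _ _ hx fun i hi => congrFun hxy ⟨i, hi⟩
  rw [this]
  exact hr (Set.to_countable _).measurableSet

theorem measurableSet_isGoodBlock (N : ℕ) :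
    MeasurableSet {x : OrderedBratteli | IsGoodBlock N x.site} :=
  measurableSet_of_site (n := N + 1) fun _ _ h h' => h.congr h'

variable {x : OrderedBratteli}

theorem siteList_site (k : ℕ) (v : x.V (k + 1)) :
    siteList (x.site k) v = (x.into k v).map Fin.val := dif_pos v.2

theorem ht_eq_sum_pathCount (l : x.V 0 → ℝ) (k : ℕ) (v : x.V k) :
    ht l k v = ∑ u : x.V 0, (pathCount x.site u k v : ℝ) * l u := by
  induction k with
  | zero => simp [pathCount, Fin.val_inj]
  | succ k ih =>
    rw [ht_succ]
    simp only [ih]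
    rw [Finset.sum_comm]
    refine Finset.sum_congr rfl fun u _ => ?_
    rw [← Finset.sum_mul, pathCount, siteList_site, List.map_map]
    congr 1
    rw [← List.sum_ofFn, Nat.cast_list_sum, List.map_map]
    congr 1
    apply List.ext_getElem <;> simp

theorem minSrc_site {p : x.PathSpace} (k : ℕ) (h : ∀ i < k, IsMinEdge (p.1 i)) :
    minSrc x.site k (src (p.1 k)) = src (p.1 0) := by
  induction k with
  | zero => rfl
  | succ k ih =>
    rw [minSrc, ← ih fun i hi => h i (by omega), siteList_site]
    congr 1
    have h1 := h k (by omega)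
    rw [← p.2 k, h1.eq_minEdge, ran_minEdge]
    generalize ran (p.1 k) = v
    have := x.into_ne_nil k v
    simp only [src, minEdge, List.get_eq_getElem]
    rw [List.headD_eq_head?_getD, List.head?_map, List.head?_eq_some_head this]
    simp [List.head_eq_getElem]

theorem maxSrc_site {p : x.PathSpace} (k : ℕ) (h : ∀ i < k, IsMaxEdge (p.1 i)) :
    maxSrc x.site k (src (p.1 k)) = src (p.1 0) := by
  induction k with
  | zero => rfl
  | succ k ih =>
    rw [maxSrc, ← ih fun i hi => h i (by omega), siteList_site]
    congr 1
    have h1 := h k (by omega)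
    rw [← p.2 k, h1.eq_maxEdge, ran_maxEdge]
    generalize ran (p.1 k) = v
    have := x.into_ne_nil k v
    simp only [src, maxEdge, List.get_eq_getElem]
    rw [List.getLastD_eq_getLast?, List.getLast?_map, List.getLast?_eq_getLast_of_ne_nil this]
    simp [List.getLast_eq_getElem]

/-- Doubling and common extremal sources persist when levels are added, so one `N` can serve all the
conditions. -/
theorem exists_isGoodBlock (hS : x.StronglyMinimal) (hP : x.ProperlyOrdered) :
    ∃ N, IsGoodBlock N x.site := by
  have h1 : ∀ᶠ N in atTop, ∀ u : x.V 0, ∀ v : x.V N, 2 ≤ pathCount x.site u N v := by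
    rw [eventually_all]
    intro u
    -- With weight 1 at `u` and 0 elsewhere, heights count the paths from `u`; this is why doubling
    -- is available for weights that may vanish.
    have hl : ∀ v, 0 ≤ (Pi.single u 1 : x.V 0 → ℝ) v := fun v => by
      by_cases h : v = u
      · subst h; simp
      · simp [h]
    obtain ⟨M, -, hM⟩ := hS.two_mul_ht_le hl 0
    filter_upwards [eventually_ge_atTop M] with N hN v
    have := le_ht_of_le hl (hM u) hN v
    rw [ht_eq_sum_pathCount _ N v] at this
    simp [Pi.single_apply] at this
    exact_mod_cast this
  obtain ⟨M₁, -, hM₁⟩ := hP.exists_level_min 0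
  obtain ⟨M₂, -, hM₂⟩ := hP.exists_level_max 0
  obtain ⟨N, hN, hN₁, hN₂⟩ := (h1.and ((eventually_ge_atTop M₁).and (eventually_ge_atTop M₂))).exists
  refine ⟨N, fun u hu v hv => hN ⟨u, hu⟩ ⟨v, hv⟩, fun v hv w hw => ?_, fun v hv w hw => ?_⟩
  · have key : ∀ v : x.V N, ∃ p : x.PathSpace, src (p.1 N) = v ∧ ∀ i < N, IsMinEdge (p.1 i) := by
      intro v
      obtain ⟨p, hp⟩ := exists_path_through N v
      obtain ⟨q, hq, hq'⟩ := exists_min_below p N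
      exact ⟨q, by rw [hq' N le_rfl, hp], hq⟩
    obtain ⟨p, hp, hp'⟩ := key ⟨v, hv⟩
    obtain ⟨q, hq, hq'⟩ := key ⟨w, hw⟩
    have e1 := minSrc_site N hp'
    have e2 := minSrc_site N hq'
    rw [hp] at e1
    rw [hq] at e2
    exact e1.trans ((congrArg Fin.val (hM₁ p q (fun i _ hi => hp' i (by omega))
      fun i _ hi => hq' i (by omega))).trans e2.symm)
  · have key : ∀ v : x.V N, ∃ p : x.PathSpace, src (p.1 N) = v ∧ ∀ i < N, IsMaxEdge (p.1 i) := by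
      intro v
      obtain ⟨p, hp⟩ := exists_path_through N v
      obtain ⟨q, hq, hq'⟩ := exists_max_below p N
      exact ⟨q, by rw [hq' N le_rfl, hp], hq⟩
    obtain ⟨p, hp, hp'⟩ := key ⟨v, hv⟩
    obtain ⟨q, hq, hq'⟩ := key ⟨w, hw⟩
    have e1 := maxSrc_site N hp'
    have e2 := maxSrc_site N hq'
    rw [hp] at e1
    rw [hq] at e2
    exact e1.trans ((congrArg Fin.val (hM₂ p q (fun i _ hi => hp' i (by omega))
      fun i _ hi => hq' i (by omega))).trans e2.symm)

/-- The levels from `k` to `N + k` double all weights, and the minimal paths as well as the maximal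
paths through them have a common source. -/
structure IsBlock (x : OrderedBratteli) (N k : ℕ) : Prop where
  two_mul_ht_le : ∀ l : x.V 0 → ℝ, (∀ v, 0 ≤ l v) → ∀ (u : x.V k) (w : x.V (N + k)),
    2 * ht l k u ≤ ht l (N + k) w
  src_eq_of_min : ∀ p q : x.PathSpace, (∀ i, k ≤ i → i < N + k → IsMinEdge (p.1 i)) →
    (∀ i, k ≤ i → i < N + k → IsMinEdge (q.1 i)) → src (p.1 k) = src (q.1 k)
  src_eq_of_max : ∀ p q : x.PathSpace, (∀ i, k ≤ i → i < N + k → IsMaxEdge (p.1 i)) →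
    (∀ i, k ≤ i → i < N + k → IsMaxEdge (q.1 i)) → src (p.1 k) = src (q.1 k)

theorem IsGoodBlock.isBlock {N : ℕ} (h : IsGoodBlock N x.site) : IsBlock x N 0 where
  two_mul_ht_le l hl u w := by
    change 2 * ht l 0 u ≤ ht l N w
    have h1 : (2 : ℝ) ≤ pathCount x.site u N w := by exact_mod_cast h.1 u u.2 w w.2
    rw [ht_zero, ht_eq_sum_pathCount]
    refine (mul_le_mul_of_nonneg_right h1 (hl u)).trans ?_
    exact Finset.single_le_sum (f := fun u : x.V 0 => (pathCount x.site u N w : ℝ) * l u)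
      (fun u _ => mul_nonneg (by positivity) (hl u)) (Finset.mem_univ u)
  src_eq_of_min p q hp hq := by
    have e1 := minSrc_site N fun i hi => hp i (Nat.zero_le i) hi
    have e2 := minSrc_site N fun i hi => hq i (Nat.zero_le i) hi
    exact Fin.ext (e1.symm.trans ((h.2.1 _ (src (p.1 N)).2 _ (src (q.1 N)).2).trans e2))
  src_eq_of_max p q hp hq := by
    have e1 := maxSrc_site N fun i hi => hp i (Nat.zero_le i) hi
    have e2 := maxSrc_site N fun i hi => hq i (Nat.zero_le i) hi
    exact Fin.ext (e1.symm.trans ((h.2.2 _ (src (p.1 N)).2 _ (src (q.1 N)).2).trans e2))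

/-- The shifted diagram, started with the heights of level 1 as weights, runs the same recursion.
`IsBlock` allows all non-negative weights so that it passes through the shift. -/
theorem ht_shift (l : x.V 0 → ℝ) (k : ℕ) (v : x.V (k + 1)) :
    ht (x := x.shift) (ht (x := x) l 1) k v = ht l (k + 1) v := by
  induction k with
  | zero => exact ht_zero (x := x.shift) _ v
  | succ k ih =>
    rw [ht_succ (x := x) l (k + 1) v]
    exact (ht_succ (x := x.shift) _ k v).trans (Finset.sum_congr rfl fun j _ => ih _)

/-- The path in the shifted diagram that forgets the first edge. -/
def shiftPath (p : x.PathSpace) : x.shift.PathSpace :=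
  ⟨fun i => p.1 (i + 1), fun i => p.2 (i + 1)⟩

/-- With levels written as `N + k`, the vertex sets on both sides agree by definition; with `k + N`
they would not. -/
theorem IsBlock.of_shift {N k : ℕ} (h : IsBlock x.shift N k) : IsBlock x N (k + 1) where
  two_mul_ht_le l hl u w := by
    have := h.two_mul_ht_le (ht (x := x) l 1) (fun v => ht_nonneg (x := x) hl 1 v) u w
    rw [ht_shift, ht_shift] at this
    exact this
  src_eq_of_min p q hp hq :=
    h.src_eq_of_min (shiftPath p) (shiftPath q)
      (fun i hi hi' => hp (i + 1) (by omega) (by omega))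
      fun i hi hi' => hq (i + 1) (by omega) (by omega)
  src_eq_of_max p q hp hq :=
    h.src_eq_of_max (shiftPath p) (shiftPath q)
      (fun i hi hi' => hp (i + 1) (by omega) (by omega))
      fun i hi hi' => hq (i + 1) (by omega) (by omega)

theorem isBlock_of_iterate_shift {N : ℕ} (k : ℕ) :
    ∀ {x : OrderedBratteli}, IsGoodBlock N (shift^[k] x).site → IsBlock x N k := by
  induction k with
  | zero => exact fun h => h.isBlock
  | succ k ih => exact fun h => (ih h).of_shift

/-! ### The growth rate exceeds one -/

/-- Each visit to `E` doubles the smallest height `N` levels later. If `λ ≤ 1`, heights grow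
subexponentially, so the visits would have frequency zero. -/
theorem one_lt_of_isKFRegular {N : ℕ} {lam : ℝ} (hK : x.IsKFRegular lam)
    {E : Set OrderedBratteli} (hE : ∀ k, shift^[k] x ∈ E → IsBlock x N k)
    (hx : ¬ Tendsto (fun n => birkhoffAverage ℝ shift (E.indicator fun _ => (1 : ℝ)) n x)
      atTop (𝓝 0)) : 1 < lam := by
  by_contra! hlam
  refine hx ?_
  have : ∀ k, Nonempty (x.V k) := fun k => ⟨⟨0, x.nV_pos k⟩⟩
  let b : ℕ → ℝ := fun n => Finset.univ.inf' Finset.univ_nonempty (ht (x := x) 1 n)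
  have h0 : ∀ v, 0 ≤ (1 : x.V 0 → ℝ) v := fun _ => zero_le_one
  have hb : ∀ n v, b n ≤ ht 1 n v := fun n v => Finset.inf'_le _ (Finset.mem_univ v)
  have hle : ∀ n c, (∀ v, c ≤ ht (x := x) 1 n v) → c ≤ b n := fun n c h =>
    Finset.le_inf' _ _ fun v _ => h v
  have hmono : Monotone b := fun m n hmn => hle n _ (le_ht_of_le h0 (hb m) hmn)
  have hb1 : ∀ n, 1 ≤ b n := fun n =>
    (hle 0 1 fun v => by simp).trans (hmono (Nat.zero_le n))
  have hb0 : ∀ n, 0 < b n := fun n => zero_lt_one.trans_le (hb1 n)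
  let g : ℕ → ℝ := fun n => Real.log (b n)
  have hgm : Monotone g := fun m n hmn => Real.log_le_log (hb0 m) (hmono hmn)
  have hg0 : ∀ n, 0 ≤ g n := fun n => Real.log_nonneg (hb1 n)
  have hstep : ∀ k, E.indicator (fun _ => (1 : ℝ)) (shift^[k] x) * Real.log 2 ≤ g (N + k) - g k := by
    intro k
    by_cases hk : shift^[k] x ∈ E
    · rw [Set.indicator_of_mem hk, one_mul, le_sub_iff_add_le, ← Real.log_mul (by norm_num) (hb0 k).ne']
      refine Real.log_le_log (mul_pos two_pos (hb0 k)) (hle _ _ fun w => ?_)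
      have := (hE k hk).two_mul_ht_le 1 h0 ⟨0, x.nV_pos k⟩ w
      linarith [hb k ⟨0, x.nV_pos k⟩]
    · rw [Set.indicator_of_notMem hk, zero_mul, sub_nonneg]
      exact hgm (by omega)
  -- The increments over `N` levels telescope to `N` boundary terms, each at most `g (N + n)` by
  -- monotonicity.
  have hsum : ∀ n, birkhoffSum shift (E.indicator fun _ => (1 : ℝ)) n x * Real.log 2 ≤ N * g (N + n) := by
    intro n
    have e1 := Finset.sum_range_add g N n
    have e2 := Finset.sum_range_add g n N
    rw [add_comm n N] at e2
    calc birkhoffSum shift (E.indicator fun _ => (1 : ℝ)) n x * Real.log 2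
        ≤ ∑ k ∈ Finset.range n, (g (N + k) - g k) := by
          rw [birkhoffSum, Finset.sum_mul]
          exact Finset.sum_le_sum fun k _ => hstep k
      _ = ∑ i ∈ Finset.range N, g (n + i) - ∑ i ∈ Finset.range N, g i := by
          rw [Finset.sum_sub_distrib]; linarith
      _ ≤ ∑ i ∈ Finset.range N, g (n + i) :=
          sub_le_self _ (Finset.sum_nonneg fun i _ => hg0 i)
      _ ≤ ∑ _i ∈ Finset.range N, g (N + n) :=
          Finset.sum_le_sum fun i hi => hgm (by have := Finset.mem_range.1 hi; omega)
      _ = N * g (N + n) := by simp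
  set c : ℕ → ℝ := fun n => Real.log ‖(x.cocycle n).mulVec 1‖ with hc
  have hgc : ∀ n, g n ≤ c n := fun n =>
    Real.log_le_log (hb0 n) ((hb n ⟨0, x.nV_pos n⟩).trans
      ((le_abs_self _).trans (norm_le_pi_norm ((x.cocycle n).mulVec 1) ⟨0, x.nV_pos n⟩)))
  have hlim : Tendsto (fun n => c n / n) atTop (𝓝 (Real.log lam)) := hK.2 1 fun _ => one_pos
  have hlim2 : Tendsto (fun n : ℕ => c (N + n) / n) atTop (𝓝 (Real.log lam)) := by
    have h1 := (hlim.comp (tendsto_add_atTop_nat N))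
    have h2 : Tendsto (fun n : ℕ => ((n + N : ℕ) : ℝ) / n) atTop (𝓝 1) := by
      have := (tendsto_const_div_atTop_nhds_zero_nat (N : ℝ)).const_add 1
      rw [add_zero] at this
      refine this.congr' ?_
      filter_upwards [eventually_gt_atTop 0] with n hn
      have : (n : ℝ) ≠ 0 := by positivity
      push_cast
      field_simp
    have h3 := h1.mul h2
    rw [mul_one] at h3
    refine h3.congr' ?_
    filter_upwards [eventually_gt_atTop 0] with n hn
    have : ((n + N : ℕ) : ℝ) ≠ 0 := by positivity
    simp only [Function.comp]
    rw [add_comm N n]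
    field_simp
  have hl2 : 0 < Real.log 2 := Real.log_pos one_lt_two
  have hub : ∀ n, birkhoffAverage ℝ shift (E.indicator fun _ => (1 : ℝ)) n x ≤
      (N / Real.log 2) * (c (N + n) / n) := by
    intro n
    change (n : ℝ)⁻¹ * birkhoffSum shift _ n x ≤ _
    have h1 : birkhoffSum shift (E.indicator fun _ => (1 : ℝ)) n x ≤ N * c (N + n) / Real.log 2 := by
      rw [le_div_iff₀ hl2]
      exact (hsum n).trans (mul_le_mul_of_nonneg_left (hgc _) (by positivity))
    calc (n : ℝ)⁻¹ * birkhoffSum shift _ n x ≤ (n : ℝ)⁻¹ * (N * c (N + n) / Real.log 2) :=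
          mul_le_mul_of_nonneg_left h1 (by positivity)
      _ = _ := by ring
  have hnn : ∀ n, 0 ≤ birkhoffAverage ℝ shift (E.indicator fun _ => (1 : ℝ)) n x := fun n =>
    mul_nonneg (by positivity)
      (Finset.sum_nonneg fun _ _ => Set.indicator_nonneg (fun _ _ => zero_le_one) _)
  have hlim3 := hlim2.const_mul (N / Real.log 2)
  have hge := ge_of_tendsto' hlim3 fun n => (hnn n).trans (hub n)
  have hle' : N / Real.log 2 * Real.log lam ≤ 0 :=
    mul_nonpos_of_nonneg_of_nonpos (by positivity) (Real.log_nonpos hK.1.le hlam)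
  rw [le_antisymm hle' hge] at hlim3
  exact squeeze_zero hnn hub hlim3

theorem ae_exists_isBlock {μ : Measure OrderedBratteli} [IsProbabilityMeasure μ]
    (hergodic : Ergodic OrderedBratteli.shift μ) (hminimal : ∀ᵐ x ∂μ, x.StronglyMinimal)
    (hproper : ∀ᵐ x ∂μ, x.ProperlyOrdered) :
    ∃ N, ∀ᵐ x ∂μ, (∀ q : ℕ, 0 < q → ∃ n₀, ∀ n, n₀ ≤ n → ∃ k, n ≤ k ∧ k ≤ n + n / q ∧ IsBlock x N k) ∧
      ∀ lam, x.IsKFRegular lam → 1 < lam := by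
  -- Almost every diagram has some good `N`, so one of countably many has positive measure.
  have hex : ∃ N, μ {x | IsGoodBlock N x.site} ≠ 0 := by
    by_contra! hcon
    have h1 : ∀ᵐ x ∂μ, ∀ N, ¬ IsGoodBlock N x.site := ae_all_iff.2 fun N => by
      rw [ae_iff]; simpa using hcon N
    obtain ⟨x, hx, hS, hP⟩ := (h1.and (hminimal.and hproper)).exists
    obtain ⟨N, hN⟩ := exists_isGoodBlock hS hP
    exact hx N hN
  obtain ⟨N, hN⟩ := hex
  refine ⟨N, ?_⟩
  filter_upwards [hergodic.ae_exists_visit_le (measurableSet_isGoodBlock N) hN,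
    hergodic.ae_not_tendsto_birkhoffAverage_indicator (measurableSet_isGoodBlock N) hN] with x h1 h2
  refine ⟨fun q hq => ?_, fun lam hK =>
    one_lt_of_isKFRegular hK (fun k hk => isBlock_of_iterate_shift k hk) h2⟩
  obtain ⟨n₀, hn₀⟩ := h1 q hq
  refine ⟨n₀, fun n hn => ?_⟩
  obtain ⟨k, hk1, hk2, hk3⟩ := hn₀ n hn
  exact ⟨k, hk1, hk2, isBlock_of_iterate_shift k hk3⟩

end OrderedBratteli

namespace OrderedBratteli

variable {x : OrderedBratteli} {lam : ℝ} {l : x.V 0 → ℝ}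

/-! ### The lower bound for the metric of the solenoid -/

theorem src_eq_of_min_of_src_eq {p q : x.PathSpace} {k M : ℕ} (hkM : k ≤ M)
    (hp : ∀ i, k ≤ i → i < M → IsMinEdge (p.1 i)) (hq : ∀ i, k ≤ i → i < M → IsMinEdge (q.1 i))
    (h : src (p.1 M) = src (q.1 M)) : src (p.1 k) = src (q.1 k) := by
  induction M, hkM using Nat.le_induction with
  | base => exact h
  | succ M hM ih =>
    refine ih (fun i h1 h2 => hp i h1 (by omega)) (fun i h1 h2 => hq i h1 (by omega)) ?_
    rw [(hp M hM (by omega)).eq_of_ran_eq (hq M hM (by omega)) (by rw [p.2, q.2, h])]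

theorem src_eq_of_max_of_src_eq {p q : x.PathSpace} {k M : ℕ} (hkM : k ≤ M)
    (hp : ∀ i, k ≤ i → i < M → IsMaxEdge (p.1 i)) (hq : ∀ i, k ≤ i → i < M → IsMaxEdge (q.1 i))
    (h : src (p.1 M) = src (q.1 M)) : src (p.1 k) = src (q.1 k) := by
  induction M, hkM using Nat.le_induction with
  | base => exact h
  | succ M hM ih =>
    refine ih (fun i h1 h2 => hp i h1 (by omega)) (fun i h1 h2 => hq i h1 (by omega)) ?_
    rw [(hp M hM (by omega)).eq_of_ran_eq (hq M hM (by omega)) (by rw [p.2, q.2, h])]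

theorem ht_le_norm (l : x.V 0 → ℝ) (k : ℕ) (v : x.V k) : ht l k v ≤ ‖ht l k‖ :=
  (le_abs_self _).trans (norm_le_pi_norm (ht l k) v)

theorem exists_norm_le_ht (hl : ∀ v, 0 ≤ l v) (k : ℕ) : ∃ v, ‖ht l k‖ ≤ ht l k v := by
  have : Nonempty (x.V k) := ⟨⟨0, x.nV_pos k⟩⟩
  obtain ⟨v, hv⟩ := Finite.exists_max (ht l k)
  refine ⟨v, (pi_norm_le_iff_of_nonneg (ht_nonneg hl k v)).2 fun w => ?_⟩
  rw [Real.norm_of_nonneg (ht_nonneg hl k w)]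
  exact hv w

theorem Admissible.norm_ht_pos (hA : Admissible lam l) (k : ℕ) : 0 < ‖ht l k‖ :=
  (ht_pos hA.pos k ⟨0, x.nV_pos k⟩).trans_le (ht_le_norm l k _)

/-- For a fixed `n` no growth is needed: compactness provides a level for the extremal sources, and
the least roof value serves as `m`, since all remainders exceed it. -/
theorem exists_le_solenoidDist_of_ne (hA : Admissible lam l) (hS : x.StronglyMinimal)
    (hP : x.ProperlyOrdered) (n : ℕ) : ∃ c, 0 < c ∧ ∀ p q : x.PathSpace, p.1 n ≠ q.1 n →
      c ≤ solenoidDist (baseParam hA (p, 0)) (baseParam hA (q, 0)) := by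
  obtain ⟨M₁, hn₁, hM₁⟩ := hP.exists_level_min (n + 1)
  obtain ⟨M₂, hn₂, hM₂⟩ := hP.exists_level_max (n + 1)
  obtain ⟨m, hm, hml⟩ := exists_pos_le hA.pos
  have hB := hA.norm_ht_pos (max M₁ M₂)
  have hV : (0 : ℝ) < x.nV (max M₁ M₂) := by exact_mod_cast x.nV_pos _
  refine ⟨(lam⁻¹) ^ (max M₁ M₂) * (m / (x.nV (max M₁ M₂) * ‖ht l (max M₁ M₂)‖)),
    mul_pos (hA.scale_pos _) (by positivity), fun p q hne => ?_⟩
  refine le_solenoidDist_of_le_graphDist hA hm (ht_le_norm l _) ?_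
  refine le_graphDist_baseParam hA hS (by omega) hne hm.le
    (fun i _ u => le_ht_of_le hA.nonneg (k := 0) (by simpa using hml) (Nat.zero_le i) u)
    (Or.inl ⟨(hml _).trans (le_rest hA.nonneg p n), (hml _).trans (le_rest hA.nonneg q n)⟩) ?_ ?_
  · exact fun p q hp hq => hM₁ p q (fun i h1 h2 => hp i h1 (by omega))
      fun i h1 h2 => hq i h1 (by omega)
  · exact fun p q hp hq => hM₂ p q (fun i h1 h2 => hp i h1 (by omega))
      fun i h1 h2 => hq i h1 (by omega)

theorem exists_le_solenoidDist_of_ne_below (hA : Admissible lam l) (hS : x.StronglyMinimal)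
    (hP : x.ProperlyOrdered) (n₀ : ℕ) : ∃ c, 0 < c ∧ ∀ n < n₀, ∀ p q : x.PathSpace, p.1 n ≠ q.1 n →
      c ≤ solenoidDist (baseParam hA (p, 0)) (baseParam hA (q, 0)) := by
  induction n₀ with
  | zero => exact ⟨1, one_pos, fun n hn => absurd hn (Nat.not_lt_zero n)⟩
  | succ n₀ ih =>
    obtain ⟨c, hc, h⟩ := ih
    obtain ⟨c', hc', h'⟩ := exists_le_solenoidDist_of_ne hA hS hP n₀
    refine ⟨min c c', lt_min hc hc', fun n hn p q hne => ?_⟩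
    rcases (Nat.lt_succ_iff_lt_or_eq.1 hn) with hn | rfl
    · exact (min_le_left _ _).trans (h n hn p q hne)
    · exact (min_le_right _ _).trans (h' p q hne)

/-- Two paths that separate between two blocks are separated in the solenoid, on the scale that
the blocks determine. -/
theorem le_solenoidDist_of_isBlock (hA : Admissible lam l) (hS : x.StronglyMinimal)
    {p q : x.PathSpace} {n N k k' : ℕ} (hn : 0 < n) (heq : ∀ i < n, p.1 i = q.1 i) (hne : p.1 n ≠ q.1 n)
    (hk' : IsBlock x N k') (hkn' : N + k' ≤ n) (hk : IsBlock x N k) (hkn : n + 1 ≤ k) :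
    (lam⁻¹) ^ (N + k) * (‖ht l k'‖ / (x.nV (N + k) * ‖ht l (N + k)‖)) ≤
      solenoidDist (baseParam hA (p, 0)) (baseParam hA (q, 0)) := by
  have hl := hA.nonneg
  have hm := hA.norm_ht_pos k'
  obtain ⟨u, hu⟩ := exists_norm_le_ht hl k'
  have h2m : ∀ i, n ≤ i → ∀ w : x.V i, 2 * ‖ht l k'‖ ≤ ht l i w := fun i hi w =>
    le_ht_of_le hl (fun w => (by linarith [hk'.two_mul_ht_le l hl u w] :
      2 * ‖ht l k'‖ ≤ ht l (N + k') w)) (hkn'.trans hi) w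
  refine le_solenoidDist_of_le_graphDist hA hm (ht_le_norm l _) ?_
  refine le_graphDist_baseParam hA hS (by omega) hne hm.le
    (fun i hi w => by linarith [h2m i hi w]) ?_ ?_ ?_
  -- At level `n` both paths are on the same floor of the same tower (a common edge exists as `n >
  -- 0`), whose height is at least twice the norm at `k'`; so the part below or the part above is at
  -- least once that norm.
  · have hh := hgt_congr l heq
    have hr : rest l p n = rest l q n := by
      rw [rest, rest, hh, src_eq_of_eq_below heq (congrArg src (heq 0 hn))]
    have hs := hgt_add_rest l p n
    have := h2m n le_rfl (src (p.1 n))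
    rw [← hr, ← hh]
    by_contra! hcon
    have h1 : rest l p n < ‖ht l k'‖ := not_le.1 fun h => absurd (hcon.1 h) (by linarith)
    have h2 : hgt l p n < ‖ht l k'‖ := not_le.1 fun h => absurd (hcon.2 h) (by linarith)
    linarith
  · intro p q hp hq
    refine src_eq_of_min_of_src_eq hkn (fun i h1 h2 => hp i h1 (by omega))
      (fun i h1 h2 => hq i h1 (by omega)) ?_
    exact hk.src_eq_of_min p q (fun i h1 h2 => hp i (by omega) h2) fun i h1 h2 => hq i (by omega) h2
  · intro p q hp hq
    refine src_eq_of_max_of_src_eq hkn (fun i h1 h2 => hp i h1 (by omega))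
      (fun i h1 h2 => hq i h1 (by omega)) ?_
    exact hk.src_eq_of_max p q (fun i h1 h2 => hp i (by omega) h2) fun i h1 h2 => hq i (by omega) h2

theorem IsKFRegular.exists_norm_ht_bounds (hK : x.IsKFRegular lam) (hl : ∀ v, 0 < l v) {δ : ℝ}
    (hδ : 0 < δ) : ∃ n₀, ∀ n : ℕ, n₀ ≤ n → Real.exp ((Real.log lam - δ) * n) ≤ ‖ht l n‖ ∧
      ‖ht l n‖ ≤ Real.exp ((Real.log lam + δ) * n) := by
  have h := hK.2 l hl
  have h1 := h.eventually_const_le (show Real.log lam - δ < _ by linarith)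
  have h2 := h.eventually_le_const (show _ < Real.log lam + δ by linarith)
  obtain ⟨n₀, hn₀⟩ := eventually_atTop.1 (h1.and (h2.and (eventually_gt_atTop 0)))
  refine ⟨n₀, fun n hn => ?_⟩
  obtain ⟨h1, h2, h3⟩ := hn₀ n hn
  have hn0 : (0 : ℝ) < n := by exact_mod_cast h3
  have hpos : 0 < ‖ht l n‖ := (ht_pos hl n ⟨0, x.nV_pos n⟩).trans_le (ht_le_norm l n _)
  constructor
  · rw [← Real.le_log_iff_exp_le hpos]
    exact (le_div_iff₀ hn0).1 h1
  · rw [← Real.log_le_iff_le_exp hpos]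
    exact (div_le_iff₀ hn0).1 h2

/-- With `k'` and `N + k` both `n (1 + O(s)) + O(1)`, the bound given by the blocks has exponent `(L
- δ) k' - (2L + 2δ)(N + k)`, which is close to `-n L`. -/
theorem exists_le_solenoidDist_of_large (hA : Admissible lam l) (hS : x.StronglyMinimal)
    (hV : x.SubexponentialVertices) (hK : x.IsKFRegular lam) {N : ℕ}
    (hblock : ∀ q : ℕ, 0 < q → ∃ n₀, ∀ n, n₀ ≤ n → ∃ k, n ≤ k ∧ k ≤ n + n / q ∧ IsBlock x N k)
    {ε : ℝ} (hε : 0 < ε) (hε₁ : ε < 1) :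
    ∃ c n₀, 0 < c ∧ ∀ n, n₀ ≤ n → ∀ p q : x.PathSpace, (∀ i < n, p.1 i = q.1 i) → p.1 n ≠ q.1 n →
      c * ((lam⁻¹) ^ n) ^ (1 + ε) ≤ solenoidDist (baseParam hA (p, 0)) (baseParam hA (q, 0)) := by
  have hlam := hA.lam_pos
  set L := Real.log lam with hL
  have hL0 : 0 < L := Real.log_pos hA.one_lt
  -- The total loss per level is at most `4δ + 3Ls`. The choices `δ = εL/8` and `s ≤ ε/6` make each
  -- of these two terms at most `εL/2`.
  obtain ⟨δ, hδ⟩ : ∃ δ, δ = ε * L / 8 := ⟨_, rfl⟩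
  have hδ0 : 0 < δ := by rw [hδ]; positivity
  have hδL : δ ≤ L := by rw [hδ]; nlinarith
  obtain ⟨a, ha⟩ := exists_nat_gt (6 / ε)
  have ha0 : 0 < a := by
    have : (0 : ℝ) < a := (by positivity : (0 : ℝ) < 6 / ε).trans ha
    exact_mod_cast this
  have haR : (0 : ℝ) < a := by exact_mod_cast ha0
  have ha2 : 2 ≤ a := by
    have h6 : (6 : ℝ) < 6 / ε := by rw [lt_div_iff₀ hε]; linarith
    have : (2 : ℝ) ≤ a := by linarith
    exact_mod_cast this
  set s : ℝ := 1 / a with hs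
  have hs0 : 0 < s := by positivity
  have hsε : s ≤ ε / 6 := by
    rw [hs, div_le_div_iff₀ haR (by norm_num)]
    rw [div_lt_iff₀ hε] at ha
    linarith
  obtain ⟨n₁, hn₁⟩ := hblock a ha0
  obtain ⟨n₂, hn₂⟩ := hK.exists_norm_ht_bounds hA.pos hδ0
  obtain ⟨K, hKV⟩ := hV δ hδ0
  have hK0 : 0 < K := by
    have h1 := hKV 0
    have h2 : (0 : ℝ) < x.nV 0 := by exact_mod_cast x.nV_pos 0
    simp only [Nat.cast_zero, mul_zero, Real.exp_zero, mul_one] at h1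
    linarith
  -- The constant collects the terms independent of `n`, with `N + 1 + s ≤ N + 2`; the threshold
  -- puts both searches for blocks beyond `n₁` and the levels used beyond `n₂`.
  refine ⟨Real.exp (-((2 * L + 2 * δ) * (N + 2) + L * N)) / K, 2 * (n₁ + n₂ + N) + 1, by positivity,
    fun n hn p q heq hne => ?_⟩
  have hdiv : n / a ≤ n / 2 := Nat.div_le_div_left ha2 (by norm_num)
  -- The search starts `n / a` levels early, so even after the largest admissible gap the block ends
  -- by level `n`.
  obtain ⟨k', hk1', hk2', hk'⟩ := hn₁ (n - N - n / a) (by omega)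
  obtain ⟨k, hk1, hk2, hk⟩ := hn₁ (n + 1) (by omega)
  have hle : (n - N - n / a) / a ≤ n / a := Nat.div_le_div_right ((Nat.sub_le _ _).trans (Nat.sub_le _ _))
  have hkn' : N + k' ≤ n := by
    generalize n / a = d at *
    omega
  refine le_trans ?_ (le_solenoidDist_of_isBlock hA hS (by omega) heq hne hk' hkn' hk hk1)
  have hb1 := (hn₂ k' (by omega)).1
  have hb2 := (hn₂ (N + k) (by omega)).2
  have hb3 := hKV (N + k)
  have hnV : (0 : ℝ) < x.nV (N + k) := by exact_mod_cast x.nV_pos _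
  have hM0 := hA.norm_ht_pos (N + k)
  -- the exponents
  have hkR : ((N + k : ℕ) : ℝ) ≤ N + (n + 1) * (1 + s) := by
    have h1 : ((k : ℕ) : ℝ) ≤ ((n + 1 + (n + 1) / a : ℕ) : ℝ) := by exact_mod_cast hk2
    have h2 : (((n + 1) / a : ℕ) : ℝ) ≤ ((n + 1 : ℕ) : ℝ) / a := Nat.cast_div_le
    push_cast at h1 h2 ⊢
    rw [hs, mul_add, mul_one, mul_one_div]
    linarith
  have hkR' : (n : ℝ) * (1 - s) - N ≤ k' := by
    have h1 : ((n : ℕ) : ℝ) ≤ ((k' + N + n / a : ℕ) : ℝ) := by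
      exact_mod_cast (by omega : n ≤ k' + N + n / a)
    have h2 : ((n / a : ℕ) : ℝ) ≤ (n : ℝ) / a := Nat.cast_div_le
    push_cast at h1
    rw [hs, mul_sub, mul_one, mul_one_div]
    linarith
  have hexp : -((2 * L + 2 * δ) * (N + 2) + L * N) - n * L * (1 + ε) ≤
      (L - δ) * k' - (2 * L + 2 * δ) * ((N + k : ℕ) : ℝ) := by
    have h1 := mul_le_mul_of_nonneg_left hkR (by positivity : 0 ≤ 2 * L + 2 * δ)
    have h2 := mul_le_mul_of_nonneg_left hkR' (by linarith : 0 ≤ L - δ)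
    have hn0 : (0 : ℝ) ≤ n := by positivity
    have hs1 : s ≤ 1 := by linarith
    have h3 : (L + 3 * δ + 3 * L * s + δ * s) ≤ L * (1 + ε) := by
      have : L * s ≤ L * (ε / 6) := mul_le_mul_of_nonneg_left hsε hL0.le
      have : δ * s ≤ δ := by nlinarith
      have : 8 * δ = ε * L := by rw [hδ]; ring
      linarith
    have h4 := mul_le_mul_of_nonneg_left h3 hn0
    have h5 : (2 * L + 2 * δ) * s ≤ (2 * L + 2 * δ) * 1 :=
      mul_le_mul_of_nonneg_left hs1 (by positivity)
    have h6 : 0 ≤ δ * N := by positivity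
    nlinarith
  have hscale : ∀ j : ℕ, (lam⁻¹) ^ j = Real.exp (-(j * L)) := fun j => by
    rw [Real.exp_neg, Real.exp_nat_mul, hL, Real.exp_log hlam, inv_pow]
  have hpow : ((lam⁻¹) ^ n) ^ (1 + ε) = Real.exp (-(n * L * (1 + ε))) := by
    rw [hscale, ← Real.exp_mul]; ring_nf
  rw [hpow, hscale]
  have hden : (x.nV (N + k) : ℝ) * ‖ht l (N + k)‖ ≤
      K * Real.exp (δ * ((N + k : ℕ) : ℝ)) * Real.exp ((L + δ) * ((N + k : ℕ) : ℝ)) :=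
    mul_le_mul hb3 hb2 hM0.le (by positivity)
  calc Real.exp (-((2 * L + 2 * δ) * (N + 2) + L * N)) / K * Real.exp (-(n * L * (1 + ε)))
      = Real.exp (-((2 * L + 2 * δ) * (N + 2) + L * N) - n * L * (1 + ε)) / K := by
        rw [sub_eq_add_neg, Real.exp_add]; ring
    _ ≤ Real.exp ((L - δ) * k' - (2 * L + 2 * δ) * ((N + k : ℕ) : ℝ)) / K := by gcongr
    _ = Real.exp (-(((N + k : ℕ) : ℝ) * L)) * (Real.exp ((L - δ) * k') /
        (K * Real.exp (δ * ((N + k : ℕ) : ℝ)) * Real.exp ((L + δ) * ((N + k : ℕ) : ℝ)))) := by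
        rw [mul_assoc, ← Real.exp_add, mul_comm K, ← div_div, ← Real.exp_sub, mul_div_assoc',
          ← Real.exp_add]
        congr 2
        ring
    _ ≤ _ := by
        refine mul_le_mul_of_nonneg_left ?_ (Real.exp_pos _).le
        exact div_le_div₀ (norm_nonneg _) hb1 (mul_pos hnV hM0) hden

theorem exists_mul_pathDist_rpow_le_solenoidDist (hA : Admissible lam l) (hS : x.StronglyMinimal)
    (hP : x.ProperlyOrdered) (hV : x.SubexponentialVertices) (hK : x.IsKFRegular lam) {N : ℕ}
    (hblock : ∀ q : ℕ, 0 < q → ∃ n₀, ∀ n, n₀ ≤ n → ∃ k, n ≤ k ∧ k ≤ n + n / q ∧ IsBlock x N k)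
    {ε : ℝ} (hε : 0 < ε) (hε₁ : ε < 1) :
    ∃ K, 0 < K ∧ ∀ p q : x.PathSpace,
      K * pathDist lam p q ^ (1 + ε) ≤ solenoidDist (baseParam hA (p, 0)) (baseParam hA (q, 0)) := by
  obtain ⟨c, n₀, hc, h⟩ := exists_le_solenoidDist_of_large hA hS hV hK hblock hε hε₁
  obtain ⟨c', hc', h'⟩ := exists_le_solenoidDist_of_ne_below hA hS hP n₀
  refine ⟨min c c', lt_min hc hc', fun p q => ?_⟩
  by_cases hpq : p = q
  · rw [pathDist, if_pos hpq, Real.zero_rpow (by linarith), mul_zero]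
    exact solenoidDist_nonneg hA _ _
  · obtain ⟨n, heq, hne, hd⟩ := exists_first_ne hpq
    rw [hd]
    have hpos : 0 ≤ ((lam⁻¹) ^ n) ^ (1 + ε) := Real.rpow_nonneg (hA.scale_pos n).le _
    rcases le_or_gt n₀ n with hn | hn
    · exact (mul_le_mul_of_nonneg_right (min_le_left _ _) hpos).trans (h n hn p q heq hne)
    · refine le_trans ?_ (h' n hn p q hne)
      have h1 : ((lam⁻¹) ^ n) ^ (1 + ε) ≤ 1 :=
        Real.rpow_le_one (hA.scale_pos n).le
          (pow_le_one₀ (inv_nonneg.2 hA.lam_pos.le) (inv_le_one_of_one_le₀ hA.one_lt.le))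
          (by linarith)
      exact (mul_le_of_le_one_right (lt_min hc hc').le h1).trans (min_le_right _ _)

end OrderedBratteli
-- The theorem: the growth rate enters only through regularity, and the exceptional null set does
-- not depend on it
open OrderedBratteli in
theorem mainTheorem6 (μ : Measure OrderedBratteli) [IsProbabilityMeasure μ]
    (hergodic : Ergodic OrderedBratteli.shift μ)
    (hminimal : ∀ᵐ x ∂μ, x.StronglyMinimal)
    (hproper : ∀ᵐ x ∂μ, x.ProperlyOrdered)
    (hvertices : ∀ᵐ x ∂μ, x.SubexponentialVertices)
    (lam : ℝ) :
    ∀ᵐ x ∂μ, x.IsKFRegular lam →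
      1 < lam ∧
      ∀ l : x.V 0 → ℝ, (∀ v, 0 < l v) →
        ∃ Φ : Flow ℝ (x.Solenoid lam l),
          IsNaturalFlow Φ ∧ (∀ Ψ : Flow ℝ (x.Solenoid lam l), IsNaturalFlow Ψ → Ψ = Φ) ∧
          ∃ ϖ : x.Suspension l ≃ₜ x.Solenoid lam l,
            (∀ (t : ℝ) (y : x.Suspension l), ϖ (specialFlow t y) = Φ t (ϖ y)) ∧
            Set.range (fun p : x.PathSpace => ϖ (base l p)) = x.mho lam l ∧
            (∀ ε : ℝ, 0 < ε → ε < 1 → ∃ K : ℝ, 0 < K ∧ ∀ p q : x.PathSpace,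
              K * pathDist lam p q ^ (1 + ε) ≤ solenoidDist (ϖ (base l p)) (ϖ (base l q))) ∧
            (∀ p q : x.PathSpace, src (p.1 0) = src (q.1 0) →
              solenoidDist (ϖ (base l p)) (ϖ (base l q)) ≤ pathDist lam p q / (lam - 1)) ∧
            (∀ p q : x.PathSpace,
              solenoidDist (ϖ (base l p)) (ϖ (base l q)) ≤
                lam * pathDist lam p q / (lam - 1)) := by
  obtain ⟨N, hN⟩ := ae_exists_isBlock hergodic hminimal hproper
  filter_upwards [hminimal, hproper, hvertices, hN] with x hS hP hV hB hK
  have hlam : 1 < lam := hB.2 lam hK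
  refine ⟨hlam, fun l hl => ?_⟩
  have hA : Admissible lam l := ⟨hlam, hl⟩
  refine ⟨naturalFlow hA hP, isNaturalFlow_naturalFlow hA hP,
    fun Ψ hΨ => hΨ.eq_naturalFlow hA hP hS, suspensionHomeo hA hP,
    suspensionHomeo_specialFlow hA hP, range_suspensionHomeo_base hA hP, ?_⟩
  simp only [suspensionHomeo_base]
  exact ⟨fun ε hε hε₁ => exists_mul_pathDist_rpow_le_solenoidDist hA hS hP hV hK hB.1 hε hε₁,
    fun p q h => solenoidDist_baseParam_le_of_src_eq hA h,
    fun p q => solenoidDist_baseParam_le hA p q⟩
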